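/- **Notation.** Let $n\ge 0$. $U\subset GL_n(\mathbb C)$ is the group of unipotent upper triangular matrices, $B_-\subset GL_n(\mathbb C)$ the group of invertible lower triangular matrices, $\Delta_{I,J}(g)$ the minor of $g$ with rows $I$ and columns $J$, and $I^{\mathrm{op}}=\{n+1-a\mid a\in I\}$. Put $$\Phi_{\rm BK}(g)=\sum_{i=1}^{n-1}\frac{\Delta_{([1,i+1]\setminus\{i\})^{\rm op},[1,i]}(g)+\Delta_{[1,i]^{\rm op},[1,i+1]\setminus\{i\}}(g)}{\Delta_{[1,i]^{\rm op},[1,i]}(g)},$$ $$\Phi_3(g_1,g_2,g_3)=\Phi_{\rm BK}(g_1)+\Phi_{\rm BK}(g_2)+\Phi_{\rm BK}(g_3)-\Phi_{\rm BK}(g_1g_2g_3).$$ Let $\Delta^3(n)=\{\alpha\in\mathbb Z_{\ge0}^3\mid \alpha_1+\alpha_2+\alpha_3\le n\}$. For $\alpha\in\Delta^3(n)$ the multi-corner minor $M_\alpha(g_1,g_2,g_3)$ is the maximal minor of the $n\times 4n$ matrix $[\,1\mid g_1\mid g_1g_2\mid g_1g_2g_3\,]$ on the first $n-\alpha_1-\alpha_2-\alpha_3$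 columns of the first block and the first $\alpha_1,\alpha_2,\alpha_3$ columns of the second, third and fourth block; $M_\alpha=0$ for $\alpha\in\mathbb Z^3\setminus\Delta^3(n)$. The group $U^4$ acts on $GL_n^3$ by $(u_0,u_1,u_2,u_3).(g_1,g_2,g_3)=(u_0g_1u_1^{-1},u_1g_2u_2^{-1},u_2g_3u_3^{-1})$, and $\mathcal M_3=GL_n^3/\!\!/U^4=\operatorname{Spec}\mathbb C[GL_n^3]^{U^4}$. A *small plane rhombus* in $\Delta^3(n)$ is an image, with all vertices in $\Delta^3(n)$, of the rhombus $(0,0,0),(1,0,0),(1,1,0),(0,1,0)$ under a permutation of the four barycentric coordinates and a translation; its vertices are denoted, in the same order, $\alpha_1,\alpha_2,\alpha_3,\alpha_4$, so that $\alpha_1\alpha_3$ is the long and $\alpha_2\alpha_4$ the short diagonal. A *toric chart* on an affine variety $P$ is an open embedding $\theta\colon(\mathbb C^*)^d\hookrightarrow P$. A rational function $f$ on $P$ is *positive* in $\theta$ if $f\circ\theta=p/q$ for Laurent polynomials $p,q$ with nonnegative real coefficients and $q\ne0$ ($f=0$ is allowed). Then $f^t=p^t-q^t$ on $\mathbb R^d$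 with values in $\mathbb R\cup\{-\infty\}$, where $p^t(\xi)$ is the maximum of $\sum_i m_i\xi_i$ over the monomials $x^m$ that occur in $p$ ($-\infty$ if $p=0$); this does not depend on the choice of $p,q$. Two charts are *positively equivalent* if the coordinates of each are positive in the other. A chart defines the positive structure that consists of all charts positively equivalent to it. **Theorem.** 1. All $M_\alpha$ are $U^4$-invariant, hence descend to regular functions $\overline M_\alpha$ on $\mathcal M_3$. The functions $\overline M_{i,j,0}$ and $\overline M_{0,i,j}$ with $i,j\ge0$, $0<i+j\le n$, are the coordinates of a toric chart on $\mathcal M_3$. $\Phi_3$ descends to a rational function $\overline\Phi_3$ on $\mathcal M_3$. In every chart of the positive structure defined by this chart, $\overline\Phi_3$ and all $\overline M_\alpha$ are positive, and their tropicalizations satisfy the following at every point $\xi\in\mathbb R^d$. The octahedron recurrence $$\overline M^t_{i+1,j,k+1}+\overline M^t_{i,j+1,k}=\max\{\overline M^t_{i,j+1,k+1}+\overline M^t_{i+1,j,k},\ \overline M^t_{i,j,k+1}+\overline M^t_{i+1,j+1,k}\}$$ holds for all integers $i,j,k$; and $\overline\Phi_3^t\le0$ if and only if $\overline M^t_{\alpha_1}+\overline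 M^t_{\alpha_3}\le\overline M^t_{\alpha_2}+\overline M^t_{\alpha_4}$ for all small plane rhombi in $\Delta^3(n)$. 2. For $i\ge0$, $j\ge1$, $i+j\le n$ and $b\in B_-$ put $\Delta_{i,j}(b)=\Delta_{[1,j]^{\rm op},[i+1,i+j]}(b)$ and $\Delta_{i,0}(b)=1$. The geometric Gelfand–Zeitlin coordinates $\Delta_{i,j}(g_l)/\Delta_{i,j-1}(g_l)$, $l=1,2,3$, are the coordinates of a toric chart on $B_-^3$. In every chart of the positive structure defined by this chart, the restrictions of $\Phi_3$ and of all $M_\alpha$ to $B_-^3$ are positive, and at every point $\xi\in\mathbb R^d$ the inequality $\Phi_3^t\le0$ implies $M^t_{\alpha_1}+M^t_{\alpha_3}\le M^t_{\alpha_2}+M^t_{\alpha_4}$ for all small plane rhombi in $\Delta^3(n)$. -/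

import Mathlib

open AlgebraicGeometry

noncomputable section

namespace MultiHorn

/-! ### Minors, the Berenstein–Kazhdan potential, multi-corner minors

Rows and columns are indexed by `Fin n`, so the integer `a ∈ [1,n]` of the usual notation is the
element of `Fin n` with value `a - 1`. -/

section Minors

variable {R : Type*} [CommRing R] {m p : Type*} [LinearOrder m] [LinearOrder p]

/-- The minor `Δ_{I,J}(g)`: the determinant of the submatrix of `g` with rows in `I` and columns in
`J`, both taken in increasing order (and `0` if `I` and `J` have different sizes). -/
def minor (g : Matrix m p R) (I : Finset m) (J : Finset p) : R :=
  if h : J.card = I.card then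
    (g.submatrix (I.orderEmbOfFin rfl) (J.orderEmbOfFin h)).det
  else 0

end Minors

/-- The set `[1,i]`. -/
def initial (n i : ℕ) : Finset (Fin n) := Finset.univ.filter fun c => c.val + 1 ≤ i

/-- The set `[1,i+1] \ {i}`. -/
def initialSkip (n i : ℕ) : Finset (Fin n) :=
  Finset.univ.filter fun c => c.val + 1 ≤ i + 1 ∧ c.val + 1 ≠ i

/-- The opposite set `I^op = {n + 1 - a | a ∈ I}`. -/
def opp {n : ℕ} (I : Finset (Fin n)) : Finset (Fin n) := I.image Fin.rev

/-- The set `[i+1,i+j]`. -/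
def interval (n i j : ℕ) : Finset (Fin n) :=
  Finset.univ.filter fun c => i + 1 ≤ c.val + 1 ∧ c.val + 1 ≤ i + j

/-- The Berenstein–Kazhdan potential
`∑_{i=1}^{n-1} (Δ_{([1,i+1]∖{i})^op,[1,i]} + Δ_{[1,i]^op,[1,i+1]∖{i}}) / Δ_{[1,i]^op,[1,i]}`. -/
def bkPotential {K : Type*} [Field K] {n : ℕ} (g : Matrix (Fin n) (Fin n) K) : K :=
  ∑ i ∈ Finset.Ico 1 n,
    (minor g (opp (initialSkip n i)) (initial n i) + minor g (opp (initial n i)) (initialSkip n i)) /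
      minor g (opp (initial n i)) (initial n i)

/-- The potential `Φ₃(g₁,g₂,g₃) = Φ_BK(g₁) + Φ_BK(g₂) + Φ_BK(g₃) - Φ_BK(g₁g₂g₃)`. -/
def potential {K : Type*} [Field K] {n : ℕ} (g : Fin 3 → Matrix (Fin n) (Fin n) K) : K :=
  bkPotential (g 0) + bkPotential (g 1) + bkPotential (g 2) - bkPotential (g 0 * g 1 * g 2)

/-- The `n × 4n` matrix `[1 | g₁ | g₁g₂ | g₁g₂g₃]`; the column `(b, c)` is the `c`-th column of the
block number `b`, and columns are ordered lexicographically, that is from left to right. -/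
def blockMatrix {R : Type*} [CommRing R] {n : ℕ} (g : Fin 3 → Matrix (Fin n) (Fin n) R) :
    Matrix (Fin n) (Fin 4 ×ₗ Fin n) R :=
  Matrix.of fun r bc =>
    (![1, g 0, g 0 * g 1, g 0 * g 1 * g 2] (ofLex bc).1) r (ofLex bc).2

/-- The integer points of the simplex: `Δ³(n) = {α | α_l ≥ 0, α₁ + α₂ + α₃ ≤ n}`. -/
def simplex (n : ℕ) : Set (Fin 3 → ℤ) := {α | (∀ l, 0 ≤ α l) ∧ α 0 + α 1 + α 2 ≤ n}

/-- The set of columns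
`J(α) = ([1,n] ∖ [1,∑α]^op) ∪ ([1,α₁] + n) ∪ ([1,α₂] + 2n) ∪ ([1,α₃] + 3n)`. -/
def columnSet (n : ℕ) (α : Fin 3 → ℤ) : Finset (Fin 4 ×ₗ Fin n) :=
  Finset.univ.filter fun bc =>
    (ofLex bc).2 ∈
      (![(opp (initial n (α 0 + α 1 + α 2).toNat))ᶜ, initial n (α 0).toNat,
        initial n (α 1).toNat, initial n (α 2).toNat] (ofLex bc).1)

open Classical in
/-- The multi-corner minor `M_α(g₁,g₂,g₃) = Δ_{[1,n],J(α)}([1 | g₁ | g₁g₂ | g₁g₂g₃])` for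
`α ∈ Δ³(n)`, with the convention `M_α = 0` for `α ∉ Δ³(n)`. -/
def multiCorner {R : Type*} [CommRing R] {n : ℕ} (g : Fin 3 → Matrix (Fin n) (Fin n) R)
    (α : Fin 3 → ℤ) : R :=
  if α ∈ simplex n then minor (blockMatrix g) Finset.univ (columnSet n α) else 0

/-! ### Small plane rhombi -/

/-- The points `(0,0,0), (1,0,0), (0,1,0), (0,0,1)`, the vertices of `Δ³(1)`. -/
def vertex : Fin 4 → Fin 3 → ℤ := ![![0, 0, 0], ![1, 0, 0], ![0, 1, 0], ![0, 0, 1]]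

/-- `α₁ α₂ α₃ α₄` are the consecutive vertices of a small rhombus in `Δ³(n)` with long diagonal
`α₁α₃` and short diagonal `α₂α₄`: the image of the rhombus `(0,0,0), (1,0,0), (1,1,0), (0,1,0)`
under a permutation of the four barycentric coordinates and a translation. -/
def IsSmallRhombus (n : ℕ) (α₁ α₂ α₃ α₄ : Fin 3 → ℤ) : Prop :=
  (∃ a b c : Fin 4, a ≠ b ∧ a ≠ c ∧ b ≠ c ∧
    α₂ = α₁ + (vertex b - vertex a) ∧
    α₄ = α₁ + (vertex c - vertex a) ∧
    α₃ = α₁ + (vertex b - vertex a) + (vertex c - vertex a)) ∧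
  α₁ ∈ simplex n ∧ α₂ ∈ simplex n ∧ α₃ ∈ simplex n ∧ α₄ ∈ simplex n

/-- The rhombus inequalities `T(α₁) + T(α₃) ≤ T(α₂) + T(α₄)` for all small plane rhombi in
`Δ³(n)`. -/
def RhombusInequalities (n : ℕ) (T : (Fin 3 → ℤ) → WithBot ℝ) : Prop :=
  ∀ α₁ α₂ α₃ α₄, IsSmallRhombus n α₁ α₂ α₃ α₄ → T α₁ + T α₃ ≤ T α₂ + T α₄

/-- The tropical octahedron recurrence. -/
def OctahedronRecurrence (T : (Fin 3 → ℤ) → WithBot ℝ) : Prop :=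
  ∀ i j k : ℤ,
    T ![i + 1, j, k + 1] + T ![i, j + 1, k] =
      max (T ![i, j + 1, k + 1] + T ![i + 1, j, k]) (T ![i, j, k + 1] + T ![i + 1, j + 1, k])

/-! ### Laurent polynomials and their tropicalization -/

/-- The coordinate ring `ℂ[x_i^{±1} | i ∈ ι]` of the torus `(ℂ^*)^ι`. -/
abbrev LaurentRing (ι : Type) : Type := AddMonoidAlgebra ℂ (ι →₀ ℤ)

/-- The coordinate function `x_i` of the torus. -/
def coordX {ι : Type} (i : ι) : LaurentRing ι := AddMonoidAlgebra.single (Finsupp.single i 1) 1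

/-- All coefficients are nonnegative real numbers, so the nonzero ones are positive. -/
def NonnegCoeffs {ι : Type} (p : LaurentRing ι) : Prop :=
  ∀ m, 0 ≤ (p.coeff m).re ∧ (p.coeff m).im = 0

/-- The value `∑ m_i ξ_i` of the linear form given by the exponent `m` at the point `ξ`. -/
def linForm {ι : Type} (ξ : ι → ℝ) (m : ι →₀ ℤ) : ℝ := m.sum fun i e => (e : ℝ) * ξ i

/-- The tropicalization `p^t(ξ) = max {∑ m_i ξ_i | x^m occurs in p}` of a Laurent polynomial `p`,
with values in the tropical numbers `𝕋 = ℝ ∪ {-∞}`; it is `-∞` for `p = 0`. -/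
def tropPoly {ι : Type} (p : LaurentRing ι) (ξ : ι → ℝ) : WithBot ℝ :=
  p.coeff.support.sup fun m => (linForm ξ m : WithBot ℝ)

/-- `(p/q)^t(ξ) = p^t(ξ) - q^t(ξ)`, for `q ≠ 0`. -/
def tropQuot {ι : Type} (p q : LaurentRing ι) (ξ : ι → ℝ) : WithBot ℝ :=
  WithBot.map (fun t => t - (tropPoly q ξ).unbotD 0) (tropPoly p ξ)

/-! ### Toric charts, positivity, tropicalization

An affine variety `P` is given by its coordinate ring `A`, a subalgebra of a field `K`; so
`P = Spec A`, and the rational functions on `P` are the quotients in `K` of elements of `A`. -/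

section Charts

variable {K : Type} [Field K] [Algebra ℂ K]

/-- A toric chart `θ : (ℂ^*)^ι ↪ Spec A`: an open embedding of a torus, given by the pull-back of
regular functions along `θ`. -/
structure ToricChart (A : Subalgebra ℂ K) (ι : Type) where
  /-- The map `f ↦ f ∘ θ` on regular functions. -/
  pullback : A →ₐ[ℂ] LaurentRing ι
  isOpenImmersion : IsOpenImmersion (Spec.map (CommRingCat.ofHom pullback.toRingHom))

namespace ToricChart

variable {A : Subalgebra ℂ K} {ι κ : Type}

/-- `f` is a rational function on `Spec A`, and `f ∘ θ = p / q`. -/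
def Represents (θ : ToricChart A ι) (f : K) (p q : LaurentRing ι) : Prop :=
  q ≠ 0 ∧ ∃ a b : A, b ≠ 0 ∧ f * (b : K) = (a : K) ∧ θ.pullback a * q = θ.pullback b * p

/-- `f` is a rational function on `Spec A`, and `f ∘ θ` has a positive (subtraction-free)
expression `p / q`. The zero function, with `p = 0`, is allowed. -/
def IsPositive (θ : ToricChart A ι) (f : K) : Prop :=
  ∃ p q, NonnegCoeffs p ∧ NonnegCoeffs q ∧ θ.Represents f p q

/-- `f` is the rational function on `Spec A` with `f ∘ θ = x_i`, that is, the `i`-th coordinate of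
the birational inverse of `θ`. -/
def IsCoordinate (θ : ToricChart A ι) (i : ι) (f : K) : Prop := θ.Represents f (coordX i) 1

/-- Two charts are positively equivalent if both transition maps are positive. -/
def PosEquiv (θ : ToricChart A ι) (θ' : ToricChart A κ) : Prop :=
  (∀ i, ∃ f, θ.IsCoordinate i f ∧ θ'.IsPositive f) ∧
  (∀ j, ∃ f, θ'.IsCoordinate j f ∧ θ.IsPositive f)

open Classical in
/-- The tropicalization `f^t` of a positive function `f` in the chart `θ`: if `f ∘ θ = p / q` with
nonnegative coefficients, then `f^t = p^t - q^t`. -/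
def trop (θ : ToricChart A ι) (f : K) (ξ : ι → ℝ) : WithBot ℝ :=
  if h : θ.IsPositive f then tropQuot h.choose h.choose_spec.choose ξ else ⊥

end ToricChart

end Charts

/-! #### The tropicalization does not depend on the positive expression -/

lemma linForm_add {ι : Type} (ξ : ι → ℝ) (m m' : ι →₀ ℤ) :
    linForm ξ (m + m') = linForm ξ m + linForm ξ m' := by
  classical
  unfold linForm
  rw [Finsupp.sum_add_index'] <;> intros <;> push_cast <;> ring

lemma mem_support_mul {ι : Type} {p q : LaurentRing ι} (hp : NonnegCoeffs p) (hq : NonnegCoeffs q)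
    {m m' : ι →₀ ℤ} (hm : m ∈ p.coeff.support) (hm' : m' ∈ q.coeff.support) :
    m + m' ∈ (p * q).coeff.support := by
  classical
  have pos : ∀ {r : LaurentRing ι}, NonnegCoeffs r → ∀ {k}, k ∈ r.coeff.support →
      0 < (r.coeff k).re := by
    intro r hr k hk
    refine lt_of_le_of_ne (hr k).1 fun h0 => ?_
    exact (Finsupp.mem_support_iff.mp hk) (Complex.ext h0.symm (hr k).2)
  rw [Finsupp.mem_support_iff]
  intro h
  have h' := congrArg Complex.re h
  rw [AddMonoidAlgebra.coeff_mul] at h'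
  simp only [Finsupp.sum, Complex.re_sum, Complex.zero_re] at h'
  have nn : ∀ a b, 0 ≤ (if a + b = m + m' then p.coeff a * q.coeff b else 0).re := by
    intro a b
    split_ifs
    · simp only [Complex.mul_re, (hp a).2, (hq b).2, mul_zero, sub_zero]
      exact mul_nonneg (hp a).1 (hq b).1
    · simp
  rw [Finset.sum_eq_zero_iff_of_nonneg
    (fun a _ => Finset.sum_nonneg fun b _ => nn a b)] at h'
  have h1 := h' m hm
  rw [Finset.sum_eq_zero_iff_of_nonneg (fun b _ => nn m b)] at h1
  have h2 := h1 m' hm'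
  simp only [if_true, Complex.mul_re, (hp m).2, zero_mul, sub_zero] at h2
  exact absurd h2 (mul_pos (pos hp hm) (pos hq hm')).ne'

lemma tropPoly_mul {ι : Type} {p q : LaurentRing ι} (hp : NonnegCoeffs p) (hq : NonnegCoeffs q)
    (ξ : ι → ℝ) : tropPoly (p * q) ξ = tropPoly p ξ + tropPoly q ξ := by
  classical
  apply le_antisymm
  · refine Finset.sup_le fun m hm => ?_
    have hex : ∃ a ∈ p.coeff.support, ∃ b ∈ q.coeff.support, a + b = m := by
      by_contra! hcon
      refine (Finsupp.mem_support_iff.mp hm) ?_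
      rw [AddMonoidAlgebra.coeff_mul]
      exact Finset.sum_eq_zero fun a ha => Finset.sum_eq_zero fun b hb => if_neg (hcon a ha b hb)
    obtain ⟨a, ha, b, hb, rfl⟩ := hex
    rw [linForm_add, WithBot.coe_add]
    exact add_le_add (Finset.le_sup (f := fun m => (linForm ξ m : WithBot ℝ)) ha)
      (Finset.le_sup (f := fun m => (linForm ξ m : WithBot ℝ)) hb)
  · rcases p.coeff.support.eq_empty_or_nonempty with h | hpn
    · simp [tropPoly, h]
    rcases q.coeff.support.eq_empty_or_nonempty with h | hqn
    · simp [tropPoly, h]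
    obtain ⟨a, ha, ha'⟩ :=
      Finset.exists_mem_eq_sup _ hpn fun m => (linForm ξ m : WithBot ℝ)
    obtain ⟨b, hb, hb'⟩ :=
      Finset.exists_mem_eq_sup _ hqn fun m => (linForm ξ m : WithBot ℝ)
    unfold tropPoly
    rw [ha', hb', ← WithBot.coe_add, ← linForm_add]
    exact Finset.le_sup (f := fun m => (linForm ξ m : WithBot ℝ)) (mem_support_mul hp hq ha hb)

lemma exists_tropPoly_eq_coe {ι : Type} {q : LaurentRing ι} (hq : q ≠ 0) (ξ : ι → ℝ) :
    ∃ t : ℝ, tropPoly q ξ = t := by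
  have hne : q.coeff.support.Nonempty := by
    rw [Finsupp.support_nonempty_iff]
    exact fun h => hq (AddMonoidAlgebra.ext (by simp [h]))
  obtain ⟨a, -, ha⟩ := Finset.exists_mem_eq_sup _ hne fun m => (linForm ξ m : WithBot ℝ)
  exact ⟨_, ha⟩

lemma ToricChart.pullback_injective {K : Type} [Field K] [Algebra ℂ K] {A : Subalgebra ℂ K}
    {ι : Type} (θ : ToricChart A ι) : Function.Injective θ.pullback := by
  have h := θ.isOpenImmersion
  have ho : IsOpen (Set.range (PrimeSpectrum.comap θ.pullback.toRingHom)) :=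
    (Spec.map (CommRingCat.ofHom θ.pullback.toRingHom)).isOpenEmbedding.isOpen_range
  have hd : DenseRange (PrimeSpectrum.comap θ.pullback.toRingHom) :=
    ho.dense (Set.range_nonempty _)
  rw [PrimeSpectrum.denseRange_comap_iff_ker_le_nilRadical, nilradical_eq_zero] at hd
  exact (RingHom.injective_iff_ker_eq_bot _).mpr (le_bot_iff.mp hd)

/-- `f^t` may be computed from any positive expression of `f ∘ θ`. -/
theorem ToricChart.trop_eq {K : Type} [Field K] [Algebra ℂ K] {A : Subalgebra ℂ K} {ι : Type}
    (θ : ToricChart A ι) {f : K} {p q : LaurentRing ι} (hp : NonnegCoeffs p) (hq : NonnegCoeffs q)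
    (h : θ.Represents f p q) (ξ : ι → ℝ) : θ.trop f ξ = tropQuot p q ξ := by
  have hpos : θ.IsPositive f := ⟨p, q, hp, hq, h⟩
  rw [ToricChart.trop, dif_pos hpos]
  obtain ⟨hp', hq', h'⟩ := hpos.choose_spec.choose_spec
  generalize hpos.choose_spec.choose = q' at *
  generalize hpos.choose = p' at *
  obtain ⟨hq0, a, b, hb, hab, hθ⟩ := h
  obtain ⟨hq0', a', b', hb', hab', hθ'⟩ := h'
  have inj := θ.pullback_injective
  have h0 : ∀ {c : A}, c ≠ 0 → θ.pullback c ≠ 0 := fun {c} hc h0 =>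
    hc (inj (h0.trans (map_zero θ.pullback).symm))
  have hcross : a * b' = a' * b := by
    apply Subtype.ext
    push_cast
    rw [← hab, ← hab']
    ring
  have hcross' := congrArg θ.pullback hcross
  rw [map_mul, map_mul] at hcross'
  have key : p' * q = p * q' := by
    apply mul_left_cancel₀ (mul_ne_zero (h0 hb) (h0 hb'))
    linear_combination (-(θ.pullback b * q)) * hθ' + (θ.pullback b' * q') * hθ
      - q * q' * hcross'
  have ht := congrArg (fun r => tropPoly r ξ) key
  simp only [tropPoly_mul hp' hq, tropPoly_mul hp hq'] at ht
  obtain ⟨s, hs⟩ := exists_tropPoly_eq_coe hq0 ξ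
  obtain ⟨s', hs'⟩ := exists_tropPoly_eq_coe hq0' ξ
  unfold tropQuot
  rw [hs, hs'] at ht ⊢
  generalize tropPoly p ξ = x at *
  generalize tropPoly p' ξ = y at *
  induction x using WithBot.recBotCoe with
  | bot => induction y using WithBot.recBotCoe with
    | bot => rfl
    | coe y => rw [WithBot.bot_add, ← WithBot.coe_add] at ht; exact absurd ht (WithBot.coe_ne_bot)
  | coe x => induction y using WithBot.recBotCoe with
    | bot => rw [WithBot.bot_add, ← WithBot.coe_add] at ht; exact absurd ht.symm (WithBot.coe_ne_bot)
    | coe y =>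
      rw [← WithBot.coe_add, ← WithBot.coe_add, WithBot.coe_inj] at ht
      simp only [WithBot.map_coe, WithBot.unbotD_coe, WithBot.coe_inj]
      linarith

/-! ### The varieties `GL_n³`, `𝓜₃ = GL_n³ // U⁴` and `B_-³` -/

/-- For a triple of matrices over a field extension `K` of `ℂ`, the subalgebra of `K` generated by
the entries of the three matrices and of their inverses. -/
def coordinateRing {K : Type} [Field K] [Algebra ℂ K] {n : ℕ}
    (g : Fin 3 → Matrix (Fin n) (Fin n) K) : Subalgebra ℂ K :=
  Algebra.adjoin ℂ {f | ∃ l r c, f = g l r c ∨ f = (g l)⁻¹ r c}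

/-- The polynomial ring in the entries of three `n × n` matrices. -/
abbrev MatPoly (n : ℕ) : Type := MvPolynomial (Fin 3 × Fin n × Fin n) ℂ

/-- The field `ℂ(GL_n³)` of rational functions on `GL_n³`. -/
abbrev GLField (n : ℕ) : Type := FractionRing (MatPoly n)

/-- The triple of matrices whose entries are independent variables. -/
def polyMat (n : ℕ) (l : Fin 3) : Matrix (Fin n) (Fin n) (MatPoly n) :=
  Matrix.of fun r c => MvPolynomial.X (l, r, c)

/-- The generic point `(g₁,g₂,g₃)` of `GL_n³`: the entries are the coordinate functions. -/
def genericGL (n : ℕ) (l : Fin 3) : Matrix (Fin n) (Fin n) (GLField n) :=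
  (polyMat n l).map (algebraMap (MatPoly n) (GLField n))

/-- A complex matrix as a matrix of constant polynomials. -/
def constMat {n : ℕ} (M : Matrix (Fin n) (Fin n) ℂ) : Matrix (Fin n) (Fin n) (MatPoly n) :=
  M.map (algebraMap ℂ (MatPoly n))

/-- The substitution `(g₁,g₂,g₃) ↦ (u₀g₁u₁⁻¹, u₁g₂u₂⁻¹, u₂g₃u₃⁻¹)` in polynomials. -/
def substHom {n : ℕ} (u : Fin 4 → GL (Fin n) ℂ) : MatPoly n →ₐ[ℂ] MatPoly n :=
  MvPolynomial.aeval fun x =>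
    (constMat (u x.1.castSucc).val * polyMat n x.1 * constMat (u x.1.succ)⁻¹.val) x.2.1 x.2.2

lemma constMat_mul {n : ℕ} (M N : Matrix (Fin n) (Fin n) ℂ) :
    constMat (M * N) = constMat M * constMat N := Matrix.map_mul

lemma constMat_one (n : ℕ) : constMat (1 : Matrix (Fin n) (Fin n) ℂ) = 1 :=
  Matrix.map_one _ (map_zero _) (map_one _)

lemma substHom_polyMat {n : ℕ} (u : Fin 4 → GL (Fin n) ℂ) (l : Fin 3) :
    (polyMat n l).map (substHom u) =
      constMat (u l.castSucc).val * polyMat n l * constMat (u l.succ)⁻¹.val := by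
  ext1 r c
  simp only [Matrix.map_apply]
  exact MvPolynomial.aeval_X _ _

lemma substHom_comp {n : ℕ} (u v : Fin 4 → GL (Fin n) ℂ) :
    (substHom v).comp (substHom u) = substHom (u * v) := by
  apply MvPolynomial.algHom_ext
  rintro ⟨l, r, c⟩
  have hC : ∀ M : Matrix (Fin n) (Fin n) ℂ, (constMat M).map (substHom v) = constMat M := by
    intro M
    ext1 i j
    exact (substHom v).commutes _
  have h1 : ((polyMat n l).map (substHom u)).map (substHom v) =
      (polyMat n l).map (substHom (u * v)) := by
    rw [substHom_polyMat, Matrix.map_mul, Matrix.map_mul, hC, hC, substHom_polyMat,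
      substHom_polyMat]
    simp only [Pi.mul_apply, mul_inv_rev, Units.val_mul, constMat_mul, Matrix.mul_assoc]
  exact congrFun (congrFun h1 r) c

lemma substHom_one (n : ℕ) : substHom (1 : Fin 4 → GL (Fin n) ℂ) = AlgHom.id ℂ (MatPoly n) := by
  apply MvPolynomial.algHom_ext
  rintro ⟨l, r, c⟩
  refine (congrFun (congrFun (substHom_polyMat 1 l) r) c).trans ?_
  simp [constMat_one, polyMat]

/-- The substitution `substHom u` as an automorphism. -/
def substEquiv {n : ℕ} (u : Fin 4 → GL (Fin n) ℂ) : MatPoly n ≃ₐ[ℂ] MatPoly n :=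
  AlgEquiv.ofAlgHom (substHom u) (substHom u⁻¹)
    (by rw [substHom_comp, inv_mul_cancel, substHom_one])
    (by rw [substHom_comp, mul_inv_cancel, substHom_one])

/-- The action on rational functions on `GL_n³`: it maps `f` to the function
`(g₁,g₂,g₃) ↦ f(u₀g₁u₁⁻¹, u₁g₂u₂⁻¹, u₂g₃u₃⁻¹)`. -/
def act {n : ℕ} (u : Fin 4 → GL (Fin n) ℂ) : GLField n ≃ₐ[ℂ] GLField n :=
  IsFractionRing.algEquivOfAlgEquiv (substEquiv u)

/-- Membership in the group `U` of unipotent upper triangular matrices. -/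
def IsUnipotentUpper {n : ℕ} (u : GL (Fin n) ℂ) : Prop :=
  (∀ i, u i i = 1) ∧ ∀ i j, j < i → u i j = 0

/-- The coordinate ring `ℂ[GL_n³]^{U⁴}` of the quotient `𝓜₃ = GL_n³ // U⁴`. -/
def invariantRing (n : ℕ) : Subalgebra ℂ (GLField n) :=
  coordinateRing (genericGL n) ⊓
    ⨅ u : {u : Fin 4 → GL (Fin n) ℂ // ∀ l, IsUnipotentUpper (u l)},
      AlgHom.equalizer (act u.1).toAlgHom (AlgHom.id ℂ (GLField n))

/-- The index set of the functions `M_{i,j,0}` and `M_{0,i,j}` with `i, j ≥ 0`, `0 < i + j ≤ n`. -/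
abbrev FaceIndex (n : ℕ) : Type :=
  {α : Fin 3 → ℤ // α ∈ simplex n ∧ (α 2 = 0 ∨ α 0 = 0) ∧ α ≠ 0}

/-- The polynomial ring in the entries on and below the diagonal of three `n × n` matrices. -/
abbrev LowerPoly (n : ℕ) : Type := MvPolynomial (Fin 3 × {x : Fin n × Fin n // x.2 ≤ x.1}) ℂ

/-- The field `ℂ(B_-³)` of rational functions on `B_-³`, where `B_-` is the group of invertible
lower triangular matrices. -/
abbrev LowerField (n : ℕ) : Type := FractionRing (LowerPoly n)

/-- The generic point of `B_-³`: lower triangular matrices whose entries on and below the diagonal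
are the coordinate functions. -/
def genericLower (n : ℕ) (l : Fin 3) : Matrix (Fin n) (Fin n) (LowerField n) :=
  Matrix.of fun r c =>
    if h : c ≤ r then
      algebraMap (LowerPoly n) (LowerField n) (MvPolynomial.X (l, ⟨(r, c), h⟩))
    else 0

/-- The index set `δ_n = {(i,j) | 0 ≤ i ≤ n - 1, 1 ≤ j ≤ n, i + j ≤ n}`. -/
abbrev GZIndex (n : ℕ) : Type := {x : ℕ × ℕ // 1 ≤ x.2 ∧ x.1 + x.2 ≤ n}

/-- The geometric Gelfand–Zeitlin coordinate `λ_j^{(n-i)} = Δ_{i,j} / Δ_{i,j-1}`, where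
`Δ_{i,j} = Δ_{[1,j]^op,[i+1,i+j]}` (and `Δ_{i,0} = 1`). -/
def gzCoord {K : Type*} [Field K] {n : ℕ} (b : Matrix (Fin n) (Fin n) K) (x : GZIndex n) : K :=
  minor b (opp (initial n x.1.2)) (interval n x.1.1 x.1.2) /
    minor b (opp (initial n (x.1.2 - 1))) (interval n x.1.1 (x.1.2 - 1))

end MultiHorn

end

/-! All functions are expressed through corner determinants D(p), the determinant of the first p_b
columns of four matrices H_b with ∑ p_b = n. For H = (1, g₁, g₁g₂, g₁g₂g₃) they are the M_α. Write S
+ a + b for the tuple S with one more column in each of the blocks a and b.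

Two instances of the three-term Plücker relation carry the proof. Columns from four different blocks
give the octahedron relation (`octahedron`). Two consecutive columns from the same block v give
`skipQuot_sub`: let σ_v(p) be the quotient of D(p), with the last column of block v replaced by the
next one, by D(p). When one column moves from b to c, with v, b, c in cyclic order, σ_v grows by
exactly the rhombus quotient ρ = D(S+2v) D(S+b+c) / (D(S+v+b) D(S+v+c)).

For H_b = H_a g the summands of Φ_BK(g) are values of σ_b and -σ_a on the edge ab. The minus sign in
Φ₃ closes the cycle 0, 1, 2, 3, so Φ₃ is the sum over v and m of the difference of σ_v between two
edges, where the columns outside v lie in v - 1 and in v + 1 (`potential_eq`). Each difference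
telescopes along a path of single moves into a sum of rhombus quotients, and every rhombus lies on
such a path. Hence Φ₃ and Φ₃ - ρ are sums of rhombus quotients for each ρ. As tropicalization turns
sums of positive functions into maxima, Φ₃^t ≤ 0 holds exactly if all ρ^t ≤ 0, and these are the
rhombus inequalities (`trop_potential_nonpos_iff`). This needs only that all D(p) are nonzero and
positive.

Positivity: the octahedron relation, solved for D(S+1+3), is subtraction-free and reduces everything
to the faces p₁ = 0 and p₃ = 0 (`cornerDet_mem`). On 𝓜₃ these are the chart coordinates. On B_-³ one
passes from interval minors to flag minors (`flagMinor_mem`) and then to products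
(`cornerDet_prods_mem_of_isLower`).

Charts come from `exists_toricChart`: the Laurent ring of the coordinates has to be a localization
of the coordinate ring at one function. For B_-³, Plücker recursions that divide only by interval
minors give the entries as Laurent polynomials. For 𝓜₃, unipotent matrices bring g₁, g₁g₂, g₁g₂g₃
into lower triangular, antidiagonal and lower triangular form; an invariant function can be
evaluated there (`evalAt_eq_of_invariant`, `invariantRing_le`). Algebraic independence follows by
comparing the number of generators with the transcendence degree. -/

open AlgebraicGeometry

noncomputable section

namespace MultiHorn

/-! ### Determinants of lists of vectors -/

section ListDet

variable {R : Type*} [CommRing R] {n : ℕ}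

/-- The square matrix whose rows are the entries of a list. -/
def listMat (l : List (Fin n → R)) : Matrix (Fin n) (Fin n) R :=
  Matrix.of fun i => l.getD i 0

/-- The determinant of a list of vectors. -/
def listDet (l : List (Fin n → R)) : R := (listMat l).det

lemma listMat_append_cons (l₁ l₂ : List (Fin n → R)) (x y : Fin n → R) (h : l₁.length < n) :
    listMat (l₁ ++ x :: l₂) = (listMat (l₁ ++ y :: l₂)).updateRow ⟨l₁.length, h⟩ x := by
  ext i j
  rw [Matrix.updateRow_apply]
  simp only [listMat, Matrix.of_apply]
  split_ifs with hi
  · subst hi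
    rw [List.getD_append_right _ _ _ _ le_rfl]
    simp
  · have hne : (i : ℕ) ≠ l₁.length := fun h' => hi (Fin.ext h')
    rcases lt_or_gt_of_ne hne with hlt | hgt
    · rw [List.getD_append _ _ _ _ hlt, List.getD_append _ _ _ _ hlt]
    · obtain ⟨k, hk⟩ := Nat.exists_eq_add_of_lt hgt
      rw [List.getD_append_right _ _ _ _ hgt.le, List.getD_append_right _ _ _ _ hgt.le]
      have : (i : ℕ) - l₁.length = k + 1 := by omega
      rw [this]
      simp

lemma listDet_append_cons (l₁ l₂ : List (Fin n → R)) (x y : Fin n → R) (h : l₁.length < n) :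
    listDet (l₁ ++ x :: l₂) = ((listMat (l₁ ++ y :: l₂)).updateRow ⟨l₁.length, h⟩ x).det := by
  rw [listDet, listMat_append_cons l₁ l₂ x y h]

lemma listDet_add (l₁ l₂ : List (Fin n → R)) (x y : Fin n → R) (h : l₁.length < n) :
    listDet (l₁ ++ (x + y) :: l₂) = listDet (l₁ ++ x :: l₂) + listDet (l₁ ++ y :: l₂) := by
  rw [listDet_append_cons _ _ _ 0 h, listDet_append_cons _ _ x 0 h, listDet_append_cons _ _ y 0 h,
    Matrix.det_updateRow_add]

lemma listDet_smul (l₁ l₂ : List (Fin n → R)) (c : R) (x : Fin n → R) (h : l₁.length < n) :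
    listDet (l₁ ++ (c • x) :: l₂) = c * listDet (l₁ ++ x :: l₂) := by
  rw [listDet_append_cons _ _ _ 0 h, listDet_append_cons _ _ x 0 h, Matrix.det_updateRow_smul]

/-- The determinant as a linear form in one of the vectors. -/
def listDetLin (l₁ l₂ : List (Fin n → R)) (h : l₁.length < n) : (Fin n → R) →ₗ[R] R where
  toFun x := listDet (l₁ ++ x :: l₂)
  map_add' x y := listDet_add l₁ l₂ x y h
  map_smul' c x := listDet_smul l₁ l₂ c x h

lemma listDet_sum {ι : Type*} (s : Finset ι) (l₁ l₂ : List (Fin n → R)) (c : ι → R)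
    (x : ι → Fin n → R) (h : l₁.length < n) :
    listDet (l₁ ++ (∑ i ∈ s, c i • x i) :: l₂) = ∑ i ∈ s, c i * listDet (l₁ ++ x i :: l₂) := by
  have := map_sum (listDetLin l₁ l₂ h) (fun i => c i • x i) s
  simp only [map_smul, smul_eq_mul] at this
  exact this

lemma listDet_swap (l₁ l₂ : List (Fin n → R)) (x y : Fin n → R) (h : l₁.length + 1 < n) :
    listDet (l₁ ++ x :: y :: l₂) = -listDet (l₁ ++ y :: x :: l₂) := by
  let a : Fin n := ⟨l₁.length, by omega⟩
  let b : Fin n := ⟨l₁.length + 1, h⟩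
  have hab : a ≠ b := by simp [a, b]
  have hm : listMat (l₁ ++ x :: y :: l₂) =
      (listMat (l₁ ++ y :: x :: l₂)).submatrix (Equiv.swap a b) id := by
    ext i j
    simp only [listMat, Matrix.of_apply, Matrix.submatrix_apply, id]
    by_cases hia : i = a
    · subst hia
      rw [Equiv.swap_apply_left, List.getD_append_right _ _ _ _ le_rfl,
        List.getD_append_right _ _ _ _ (by simp [b])]
      simp [b]
    by_cases hib : i = b
    · subst hib
      rw [Equiv.swap_apply_right, List.getD_append_right _ _ _ _ le_rfl,
        List.getD_append_right _ _ _ _ (by simp [b])]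
      simp [b]
    rw [Equiv.swap_apply_of_ne_of_ne hia hib]
    rcases lt_or_ge (i : ℕ) l₁.length with hlt | hge
    · rw [List.getD_append _ _ _ _ hlt, List.getD_append _ _ _ _ hlt]
    · have h1 : (i : ℕ) ≠ l₁.length := fun h' => hia (Fin.ext h')
      have h2 : (i : ℕ) ≠ l₁.length + 1 := fun h' => hib (Fin.ext h')
      obtain ⟨k, hk⟩ : ∃ k, (i : ℕ) - l₁.length = k + 2 := ⟨i - l₁.length - 2, by omega⟩
      rw [List.getD_append_right _ _ _ _ hge, List.getD_append_right _ _ _ _ hge, hk]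
      simp
  rw [listDet, hm, Matrix.det_permute, Equiv.Perm.sign_swap hab, listDet]
  simp

lemma listDet_move (p l₁ l₂ : List (Fin n → R)) (x : Fin n → R)
    (h : p.length + l₁.length < n) :
    listDet (p ++ l₁ ++ x :: l₂) = (-1) ^ l₁.length * listDet (p ++ x :: (l₁ ++ l₂)) := by
  induction l₁ generalizing p with
  | nil => simp
  | cons a l ih =>
    have := ih (p ++ [a]) (by simp at h ⊢; omega)
    simp only [List.append_assoc, List.cons_append, List.nil_append, List.length_cons] at this ⊢
    rw [this, listDet_swap _ _ _ _ (by simp at h; omega)]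
    ring

lemma listDet_perm {l l' : List (Fin n → R)} (h : l.Perm l') (p : List (Fin n → R))
    (hn : p.length + l.length = n) :
    listDet (p ++ l) = listDet (p ++ l') ∨ listDet (p ++ l) = -listDet (p ++ l') := by
  induction h generalizing p with
  | nil => simp
  | cons x _ ih =>
    have := ih (p ++ [x]) (by simp at hn ⊢; omega)
    simpa using this
  | swap x y l => exact Or.inr (listDet_swap _ _ _ _ (by simp at hn; omega))
  | trans h1 _ ih1 ih2 =>
    have e1 := ih1 p hn
    have e2 := ih2 p (by rw [← h1.length_eq]; exact hn)
    rcases e1 with e1 | e1 <;> rcases e2 with e2 | e2 <;> rw [e1, e2] <;> simp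

lemma listDet_eq_zero_of_mem {l₁ : List (Fin n → R)} (l₂ : List (Fin n → R)) {x : Fin n → R}
    (hx : x ∈ l₁) (h : l₁.length < n) : listDet (l₁ ++ x :: l₂) = 0 := by
  obtain ⟨k, hk, rfl⟩ := List.mem_iff_getElem.mp hx
  refine Matrix.det_zero_of_row_eq (i := ⟨k, hk.trans h⟩) (j := ⟨l₁.length, h⟩)
    (by simp [Fin.ext_iff]; omega) ?_
  simp only [listMat]
  change (l₁ ++ l₁[k] :: l₂).getD k 0 = (l₁ ++ l₁[k] :: l₂).getD l₁.length 0
  rw [List.getD_append _ _ _ _ hk, List.getD_append_right _ _ _ _ le_rfl]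
  simp [hk]

/-- The three-term Plücker relation. -/
lemma listDet_plucker (S : List (Fin n → R)) (x y z t : Fin n → R) (h : S.length + 2 = n) :
    listDet (x :: y :: S) * listDet (z :: t :: S) =
      listDet (x :: z :: S) * listDet (y :: t :: S) -
        listDet (x :: t :: S) * listDet (y :: z :: S) := by
  obtain ⟨m, rfl⟩ : ∃ m, n = m + 2 := ⟨_, h.symm⟩
  set A := listMat (x :: y :: S) with hA
  -- Cramer's rule writes det A • z as a combination of the rows of A, the coefficient of a row
  -- being the determinant with this row replaced by z. Under the linear form v ↦ det(v, t, S) the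
  -- rows from S die, and only x and y contribute.
  have hcr := Matrix.mulVec_cramer A.transpose z
  let φ : (Fin (m + 2) → R) →ₗ[R] R := listDetLin [] (t :: S) (by simp)
  have hφ : ∀ v, φ v = listDet (v :: t :: S) := fun v => rfl
  have hsum : A.transpose.mulVec (A.transpose.cramer z) = ∑ i, (A.updateRow i z).det • A i := by
    rw [Matrix.mulVec_eq_sum]
    refine Finset.sum_congr rfl fun i _ => ?_
    rw [Matrix.cramer_transpose_apply, Matrix.transpose_transpose]
    simp
  rw [hsum] at hcr
  have hφcr := congrArg φ hcr
  rw [map_sum, map_smul, Matrix.det_transpose, smul_eq_mul, Fin.sum_univ_succ,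
    Fin.sum_univ_succ] at hφcr
  have hrest : ∀ i : Fin m, φ (A i.succ.succ) = 0 := by
    intro i
    have hiS : (i : ℕ) < S.length := by omega
    obtain ⟨v, hv, hm⟩ : ∃ v ∈ S, A i.succ.succ = v := by
      refine ⟨S[(i : ℕ)], List.getElem_mem _, ?_⟩
      change (x :: y :: S).getD (i + 1 + 1) 0 = _
      simp [hiS]
    obtain ⟨s, t', hst⟩ := List.append_of_mem hv
    have hz := listDet_eq_zero_of_mem (l₁ := v :: t :: s) t' (x := v) (by simp)
      (by have := congrArg List.length hst; simp at this ⊢; omega)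
    rw [hφ, hm, hst]
    simpa using hz
  simp only [map_smul, smul_eq_mul, hrest, mul_zero, Finset.sum_const_zero, add_zero] at hφcr
  have e0 : (A.updateRow 0 z).det = listDet (z :: y :: S) :=
    (listDet_append_cons [] (y :: S) z x (by simp)).symm
  have e1 : (A.updateRow (Fin.succ 0) z).det = listDet (x :: z :: S) :=
    (listDet_append_cons [x] S z y (by simp)).symm
  have a0 : A 0 = x := rfl
  have a1 : A (Fin.succ 0) = y := rfl
  rw [e0, e1, a0, a1, hφ, hφ, hφ] at hφcr
  have hsw := listDet_swap [] S z y (by simp)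
  simp only [List.nil_append] at hsw
  rw [hsw] at hφcr
  change listDet (x :: y :: S) * _ = _
  have hd : A.det = listDet (x :: y :: S) := rfl
  rw [hd] at hφcr
  linear_combination -hφcr

lemma listDet_map_mulVec (M : Matrix (Fin n) (Fin n) R) (l : List (Fin n → R))
    (h : l.length = n) : listDet (l.map M.mulVec) = M.det * listDet l := by
  have : listMat (l.map M.mulVec) = listMat l * M.transpose := by
    ext i j
    have hi : (i : ℕ) < l.length := by rw [h]; exact i.2
    simp [listMat, Matrix.mul_apply, hi, Matrix.mulVec, dotProduct, mul_comm]
  rw [listDet, this, Matrix.det_mul, Matrix.det_transpose, mul_comm, listDet]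

lemma listDet_map {R' : Type*} [CommRing R'] (φ : R →+* R') (l : List (Fin n → R)) :
    φ (listDet l) = listDet (l.map fun v i => φ (v i)) := by
  rw [listDet, RingHom.map_det, listDet]
  congr 1
  ext i j
  simp only [RingHom.mapMatrix_apply, Matrix.map_apply, listMat, Matrix.of_apply]
  rcases lt_or_ge (i : ℕ) l.length with h | h
  · simp [h]
  · simp [h]

end ListDet

/-! ### Determinants of four blocks of vectors -/

section Blocks

variable {R : Type*} [CommRing R] {n : ℕ}

/-- The concatenation of four lists. -/
def flat {V : Type*} (L : Fin 4 → List V) : List V := L 0 ++ L 1 ++ L 2 ++ L 3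

/-- Append a vector to one of four lists. -/
def ins {V : Type*} (L : Fin 4 → List V) (a : Fin 4) (x : V) : Fin 4 → List V :=
  Function.update L a (L a ++ [x])

/-- The number of vectors in the lists up to the given one. -/
def lenUpTo {V : Type*} (L : Fin 4 → List V) (a : Fin 4) : ℕ :=
  ∑ b ∈ Finset.Iic a, (L b).length

lemma length_flat {V : Type*} (L : Fin 4 → List V) :
    (flat L).length = (L 0).length + (L 1).length + (L 2).length + (L 3).length := by
  simp [flat]; omega

lemma length_flat_ins {V : Type*} (L : Fin 4 → List V) (a : Fin 4) (x : V) :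
    (flat (ins L a x)).length = (flat L).length + 1 := by
  rw [length_flat, length_flat]
  fin_cases a <;> simp [ins] <;> omega

lemma flat_ins {V : Type*} (L : Fin 4 → List V) (a : Fin 4) :
    ∃ l₁ l₂ : List V, l₁.length = lenUpTo L a ∧ flat L = l₁ ++ l₂ ∧
      ∀ x, flat (ins L a x) = l₁ ++ x :: l₂ := by
  have hI : (Finset.Iic (0 : Fin 4)) = {0} := by decide
  have hI1 : (Finset.Iic (1 : Fin 4)) = {0, 1} := by decide
  have hI2 : (Finset.Iic (2 : Fin 4)) = {0, 1, 2} := by decide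
  have hI3 : (Finset.Iic (3 : Fin 4)) = {0, 1, 2, 3} := by decide
  fin_cases a
  · exact ⟨L 0, L 1 ++ L 2 ++ L 3, by simp [lenUpTo, hI], by simp [flat], by simp [flat, ins]⟩
  · exact ⟨L 0 ++ L 1, L 2 ++ L 3, by simp [lenUpTo, hI1], by simp [flat], by simp [flat, ins]⟩
  · exact ⟨L 0 ++ L 1 ++ L 2, L 3, by simp [lenUpTo, hI2], by simp [flat],
      by simp [flat, ins]⟩
  · exact ⟨L 0 ++ L 1 ++ L 2 ++ L 3, [], by simp [lenUpTo, hI3], by simp [flat],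
      by simp [flat, ins]⟩

lemma lenUpTo_ins {V : Type*} (L : Fin 4 → List V) (a b : Fin 4) (x : V) :
    lenUpTo (ins L a x) b = lenUpTo L b + if a ≤ b then 1 else 0 := by
  simp only [lenUpTo]
  split_ifs with h
  · rw [← Finset.add_sum_erase _ _ (Finset.mem_Iic.2 h),
      ← Finset.add_sum_erase _ (fun b => (L b).length) (Finset.mem_Iic.2 h)]
    have : ∀ c ∈ (Finset.Iic b).erase a, (ins L a x c).length = (L c).length := by
      intro c hc
      rw [ins, Function.update_of_ne (Finset.ne_of_mem_erase hc)]
    rw [Finset.sum_congr rfl this]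
    simp [ins]; omega
  · rw [add_zero]
    refine Finset.sum_congr rfl fun c hc => ?_
    rw [ins, Function.update_of_ne]
    rintro rfl
    exact h (Finset.mem_Iic.1 hc)

/-- The sign of a pair of blocks: `1` if the first is not to the right of the second. -/
def sg (R : Type*) [CommRing R] (a b : Fin 4) : R := if a ≤ b then 1 else -1

lemma sg_mul_self (a b : Fin 4) : sg R a b * sg R a b = 1 := by
  unfold sg; split_ifs <;> simp

/-- Both vectors are pulled to the front, each past the vectors of L before it. The factor `sg`
records whether x and y have to cross each other. -/
lemma listDet_ins (L : Fin 4 → List (Fin n → R)) (a b : Fin 4) (x y : Fin n → R)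
    (h : (flat L).length + 2 = n) :
    listDet (flat (ins (ins L a x) b y)) =
      (-1) ^ lenUpTo L a * (-1) ^ lenUpTo L b * sg R a b * listDet (x :: y :: flat L) := by
  obtain ⟨l₁, l₂, h1, h2, h3⟩ := flat_ins L a
  obtain ⟨m₁, m₂, k1, k2, k3⟩ := flat_ins (ins L a x) b
  have hl := congrArg List.length h2
  have hm := congrArg List.length k2
  rw [length_flat_ins] at hm
  simp only [List.length_append] at hl hm
  rw [k3]
  have s1 := listDet_move [] m₁ m₂ y (by simp; omega)
  rw [List.nil_append, ← k2, h3] at s1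
  have s2 := listDet_move [y] l₁ l₂ x (by simp; omega)
  rw [← h2] at s2
  have s3 := listDet_swap [] (flat L) y x (by simp; omega)
  simp only [List.nil_append, List.cons_append] at s1 s2 s3
  rw [s1, s2, s3, k1, h1, lenUpTo_ins, sg]
  split_ifs
  · ring
  · ring

/-- The three-term Plücker relation for vectors inserted into four blocks. -/
lemma plucker_ins (L : Fin 4 → List (Fin n → R)) (x y z t : Fin n → R)
    (h : (flat L).length + 2 = n) :
    listDet (flat (ins (ins L 0 x) 2 z)) * listDet (flat (ins (ins L 1 y) 3 t)) =
      listDet (flat (ins (ins L 0 x) 1 y)) * listDet (flat (ins (ins L 2 z) 3 t)) +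
      listDet (flat (ins (ins L 0 x) 3 t)) * listDet (flat (ins (ins L 1 y) 2 z)) := by
  simp only [listDet_ins _ _ _ _ _ h]
  have e : ∀ {a b : Fin 4}, a ≤ b → sg R a b = 1 := fun h => if_pos h
  rw [e (a := 0) (b := 2) (by decide), e (a := 1) (b := 3) (by decide),
    e (a := 0) (b := 1) (by decide), e (a := 2) (b := 3) (by decide),
    e (a := 0) (b := 3) (by decide), e (a := 1) (b := 2) (by decide)]
  -- Every product contains each of the four insertion signs exactly once, so they factor out of the
  -- relation.
  have := listDet_plucker (flat L) x y z t h
  linear_combination (-((-1) ^ lenUpTo L 0 * (-1) ^ lenUpTo L 1 * (-1) ^ lenUpTo L 2 *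
    (-1) ^ lenUpTo L 3)) * this

/-- The three-term Plücker relation with two vectors inserted into the same block. -/
lemma plucker_ins_same (L : Fin 4 → List (Fin n → R)) (v b c : Fin 4) (x y z t : Fin n → R)
    (h : (flat L).length + 2 = n) (hs : sg R v b * sg R v c * sg R b c = 1) :
    listDet (flat (ins (ins L v y) c t)) * listDet (flat (ins (ins L v x) b z)) -
      listDet (flat (ins (ins L v y) b z)) * listDet (flat (ins (ins L v x) c t)) =
      listDet (flat (ins (ins L v x) v y)) * listDet (flat (ins (ins L b z) c t)) := by
  simp only [listDet_ins _ _ _ _ _ h]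
  have e : sg R v v = 1 := if_pos le_rfl
  have := listDet_plucker (flat L) x y z t h
  have e2 := sg_mul_self (R := R) b c
  -- For distinct blocks the sign condition says that v, b, c are in cyclic order.
  have hs' : sg R v b * sg R v c = sg R b c := by
    linear_combination sg R b c * hs - (sg R v b * sg R v c) * e2
  rw [e]
  linear_combination (-((-1) ^ lenUpTo L v * (-1) ^ lenUpTo L v * (-1) ^ lenUpTo L b *
    (-1) ^ lenUpTo L c * sg R b c)) * this + ((-1) ^ lenUpTo L v * (-1) ^ lenUpTo L v *
    (-1) ^ lenUpTo L b * (-1) ^ lenUpTo L c) * (listDet (y :: t :: flat L) *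
      listDet (x :: z :: flat L) - listDet (y :: z :: flat L) * listDet (x :: t :: flat L)) * hs'

end Blocks


/-! ### Blocks of columns and corner determinants -/

section Columns

variable {R : Type*} [CommRing R] {n : ℕ}

/-- The `k`-th column of a matrix, and `0` if there is no such column. -/
def mcol (M : Matrix (Fin n) (Fin n) R) (k : ℕ) : Fin n → R :=
  fun r => if h : k < n then M r ⟨k, h⟩ else 0

/-- The list of the columns `a, …, a + k - 1` of a matrix. -/
def blk (M : Matrix (Fin n) (Fin n) R) (a k : ℕ) : List (Fin n → R) :=
  (List.range' a k).map (mcol M)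

@[simp] lemma length_blk (M : Matrix (Fin n) (Fin n) R) (a k : ℕ) : (blk M a k).length = k := by
  simp [blk]

@[simp] lemma blk_zero (M : Matrix (Fin n) (Fin n) R) (a : ℕ) : blk M a 0 = [] := rfl

lemma blk_succ (M : Matrix (Fin n) (Fin n) R) (a k : ℕ) :
    blk M a (k + 1) = blk M a k ++ [mcol M (a + k)] := by
  simp [blk, List.range'_concat]

lemma blk_succ' (M : Matrix (Fin n) (Fin n) R) (a k : ℕ) :
    blk M a (k + 1) = mcol M a :: blk M (a + 1) k := by
  simp [blk, List.range'_succ]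

lemma blk_append (M : Matrix (Fin n) (Fin n) R) (a k l : ℕ) :
    blk M a k ++ blk M (a + k) l = blk M a (k + l) := by
  simp only [blk, ← List.map_append]
  rw [List.range'_append_1]

lemma getD_blk (M : Matrix (Fin n) (Fin n) R) (a : ℕ) {k i : ℕ} (h : i < k) :
    (blk M a k).getD i 0 = mcol M (a + i) := by
  simp [blk, h]

lemma mem_blk {M : Matrix (Fin n) (Fin n) R} {a k : ℕ} {j : ℕ} (h1 : a ≤ j) (h2 : j < a + k) :
    mcol M j ∈ blk M a k :=
  List.mem_map_of_mem (List.mem_range'_1.2 ⟨h1, h2⟩)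

lemma mcol_mul (M N : Matrix (Fin n) (Fin n) R) (k : ℕ) :
    mcol (M * N) k = M.mulVec (mcol N k) := by
  ext r
  simp only [mcol, Matrix.mulVec, dotProduct]
  split_ifs
  · rfl
  · simp

lemma blk_mul (M N : Matrix (Fin n) (Fin n) R) (a k : ℕ) :
    blk (M * N) a k = (blk N a k).map M.mulVec := by
  simp only [blk, List.map_map]
  exact List.map_congr_left fun j _ => mcol_mul M N j

lemma mcol_map {R' : Type*} [CommRing R'] (φ : R →+* R') (M : Matrix (Fin n) (Fin n) R) (k : ℕ) :
    mcol (M.map φ) k = fun r => φ (mcol M k r) := by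
  ext r
  simp only [mcol]
  split_ifs
  · rfl
  · simp

lemma blk_map {R' : Type*} [CommRing R'] (φ : R →+* R') (M : Matrix (Fin n) (Fin n) R)
    (a k : ℕ) : blk (M.map φ) a k = (blk M a k).map fun v i => φ (v i) := by
  simp only [blk, List.map_map]
  exact List.map_congr_left fun j _ => mcol_map φ M j

lemma listDet_blk_full (M : Matrix (Fin n) (Fin n) R) : listDet (blk M 0 n) = M.det := by
  rw [listDet, ← Matrix.det_transpose M]
  congr 1
  ext i j
  simp only [listMat, Matrix.of_apply]
  rw [getD_blk _ _ i.2]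
  simp [mcol]

/-- The first columns of four matrices, in numbers given by a tuple. -/
def blocks (H : Fin 4 → Matrix (Fin n) (Fin n) R) (p : Fin 4 → ℕ) : Fin 4 → List (Fin n → R) :=
  fun b => blk (H b) 0 (p b)

/-- The determinant of the first columns of four matrices. -/
def cornerDet (H : Fin 4 → Matrix (Fin n) (Fin n) R) (p : Fin 4 → ℕ) : R :=
  listDet (flat (blocks H p))

lemma length_flat_blocks (H : Fin 4 → Matrix (Fin n) (Fin n) R) (p : Fin 4 → ℕ) :
    (flat (blocks H p)).length = ∑ b, p b := by
  rw [length_flat, Fin.sum_univ_four]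
  simp [blocks]

lemma blocks_add_single (H : Fin 4 → Matrix (Fin n) (Fin n) R) (p : Fin 4 → ℕ) (a : Fin 4) :
    blocks H (p + Pi.single a 1) = ins (blocks H p) a (mcol (H a) (p a)) := by
  ext1 b
  rcases eq_or_ne b a with rfl | h
  · simp [blocks, ins, blk_succ]
  · simp [blocks, ins, h]

/-- The matrices `1, g₁, g₁g₂, g₁g₂g₃`. -/
def prods (g : Fin 3 → Matrix (Fin n) (Fin n) R) : Fin 4 → Matrix (Fin n) (Fin n) R :=
  ![1, g 0, g 0 * g 1, g 0 * g 1 * g 2]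

lemma cornerDet_map {R' : Type*} [CommRing R'] (φ : R →+* R')
    (H : Fin 4 → Matrix (Fin n) (Fin n) R) (p : Fin 4 → ℕ) :
    φ (cornerDet H p) = cornerDet (fun b => (H b).map φ) p := by
  rw [cornerDet, listDet_map, cornerDet]
  congr 1
  simp [flat, blocks, blk_map]

lemma prods_map {R' : Type*} [CommRing R'] (φ : R →+* R')
    (g : Fin 3 → Matrix (Fin n) (Fin n) R) :
    (fun b => (prods g b).map φ) = prods fun l => (g l).map φ := by
  ext1 b
  fin_cases b
  · simp [prods]
  · simp [prods]
  · simp [prods, Matrix.map_mul]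
  · simp [prods, Matrix.map_mul]

lemma minor_eq_det {m p : Type*} [LinearOrder m] [LinearOrder p] (g : Matrix m p R)
    {I : Finset m} {J : Finset p} {k : ℕ} (f : Fin k → m) (f' : Fin k → p) (hf : StrictMono f)
    (hf' : StrictMono f') (hI : ∀ x, x ∈ I ↔ ∃ c, f c = x) (hJ : ∀ x, x ∈ J ↔ ∃ c, f' c = x) :
    minor g I J = (g.submatrix f f').det := by
  have hIc : I.card = k := by
    have : I = Finset.univ.image f := by ext x; simp [hI]
    rw [this, Finset.card_image_of_injective _ hf.injective, Finset.card_univ, Fintype.card_fin]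
  have hJc : J.card = k := by
    have : J = Finset.univ.image f' := by ext x; simp [hJ]
    rw [this, Finset.card_image_of_injective _ hf'.injective, Finset.card_univ, Fintype.card_fin]
  subst hIc
  have e1 : f = I.orderEmbOfFin rfl :=
    Finset.orderEmbOfFin_unique rfl (fun x => (hI _).2 ⟨x, rfl⟩) hf
  have e2 : f' = J.orderEmbOfFin hJc :=
    Finset.orderEmbOfFin_unique hJc (fun x => (hJ _).2 ⟨x, rfl⟩) hf'
  rw [minor, dif_pos hJc, e1, e2]

/-- The numbers of columns of the four blocks in the minor `M_α`. -/
def mult (n : ℕ) (α : Fin 3 → ℤ) : Fin 4 → ℕ :=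
  ![(n - (α 0 + α 1 + α 2)).toNat, (α 0).toNat, (α 1).toNat, (α 2).toNat]

/-- The increasing enumeration of the chosen columns. -/
def columnEnum (n : ℕ) (p : Fin 4 → ℕ) (c : Fin n) : Fin 4 ×ₗ Fin n :=
  if c < p 0 then toLex (0, c)
  else if c < p 0 + p 1 then toLex (1, ⟨c - p 0, by omega⟩)
  else if c < p 0 + p 1 + p 2 then toLex (2, ⟨c - (p 0 + p 1), by omega⟩)
  else toLex (3, ⟨c - (p 0 + p 1 + p 2), by omega⟩)

lemma columnEnum_strictMono (p : Fin 4 → ℕ) : StrictMono (columnEnum n p) := by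
  intro c d h
  have h' : (c : ℕ) < d := h
  unfold columnEnum
  split_ifs <;> simp [Prod.Lex.toLex_lt_toLex, Fin.mk_lt_mk] <;> omega

lemma columnEnum_snd_lt (p : Fin 4 → ℕ) (hp : ∑ b, p b = n) (c : Fin n) :
    ((ofLex (columnEnum n p c)).2 : ℕ) < p (ofLex (columnEnum n p c)).1 := by
  rw [Fin.sum_univ_four] at hp
  have := c.2
  unfold columnEnum
  split_ifs <;> simp <;> omega

/-- The complement of [1,∑α]^op is the set of the first n - ∑α columns. So all four blocks
contribute initial segments, and `columnEnum` lists them from left to right. -/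
lemma multiCorner_eq (g : Fin 3 → Matrix (Fin n) (Fin n) R) {α : Fin 3 → ℤ}
    (hα : α ∈ simplex n) : multiCorner g α = cornerDet (prods g) (mult n α) := by
  obtain ⟨h0, hs⟩ := hα
  have a0 := h0 0
  have a1 := h0 1
  have a2 := h0 2
  obtain ⟨p0, p1, p2, p3, hp, e⟩ : ∃ p0 p1 p2 p3 : ℕ, mult n α = ![p0, p1, p2, p3] ∧
      (p0 : ℤ) = n - (α 0 + α 1 + α 2) ∧ (p1 : ℤ) = α 0 ∧ (p2 : ℤ) = α 1 ∧ (p3 : ℤ) = α 2 :=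
    ⟨_, _, _, _, rfl, by omega, by omega, by omega, by omega⟩
  obtain ⟨e0, e1, e2, e3⟩ := e
  rw [multiCorner, if_pos ⟨h0, hs⟩, hp]
  rw [minor_eq_det (blockMatrix g) (k := n) id (columnEnum n ![p0, p1, p2, p3]) strictMono_id
    (columnEnum_strictMono _) (by simp)]
  · rw [cornerDet, listDet, ← Matrix.det_transpose]
    congr 1
    ext i r
    have hi := i.2
    have e : p0 + p1 + p2 + p3 = n := by omega
    simp only [Matrix.transpose_apply, Matrix.submatrix_apply, id, listMat, Matrix.of_apply, flat,
      blocks, prods, blockMatrix]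
    simp only [Matrix.cons_val_zero, Matrix.cons_val_one, Matrix.cons_val]
    rcases lt_or_ge (i : ℕ) p0 with c1 | c1
    · have hc : columnEnum n ![p0, p1, p2, p3] i = toLex (0, i) := if_pos c1
      rw [List.getD_append _ _ _ _ (by simp; omega), List.getD_append _ _ _ _ (by simp; omega),
        List.getD_append _ _ _ _ (by simp; omega), getD_blk _ _ c1, hc, zero_add]
      simp [mcol]
    rcases lt_or_ge (i : ℕ) (p0 + p1) with c2 | c2
    · have hc : columnEnum n ![p0, p1, p2, p3] i = toLex (1, ⟨i - p0, by omega⟩) :=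
        (if_neg (by simpa using c1)).trans (if_pos c2)
      rw [List.getD_append _ _ _ _ (by simp; omega), List.getD_append _ _ _ _ (by simp; omega),
        List.getD_append_right _ _ _ _ (by simp; omega), length_blk, getD_blk _ _ (by omega), hc]
      simp [mcol, show (i : ℕ) - p0 < n by omega]
    rcases lt_or_ge (i : ℕ) (p0 + p1 + p2) with c3 | c3
    · have hc : columnEnum n ![p0, p1, p2, p3] i = toLex (2, ⟨i - (p0 + p1), by omega⟩) :=
        (if_neg (by simpa using c1)).trans ((if_neg (by simpa using c2)).trans (if_pos c3))
      rw [List.getD_append _ _ _ _ (by simp; omega),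
        List.getD_append_right _ _ _ _ (by simp; omega), List.length_append, length_blk, length_blk,
        getD_blk _ _ (by omega), hc]
      simp [mcol, show (i : ℕ) - (p0 + p1) < n by omega]
    · have hc : columnEnum n ![p0, p1, p2, p3] i = toLex (3, ⟨i - (p0 + p1 + p2), by omega⟩) :=
        (if_neg (by simpa using c1)).trans ((if_neg (by simpa using c2)).trans
          (if_neg (by simpa using c3)))
      rw [List.getD_append_right _ _ _ _ (by simp; omega)]
      simp only [List.length_append, length_blk]
      rw [getD_blk _ _ (by omega), hc]
      simp [mcol, show (i : ℕ) - (p0 + p1 + p2) < n by omega]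
  · intro x
    obtain ⟨⟨b, c⟩, rfl⟩ := toLex.surjective x
    have hc := c.2
    have key : ∀ (b : Fin 4), toLex (b, c) ∈ columnSet n α ↔
        (c : ℕ) < (![p0, p1, p2, p3] : Fin 4 → ℕ) b := by
      intro b
      simp only [columnSet, Finset.mem_filter, Finset.mem_univ, true_and, ofLex_toLex]
      fin_cases b
      · simp only [Fin.zero_eta, Matrix.cons_val_zero, Finset.mem_compl, opp, initial,
          Finset.mem_image, Finset.mem_filter, Finset.mem_univ, true_and]
        constructor
        · intro h
          by_contra h'
          exact h ⟨Fin.rev c, by simp [Fin.val_rev]; omega, by simp⟩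
        · rintro h ⟨d, hd, rfl⟩
          simp [Fin.val_rev] at h
          omega
      · simp [initial]; omega
      · simp [initial]; omega
      · simp [initial]; omega
    rw [key]
    constructor
    · intro h
      fin_cases b
      · refine ⟨c, ?_⟩
        simp at h
        simp [columnEnum, h]
      · simp at h
        refine ⟨⟨p0 + c, by omega⟩, ?_⟩
        simp [columnEnum, h]
      · simp at h
        refine ⟨⟨p0 + p1 + c, by omega⟩, ?_⟩
        refine (if_neg (by simp; omega)).trans ((if_neg (by simp)).trans
          ((if_pos (by simp; omega)).trans ?_))
        simp
      · simp at h
        refine ⟨⟨p0 + p1 + p2 + c, by omega⟩, ?_⟩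
        refine (if_neg (by simp; omega)).trans ((if_neg (by simp; omega)).trans
          ((if_neg (by simp)).trans ?_))
        simp
    · rintro ⟨d, hd⟩
      have := columnEnum_snd_lt ![p0, p1, p2, p3] (n := n)
        (by rw [Fin.sum_univ_four]; simp; omega) d
      rw [hd] at this
      exact this

lemma multiCorner_of_notMem (g : Fin 3 → Matrix (Fin n) (Fin n) R) {α : Fin 3 → ℤ}
    (hα : α ∉ simplex n) : multiCorner g α = 0 := if_neg hα

lemma sum_mult {α : Fin 3 → ℤ} (hα : α ∈ simplex n) : ∑ b, mult n α b = n := by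
  obtain ⟨h0, hs⟩ := hα
  have a0 := h0 0
  have a1 := h0 1
  have a2 := h0 2
  rw [Fin.sum_univ_four]
  simp [mult]
  omega

lemma multiCorner_of_mult (g : Fin 3 → Matrix (Fin n) (Fin n) R) {p : Fin 4 → ℕ}
    (hp : ∑ b, p b = n) {α : Fin 3 → ℤ} (h0 : α 0 = p 1) (h1 : α 1 = p 2) (h2 : α 2 = p 3) :
    multiCorner g α = cornerDet (prods g) p := by
  rw [Fin.sum_univ_four] at hp
  rw [multiCorner_eq]
  · congr 1
    ext1 b
    fin_cases b <;> simp [mult, h0, h1, h2]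
    omega
  · refine ⟨fun l => ?_, ?_⟩
    · fin_cases l <;> simp [h0, h1, h2]
    · rw [h0, h1, h2]; omega

end Columns


/-! ### Minors as determinants of lists -/

section Bottom

variable {R : Type*} [CommRing R] {n : ℕ}

/-- The matrix is block lower triangular with an identity block in the upper left corner. Padding by
standard basis vectors thus turns a minor on the last rows into a full determinant. -/
lemma listDet_blk_one_append (p i : ℕ) (h : p + i = n) (v : Fin i → Fin n → R) :
    listDet (blk 1 0 p ++ List.ofFn v) =
      (Matrix.of fun a b : Fin i => v b ⟨p + a, by omega⟩).det := by
  subst h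
  have : (listMat (blk 1 0 p ++ List.ofFn v)).submatrix finSumFinEquiv finSumFinEquiv =
      Matrix.fromBlocks (1 : Matrix (Fin p) (Fin p) R) 0
        (Matrix.of fun (a : Fin i) (b : Fin p) => v a (Fin.castAdd i b))
        (Matrix.of fun a b : Fin i => v a (Fin.natAdd p b)) := by
    ext x y
    rcases x with x | x <;> rcases y with y | y
    · simp only [listMat, Matrix.submatrix_apply, finSumFinEquiv_apply_left, Matrix.of_apply,
        Matrix.fromBlocks_apply₁₁]
      rw [List.getD_append _ _ _ _ (by simp), getD_blk _ _ (by simp)]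
      simp [mcol, Matrix.one_apply, show (x : ℕ) < p + i by omega, Fin.ext_iff, eq_comm]
    · simp only [listMat, Matrix.submatrix_apply, finSumFinEquiv_apply_left, Matrix.of_apply,
        Matrix.fromBlocks_apply₁₂, finSumFinEquiv_apply_right]
      rw [List.getD_append _ _ _ _ (by simp), getD_blk _ _ (by simp)]
      have := x.2
      simp [mcol, Matrix.one_apply, show (x : ℕ) < p + i by omega, Fin.ext_iff]
      omega
    · simp only [listMat, Matrix.submatrix_apply, finSumFinEquiv_apply_left, Matrix.of_apply,
        Matrix.fromBlocks_apply₂₁, finSumFinEquiv_apply_right]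
      rw [List.getD_append_right _ _ _ _ (by simp)]
      simp
    · simp only [listMat, Matrix.submatrix_apply, Matrix.of_apply,
        Matrix.fromBlocks_apply₂₂, finSumFinEquiv_apply_right]
      rw [List.getD_append_right _ _ _ _ (by simp)]
      simp
  rw [listDet, ← Matrix.det_submatrix_equiv_self finSumFinEquiv, this,
    Matrix.det_fromBlocks_zero₁₂, Matrix.det_one, one_mul, ← Matrix.det_transpose]
  rfl

lemma mem_opp_initial {i : ℕ} (hi : i ≤ n) (x : Fin n) : x ∈ opp (initial n i) ↔ n - i ≤ x := by
  have := x.2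
  simp only [opp, initial, Finset.mem_image, Finset.mem_filter, Finset.mem_univ, true_and]
  constructor
  · rintro ⟨d, hd, rfl⟩
    simp [Fin.val_rev]; omega
  · intro h
    exact ⟨Fin.rev x, by simp [Fin.val_rev]; omega, by simp⟩

lemma mem_opp_initialSkip {i : ℕ} (hi : i < n) (x : Fin n) :
    x ∈ opp (initialSkip n i) ↔ n - i - 1 ≤ x ∧ (x : ℕ) ≠ n - i := by
  have := x.2
  simp only [opp, initialSkip, Finset.mem_image, Finset.mem_filter, Finset.mem_univ, true_and]
  constructor
  · rintro ⟨d, hd, rfl⟩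
    have := d.2
    simp only [Fin.val_rev]; omega
  · intro h
    exact ⟨Fin.rev x, by simp only [Fin.val_rev]; omega, by simp⟩

/-- A minor on the last rows. -/
lemma minor_opp_initial (g : Matrix (Fin n) (Fin n) R) {i : ℕ} (hi : i ≤ n) {J : Finset (Fin n)}
    (f : Fin i → Fin n) (hf : StrictMono f) (hJ : ∀ x, x ∈ J ↔ ∃ c, f c = x) :
    minor g (opp (initial n i)) J =
      listDet (blk 1 0 (n - i) ++ List.ofFn fun c => mcol g (f c)) := by
  rw [minor_eq_det g (fun c : Fin i => (⟨n - i + c, by omega⟩ : Fin n)) f _ hf _ hJ,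
    listDet_blk_one_append (n - i) i (by omega)]
  · congr 1
    ext a b
    simp [mcol]
  · intro a b h
    have : (a : ℕ) < b := h
    simp [this]
  · intro x
    rw [mem_opp_initial hi]
    have := x.2
    constructor
    · intro h
      exact ⟨⟨x - (n - i), by omega⟩, by ext; simp; omega⟩
    · rintro ⟨c, rfl⟩
      simp

lemma ofFn_mcol (g : Matrix (Fin n) (Fin n) R) (a i : ℕ) :
    (List.ofFn fun c : Fin i => mcol g (a + c)) = blk g a i := by
  apply List.ext_getElem
  · simp
  · intro k h1 h2
    simp [blk]

lemma minor_opp_initial_interval (g : Matrix (Fin n) (Fin n) R) {i j : ℕ} (hi : i + j ≤ n) :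
    minor g (opp (initial n j)) (interval n i j) =
      listDet (blk 1 0 (n - j) ++ blk g i j) := by
  rw [minor_opp_initial g (by omega) (fun c : Fin j => (⟨i + c, by omega⟩ : Fin n)), ← ofFn_mcol g i j]
  · intro a b h
    have : (a : ℕ) < b := h
    simp [this]
  · intro x
    simp only [interval, Finset.mem_filter, Finset.mem_univ, true_and]
    constructor
    · intro h
      exact ⟨⟨x - i, by omega⟩, by ext; simp; omega⟩
    · rintro ⟨c, rfl⟩
      simp

lemma initial_eq_interval (i : ℕ) : initial n i = interval n 0 i := by
  ext x; simp [initial, interval]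

lemma minor_opp_initial_initial (g : Matrix (Fin n) (Fin n) R) {i : ℕ} (hi : i ≤ n) :
    minor g (opp (initial n i)) (initial n i) = listDet (blk 1 0 (n - i) ++ blk g 0 i) := by
  rw [initial_eq_interval (n := n) i, ← minor_opp_initial_interval g (by omega),
    initial_eq_interval]

lemma minor_opp_initial_skip (g : Matrix (Fin n) (Fin n) R) {i : ℕ} (h1 : 1 ≤ i) (hi : i < n) :
    minor g (opp (initial n i)) (initialSkip n i) =
      listDet (blk 1 0 (n - i) ++ (blk g 0 (i - 1) ++ [mcol g i])) := by
  rw [minor_opp_initial g (by omega)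
    (fun c : Fin i => (⟨if (c : ℕ) + 1 = i then i else c, by split_ifs <;> omega⟩ : Fin n))]
  · congr 2
    apply List.ext_getElem
    · simp; omega
    · intro k h2 h3
      simp only [List.length_ofFn] at h2
      rw [List.getElem_ofFn]
      rcases eq_or_ne (k + 1) i with h | h
      · subst h
        simp
      · rw [List.getElem_append_left (by simp; omega)]
        simp [blk, h]
  · intro a b h
    have : (a : ℕ) < b := h
    simp only [Fin.mk_lt_mk]
    split_ifs <;> omega
  · intro x
    simp only [initialSkip, Finset.mem_filter, Finset.mem_univ, true_and]
    constructor
    · intro h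
      rcases eq_or_ne (x : ℕ) i with h' | h'
      · exact ⟨⟨i - 1, by omega⟩, by ext; simp [show i - 1 + 1 = i by omega, h']⟩
      · exact ⟨⟨x, by omega⟩, by ext; simp; omega⟩
    · rintro ⟨c, rfl⟩
      have := c.2
      simp only
      split_ifs <;> omega

/-- Exchanging the rows n - i - 1 and n - i (counted from 0) makes the rows of the minor the last i
ones. The exchange has determinant -1, and on the padding by standard basis vectors it acts as a
skip. -/
lemma minor_opp_skip_initial (g : Matrix (Fin n) (Fin n) R) {i : ℕ} (h1 : 1 ≤ i) (hi : i < n) :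
    minor g (opp (initialSkip n i)) (initial n i) =
      -listDet (blk 1 0 (n - i - 1) ++ [mcol 1 (n - i)] ++ blk g 0 i) := by
  let a : Fin n := ⟨n - i - 1, by omega⟩
  let b : Fin n := ⟨n - i, by omega⟩
  have hab : a ≠ b := by simp only [a, b, ne_eq, Fin.mk.injEq]; omega
  let M : Matrix (Fin n) (Fin n) R := (1 : Matrix (Fin n) (Fin n) R).submatrix (Equiv.swap a b) id
  have hM : M.det = -1 := by
    rw [Matrix.det_permute, Equiv.Perm.sign_swap hab]; simp
  have hMg : M * g = g.submatrix (Equiv.swap a b) id := by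
    ext x y
    simp [M, Matrix.mul_apply, Matrix.one_apply]
  have hMc : ∀ k (hk : k < n), M.mulVec (mcol 1 k) = mcol 1 (Equiv.swap a b ⟨k, hk⟩) := by
    intro k hk
    rw [← mcol_mul, mul_one]
    ext r
    simp only [mcol, M, Matrix.submatrix_apply, Matrix.one_apply, hk, id, Fin.is_lt, dite_true]
    congr 1
    rw [Equiv.swap_apply_eq_iff]
  have e1 : minor g (opp (initialSkip n i)) (initial n i) =
      minor (M * g) (opp (initial n i)) (initial n i) := by
    have hJ : ∀ x : Fin n, x ∈ initial n i ↔
        ∃ c : Fin i, (⟨c, by omega⟩ : Fin n) = x := by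
      intro x
      simp only [initial, Finset.mem_filter, Finset.mem_univ, true_and]
      constructor
      · intro h; exact ⟨⟨x, by omega⟩, rfl⟩
      · rintro ⟨c, rfl⟩; simp
    have hJm : StrictMono (fun c : Fin i => (⟨c, by omega⟩ : Fin n)) := fun _ _ h => h
    rw [minor_eq_det (M * g) (fun c : Fin i => (⟨n - i + c, by omega⟩ : Fin n)) _ _ hJm _ hJ,
      minor_eq_det g (fun c : Fin i => (⟨if (c : ℕ) = 0 then n - i - 1 else n - i + c,
        by split_ifs <;> omega⟩ : Fin n)) _ _ hJm _ hJ, hMg]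
    · congr 1
      ext x y
      simp only [Matrix.submatrix_apply, id]
      congr 1
      have := x.2
      split_ifs with h
      · simp only [h, add_zero]
        exact (Equiv.swap_apply_right a b).symm
      · rw [Equiv.swap_apply_of_ne_of_ne] <;> simp only [a, b, ne_eq, Fin.mk.injEq] <;> omega
    · intro x y h
      have : (x : ℕ) < y := h
      simp only [Fin.mk_lt_mk]
      split_ifs <;> omega
    · intro x
      rw [mem_opp_initialSkip hi]
      have := x.2
      constructor
      · intro h
        exact ⟨⟨x - (n - i), by omega⟩, by ext; simp only; split_ifs <;> omega⟩
      · rintro ⟨c, rfl⟩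
        simp only
        split_ifs <;> omega
    · intro x y h
      have : (x : ℕ) < y := h
      simp only [Fin.mk_lt_mk]
      omega
    · intro x
      rw [mem_opp_initial hi.le]
      have := x.2
      constructor
      · intro h
        exact ⟨⟨x - (n - i), by omega⟩, by ext; simp; omega⟩
      · rintro ⟨c, rfl⟩
        simp
  rw [e1, minor_opp_initial_initial _ hi.le]
  have e2 := listDet_map_mulVec M (blk 1 0 (n - i - 1) ++ [mcol 1 (n - i)] ++ blk g 0 i)
    (by simp; omega)
  rw [hM, neg_one_mul] at e2
  rw [← e2, List.map_append, List.map_append, ← blk_mul, ← blk_mul, mul_one]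
  have e3 : blk M 0 (n - i - 1) = blk 1 0 (n - i - 1) := by
    refine List.map_congr_left fun k hk => ?_
    rw [List.mem_range'_1] at hk
    have := hMc k (by omega)
    rw [← mcol_mul, mul_one] at this
    rw [this, Equiv.swap_apply_of_ne_of_ne] <;> simp only [a, b, ne_eq, Fin.mk.injEq] <;> omega
  rw [e3, List.map_singleton, hMc _ (by omega)]
  have e4 : Equiv.swap a b ⟨n - i, by omega⟩ = a := Equiv.swap_apply_right a b
  rw [e4]
  have e5 : n - i = (n - i - 1) + 1 := by omega
  conv_lhs => rw [e5, blk_succ, zero_add]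

end Bottom

/-! ### The potential as a sum over rhombi -/

section Rhombi

variable {K : Type*} [Field K] {n : ℕ}

/-- The determinant of the first columns of four matrices, with the last column taken from the
block `v` replaced by the next one. -/
def skipDet (H : Fin 4 → Matrix (Fin n) (Fin n) K) (v : Fin 4) (p : Fin 4 → ℕ) : K :=
  listDet (flat (ins (blocks H (p - Pi.single v 1)) v (mcol (H v) (p v))))

/-- The quotient of `skipDet` by `cornerDet`. -/
def skipQuot (H : Fin 4 → Matrix (Fin n) (Fin n) K) (v : Fin 4) (p : Fin 4 → ℕ) : K :=
  skipDet H v p / cornerDet H p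

/-- The quotient attached to the small rhombus with vertices `S + 2v`, `S + v + b`, `S + b + c`,
`S + v + c`. -/
def rhombusQuot (H : Fin 4 → Matrix (Fin n) (Fin n) K) (S : Fin 4 → ℕ) (v b c : Fin 4) : K :=
  cornerDet H (S + Pi.single v 1 + Pi.single v 1) * cornerDet H (S + Pi.single b 1 + Pi.single c 1) /
    (cornerDet H (S + Pi.single v 1 + Pi.single b 1) *
      cornerDet H (S + Pi.single v 1 + Pi.single c 1))

/-- This is the Plücker relation for the columns S v and S v + 1 of block v and the next columns of
b and c: over the common denominator, the difference has the numerator of the rhombus quotient. -/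
lemma skipQuot_sub (H : Fin 4 → Matrix (Fin n) (Fin n) K) {S : Fin 4 → ℕ} {v b c : Fin 4}
    (hS : ∑ a, S a + 2 = n) (hvb : v ≠ b) (hvc : v ≠ c) (hbc : b ≠ c)
    (hs : sg K v b * sg K v c * sg K b c = 1)
    (hb : cornerDet H (S + Pi.single v 1 + Pi.single b 1) ≠ 0)
    (hc : cornerDet H (S + Pi.single v 1 + Pi.single c 1) ≠ 0) :
    skipQuot H v (S + Pi.single v 1 + Pi.single c 1) -
      skipQuot H v (S + Pi.single v 1 + Pi.single b 1) = rhombusQuot H S v b c := by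
  have hD : ∀ a b, a ≠ b → cornerDet H (S + Pi.single a 1 + Pi.single b 1) =
      listDet (flat (ins (ins (blocks H S) a (mcol (H a) (S a))) b (mcol (H b) (S b)))) := by
    intro a b hab
    rw [cornerDet, blocks_add_single, blocks_add_single]
    simp [hab.symm]
  have hDD : cornerDet H (S + Pi.single v 1 + Pi.single v 1) =
      listDet (flat (ins (ins (blocks H S) v (mcol (H v) (S v))) v (mcol (H v) (S v + 1)))) := by
    rw [cornerDet, blocks_add_single, blocks_add_single]
    simp
  have hskip : ∀ c, v ≠ c → skipDet H v (S + Pi.single v 1 + Pi.single c 1) =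
      listDet (flat (ins (ins (blocks H S) v (mcol (H v) (S v + 1))) c (mcol (H c) (S c)))) := by
    intro c hvc
    have e : S + Pi.single v 1 + Pi.single c 1 - Pi.single v 1 = S + Pi.single c 1 := by
      rw [add_right_comm, add_tsub_cancel_right]
    rw [skipDet, e, blocks_add_single]
    congr 2
    simp only [Pi.add_apply, Pi.single_eq_same, Pi.single_eq_of_ne hvc, add_zero]
    unfold ins
    rw [Function.update_of_ne hvc, Function.update_of_ne hvc.symm, Function.update_comm hvc]
  have hpl := plucker_ins_same (blocks H S) v b c (mcol (H v) (S v)) (mcol (H v) (S v + 1))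
    (mcol (H b) (S b)) (mcol (H c) (S c)) (by rw [length_flat_blocks, hS]) hs
  rw [← hskip c hvc, ← hskip b hvb, ← hD v b hvb, ← hD v c hvc, ← hD b c hbc, ← hDD] at hpl
  rw [skipQuot, skipQuot, rhombusQuot, div_sub_div _ _ hc hb, ← hpl]
  congr 1 <;> ring

lemma octahedron (H : Fin 4 → Matrix (Fin n) (Fin n) K) {S : Fin 4 → ℕ}
    (hS : ∑ a, S a + 2 = n) :
    cornerDet H (S + Pi.single 0 1 + Pi.single 2 1) *
        cornerDet H (S + Pi.single 1 1 + Pi.single 3 1) =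
      cornerDet H (S + Pi.single 0 1 + Pi.single 1 1) *
        cornerDet H (S + Pi.single 2 1 + Pi.single 3 1) +
      cornerDet H (S + Pi.single 0 1 + Pi.single 3 1) *
        cornerDet H (S + Pi.single 1 1 + Pi.single 2 1) := by
  have hD : ∀ a b, a ≠ b → cornerDet H (S + Pi.single a 1 + Pi.single b 1) =
      listDet (flat (ins (ins (blocks H S) a (mcol (H a) (S a))) b (mcol (H b) (S b)))) := by
    intro a b hab
    rw [cornerDet, blocks_add_single, blocks_add_single]
    simp [hab.symm]
  rw [hD 0 2 (by decide), hD 1 3 (by decide), hD 0 1 (by decide), hD 2 3 (by decide),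
    hD 0 3 (by decide), hD 1 2 (by decide)]
  exact plucker_ins _ _ _ _ _ (by rw [length_flat_blocks, hS])

/-- The value of `skipQuot` with `m` columns from `v` and the other ones from `b`. -/
def edgeQuot (H : Fin 4 → Matrix (Fin n) (Fin n) K) (v : Fin 4) (m : ℕ) (b : Fin 4) : K :=
  skipQuot H v (Pi.single v m + Pi.single b (n - m))

lemma flat_pair (H : Fin 4 → Matrix (Fin n) (Fin n) K) {a b : Fin 4} (hab : a < b) (k l : ℕ) :
    flat (blocks H (Pi.single a k + Pi.single b l)) = blk (H a) 0 k ++ blk (H b) 0 l := by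
  revert hab
  fin_cases a <;> fin_cases b <;> simp [flat, blocks]

lemma flat_pair_left (H : Fin 4 → Matrix (Fin n) (Fin n) K) {a b : Fin 4} (hab : a < b)
    (k l : ℕ) (x : Fin n → K) :
    flat (ins (blocks H (Pi.single a k + Pi.single b l)) a x) =
      blk (H a) 0 k ++ [x] ++ blk (H b) 0 l := by
  revert hab
  fin_cases a <;> fin_cases b <;> simp [flat, blocks, ins]

lemma flat_pair_right (H : Fin 4 → Matrix (Fin n) (Fin n) K) {a b : Fin 4} (hab : a < b)
    (k l : ℕ) (x : Fin n → K) :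
    flat (ins (blocks H (Pi.single a k + Pi.single b l)) b x) =
      blk (H a) 0 k ++ (blk (H b) 0 l ++ [x]) := by
  revert hab
  fin_cases a <;> fin_cases b <;> simp [flat, blocks, ins]

lemma sum_Ico_reflect' (f : ℕ → K) : ∑ i ∈ Finset.Ico 1 n, f (n - i) = ∑ i ∈ Finset.Ico 1 n, f i := by
  refine Finset.sum_nbij' (fun i => n - i) (fun i => n - i) ?_ ?_ ?_ ?_
    (fun _ _ => rfl) <;> simp only [Finset.mem_Ico] <;> intros <;> omega

/-- Left multiplication by H a carries the columns of 1 and g to those of H a and H b. All minors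
acquire the factor det (H a), which cancels in the quotients. A skipped column of g is a skip in
block b; a skipped row is a skip in block a with a minus sign. -/
lemma bkPotential_eq (H : Fin 4 → Matrix (Fin n) (Fin n) K) {a b : Fin 4} (hab : a < b)
    {g : Matrix (Fin n) (Fin n) K} (hg : H b = H a * g) (hdet : (H a).det ≠ 0) :
    bkPotential g = ∑ i ∈ Finset.Ico 1 n, (edgeQuot H b i a - edgeQuot H a i b) := by
  -- The i-th summand has i columns in b but n - i columns in a, so the second sum is reflected.
  rw [Finset.sum_sub_distrib, ← sum_Ico_reflect' (fun i => edgeQuot H a i b),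
    ← Finset.sum_sub_distrib, bkPotential]
  refine Finset.sum_congr rfl fun i hi => ?_
  obtain ⟨h1, h2⟩ := Finset.mem_Ico.1 hi
  have hb : blk (H b) 0 = fun k => (blk g 0 k).map (H a).mulVec := by
    ext1 k; rw [hg, blk_mul]
  have ha : blk (H a) 0 = fun k => (blk 1 0 k).map (H a).mulVec := by
    ext1 k; rw [← blk_mul, mul_one]
  have e0 : n - (n - i) = i := by omega
  have d0 : cornerDet H (Pi.single a (n - i) + Pi.single b i) =
      (H a).det * minor g (opp (initial n i)) (initial n i) := by
    rw [cornerDet, flat_pair H hab, minor_opp_initial_initial g h2.le, ← listDet_map_mulVec _ _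
      (by simp; omega), List.map_append, ha, hb]
  have d1 : skipDet H b (Pi.single a (n - i) + Pi.single b i) =
      (H a).det * minor g (opp (initial n i)) (initialSkip n i) := by
    have e : (Pi.single a (n - i) + Pi.single b i - Pi.single b 1 : Fin 4 → ℕ) =
        Pi.single a (n - i) + Pi.single b (i - 1) := by
      ext1 x
      rcases eq_or_ne x b with rfl | hx
      · simp [hab.ne']
      · simp [hx]
    rw [skipDet, e, flat_pair_right H hab, minor_opp_initial_skip g h1 h2, ← listDet_map_mulVec _ _
      (by simp; omega), List.map_append, List.map_append, ha, hb]
    simp only [Pi.add_apply, Pi.single_eq_of_ne hab.ne', Pi.single_eq_same, zero_add,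
      List.map_singleton]
    rw [hg, mcol_mul]
  have d2 : skipDet H a (Pi.single a (n - i) + Pi.single b i) =
      -((H a).det * minor g (opp (initialSkip n i)) (initial n i)) := by
    have e : (Pi.single a (n - i) + Pi.single b i - Pi.single a 1 : Fin 4 → ℕ) =
        Pi.single a (n - i - 1) + Pi.single b i := by
      ext1 x
      rcases eq_or_ne x a with rfl | hx
      · simp [hab.ne]
      · simp [hx]
    rw [skipDet, e, flat_pair_left H hab, minor_opp_skip_initial g h1 h2, mul_neg, neg_neg,
      ← listDet_map_mulVec _ _ (by simp; omega), List.map_append, List.map_append, ha, hb]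
    simp only [Pi.add_apply, Pi.single_eq_of_ne hab.ne, Pi.single_eq_same, add_zero,
      List.map_singleton]
    rw [← mcol_mul, mul_one]
  rw [edgeQuot, edgeQuot, e0, add_comm (Pi.single b i : Fin 4 → ℕ), skipQuot, skipQuot, d0, d1, d2,
    ← sub_div, sub_neg_eq_add, ← mul_add, mul_div_mul_left _ _ hdet, add_comm (minor _ _ _)]

/-- The factors g₁, g₂, g₃ belong to the edges 01, 12, 23 and their product to the edge 03. The
minus sign reverses the last one, so that the four edges form a cycle; in `Fin 4` the neighbours of
v are v + 1 and v + 3. -/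
lemma potential_eq {g : Fin 3 → Matrix (Fin n) (Fin n) K} (hg : ∀ l, (g l).det ≠ 0) :
    potential g = ∑ v, ∑ m ∈ Finset.Ico 1 n,
      (edgeQuot (prods g) v m (v + 3) - edgeQuot (prods g) v m (v + 1)) := by
  have h1 := bkPotential_eq (prods g) (a := 0) (b := 1) (g := g 0) (by decide)
    (by simp [prods]) (by simp [prods])
  have h2 := bkPotential_eq (prods g) (a := 1) (b := 2) (g := g 1) (by decide)
    (by simp [prods]) (by simpa [prods] using hg 0)
  have h3 := bkPotential_eq (prods g) (a := 2) (b := 3) (g := g 2) (by decide)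
    (by simp [prods]) (by simp [prods, hg 0, hg 1])
  have h4 := bkPotential_eq (prods g) (a := 0) (b := 3) (g := g 0 * g 1 * g 2) (by decide)
    (by simp [prods]) (by simp [prods])
  rw [potential, h1, h2, h3, h4, Fin.sum_univ_four]
  simp only [Finset.sum_sub_distrib]
  have e : ∀ v b : Fin 4, ∑ m ∈ Finset.Ico 1 n, edgeQuot (prods g) v m b =
    (fun v b => ∑ m ∈ Finset.Ico 1 n, edgeQuot (prods g) v m b) v b := fun _ _ => rfl
  generalize (fun v b => ∑ m ∈ Finset.Ico 1 n, edgeQuot (prods g) v m b) = E at e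
  simp only [e]
  change _ = (E 0 3 - E 0 1) + (E 1 0 - E 1 2) + (E 2 1 - E 2 3) + (E 3 2 - E 3 0)
  ring

end Rhombi


/-! ### Telescoping the potential along paths of rhombi -/

section Monotone

variable {K : Type*} [Field K] {n : ℕ}

lemma fin_four_ne : ∀ v : Fin 4, v ≠ v + 1 ∧ v ≠ v + 2 ∧ v ≠ v + 3 ∧ v + 1 ≠ v + 2 ∧
    v + 1 ≠ v + 3 ∧ v + 2 ≠ v + 3 := by decide

lemma fin_four_eq : ∀ v x : Fin 4, x = v ∨ x = v + 1 ∨ x = v + 2 ∨ x = v + 3 := by decide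

lemma sum_cyclic (q : Fin 4 → ℕ) (v : Fin 4) :
    ∑ b, q b = q v + q (v + 1) + q (v + 2) + q (v + 3) := by
  rw [Fin.sum_univ_four]
  fin_cases v
  · rfl
  · change _ = q 1 + q 2 + q 3 + q 0; omega
  · change _ = q 2 + q 3 + q 0 + q 1; omega
  · change _ = q 3 + q 0 + q 1 + q 2; omega

lemma sg_cyclic (v : Fin 4) :
    sg K v (v + 1) * sg K v (v + 2) * sg K (v + 1) (v + 2) = 1 ∧
    sg K v (v + 1) * sg K v (v + 3) * sg K (v + 1) (v + 3) = 1 ∧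
    sg K v (v + 2) * sg K v (v + 3) * sg K (v + 2) (v + 3) = 1 := by
  fin_cases v <;> simp [sg]

lemma exists_add_single {q : Fin 4 → ℕ} {v b : Fin 4} (hvb : v ≠ b) (hv : 1 ≤ q v)
    (hb : 1 ≤ q b) : ∃ S : Fin 4 → ℕ, q = S + Pi.single v 1 + Pi.single b 1 := by
  refine ⟨q - Pi.single v 1 - Pi.single b 1, ?_⟩
  ext1 x
  rcases eq_or_ne x v with rfl | h1
  · simp [hvb]; omega
  rcases eq_or_ne x b with rfl | h2
  · simp [h1]; omega
  · simp [h1, h2]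

lemma sum_add_single (S : Fin 4 → ℕ) (v : Fin 4) :
    ∑ b, (S + Pi.single v 1 : Fin 4 → ℕ) b = ∑ b, S b + 1 := by
  simp [Finset.sum_add_distrib]

variable {H : Fin 4 → Matrix (Fin n) (Fin n) K} {Q : AddSubmonoid K}

/-- Here Q stands for an arbitrary additive submonoid that contains the rhombus quotients. It will
be the submonoid of positive functions, and that of positive functions with tropicalization at most
0 at a given point. -/
lemma skipQuot_move_mem (hne : ∀ p, ∑ b, p b = n → cornerDet H p ≠ 0)
    (hQ : ∀ S v b c, ∑ a, S a + 2 = n → v ≠ b → v ≠ c → b ≠ c → rhombusQuot H S v b c ∈ Q)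
    {S : Fin 4 → ℕ} {v b c : Fin 4} (hvb : v ≠ b) (hvc : v ≠ c) (hbc : b ≠ c)
    (hs : sg K v b * sg K v c * sg K b c = 1)
    (hS : ∑ a, (S + Pi.single v 1 + Pi.single b 1 : Fin 4 → ℕ) a = n) :
    skipQuot H v (S + Pi.single v 1 + Pi.single c 1) -
      skipQuot H v (S + Pi.single v 1 + Pi.single b 1) ∈ Q := by
  have h := hS
  rw [sum_add_single, sum_add_single] at h
  rw [skipQuot_sub H h hvb hvc hbc hs (hne _ hS)
    (hne _ (by rw [sum_add_single, sum_add_single]; exact h))]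
  exact hQ S v b c h hvb hvc hbc

/-- The columns of v + 1 and v + 2 are moved to v + 3 one at a time. The triples (v, v+1, v+3) and
(v, v+2, v+3) are in cyclic order, so each move adds a rhombus quotient. The induction is on the
number of columns still to be moved. -/
lemma edgeQuot_sub_mem (hne : ∀ p, ∑ b, p b = n → cornerDet H p ≠ 0)
    (hQ : ∀ S v b c, ∑ a, S a + 2 = n → v ≠ b → v ≠ c → b ≠ c → rhombusQuot H S v b c ∈ Q)
    (v : Fin 4) (k : ℕ) (q : Fin 4 → ℕ) (hk : q (v + 1) + q (v + 2) = k) (hv : 1 ≤ q v)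
    (hq : ∑ b, q b = n) : edgeQuot H v (q v) (v + 3) - skipQuot H v q ∈ Q := by
  obtain ⟨-, s13, s23⟩ := sg_cyclic (K := K) v
  obtain ⟨n1, n2, n3, n12, n13, n23⟩ := fin_four_ne v
  induction k generalizing q with
  | zero =>
    have hc := sum_cyclic q v
    have : q = Pi.single v (q v) + Pi.single (v + 3) (n - q v) := by
      ext1 x
      rcases fin_four_eq v x with rfl | rfl | rfl | rfl
      · simp [n3]
      · simp [n1.symm, n13]; omega
      · simp [n2.symm, n23]; omega
      · simp [n3.symm]; omega
    rw [edgeQuot, ← this, sub_self]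
    exact Q.zero_mem
  | succ k ih =>
    rcases Nat.eq_zero_or_pos (q (v + 1)) with h0 | h0
    · obtain ⟨S, rfl⟩ := exists_add_single n2 hv (show 1 ≤ q (v + 2) by omega)
      have hS := hq
      rw [sum_add_single] at hq
      have := ih (S + Pi.single v 1 + Pi.single (v + 3) 1)
        (by simp [n1.symm, n2.symm, n12, n13, n23] at hk ⊢; omega) (by simp)
        (by rw [sum_add_single]; exact hq)
      have h2 := skipQuot_move_mem hne hQ n2 n3 n23 s23 hS
      have h3 := Q.add_mem this h2
      simpa [n3, n2] using h3
    · obtain ⟨S, rfl⟩ := exists_add_single n1 hv h0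
      have hS := hq
      rw [sum_add_single] at hq
      have := ih (S + Pi.single v 1 + Pi.single (v + 3) 1)
        (by simp [n1.symm, n2.symm, n12.symm, n13, n23] at hk ⊢; omega) (by simp)
        (by rw [sum_add_single]; exact hq)
      have h2 := skipQuot_move_mem hne hQ n1 n3 n13 s13 hS
      have h3 := Q.add_mem this h2
      simpa [n3, n1] using h3

/-- The other half of a path: the columns of v + 2 and v + 3 are moved back to v + 1, and each move
is traversed in the opposite direction. -/
lemma sub_edgeQuot_mem (hne : ∀ p, ∑ b, p b = n → cornerDet H p ≠ 0)
    (hQ : ∀ S v b c, ∑ a, S a + 2 = n → v ≠ b → v ≠ c → b ≠ c → rhombusQuot H S v b c ∈ Q)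
    (v : Fin 4) (k : ℕ) (q : Fin 4 → ℕ) (hk : q (v + 2) + q (v + 3) = k) (hv : 1 ≤ q v)
    (hq : ∑ b, q b = n) : skipQuot H v q - edgeQuot H v (q v) (v + 1) ∈ Q := by
  obtain ⟨s12, s13, -⟩ := sg_cyclic (K := K) v
  obtain ⟨n1, n2, n3, n12, n13, n23⟩ := fin_four_ne v
  induction k generalizing q with
  | zero =>
    have hc := sum_cyclic q v
    have : q = Pi.single v (q v) + Pi.single (v + 1) (n - q v) := by
      ext1 x
      rcases fin_four_eq v x with rfl | rfl | rfl | rfl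
      · simp [n1]
      · simp [n1.symm]; omega
      · simp [n2.symm, n12.symm]; omega
      · simp [n3.symm, n13.symm]; omega
    rw [edgeQuot, ← this, sub_self]
    exact Q.zero_mem
  | succ k ih =>
    rcases Nat.eq_zero_or_pos (q (v + 2)) with h0 | h0
    · obtain ⟨S, rfl⟩ := exists_add_single n3 hv (show 1 ≤ q (v + 3) by omega)
      have hS := hq
      rw [sum_add_single] at hq
      have hq' : ∑ a, (S + Pi.single v 1 + Pi.single (v + 1) 1 : Fin 4 → ℕ) a = n := by
        rw [sum_add_single]; exact hq
      have := ih (S + Pi.single v 1 + Pi.single (v + 1) 1)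
        (by simp [n2.symm, n3.symm, n12.symm, n13.symm, n23] at hk ⊢; omega) (by simp) hq'
      have h2 := skipQuot_move_mem hne hQ n1 n3 n13 s13 hq'
      have h3 := Q.add_mem h2 this
      simpa [n3, n1] using h3
    · obtain ⟨S, rfl⟩ := exists_add_single n2 hv h0
      have hS := hq
      rw [sum_add_single] at hq
      have hq' : ∑ a, (S + Pi.single v 1 + Pi.single (v + 1) 1 : Fin 4 → ℕ) a = n := by
        rw [sum_add_single]; exact hq
      have := ih (S + Pi.single v 1 + Pi.single (v + 1) 1)
        (by simp [n2.symm, n3.symm, n12.symm, n13.symm, n23.symm] at hk ⊢; omega) (by simp) hq'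
      have h2 := skipQuot_move_mem hne hQ n1 n2 n12 s12 hq'
      have h3 := Q.add_mem h2 this
      simpa [n2, n1] using h3

lemma edge_sub_edge_mem (hne : ∀ p, ∑ b, p b = n → cornerDet H p ≠ 0)
    (hQ : ∀ S v b c, ∑ a, S a + 2 = n → v ≠ b → v ≠ c → b ≠ c → rhombusQuot H S v b c ∈ Q)
    (v : Fin 4) {m : ℕ} (hm : 1 ≤ m) (hmn : m < n) :
    edgeQuot H v m (v + 3) - edgeQuot H v m (v + 1) ∈ Q := by
  have n1 := (fin_four_ne v).1
  have e : (Pi.single v m + Pi.single (v + 1) (n - m) : Fin 4 → ℕ) v = m := by simp [n1]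
  have := edgeQuot_sub_mem hne hQ v _ (Pi.single v m + Pi.single (v + 1) (n - m)) rfl
    (by rw [e]; exact hm) (by simp [Finset.sum_add_distrib]; omega)
  rw [e] at this
  exact this

lemma rhombusQuot_comm (S : Fin 4 → ℕ) (v b c : Fin 4) :
    rhombusQuot H S v b c = rhombusQuot H S v c b := by
  unfold rhombusQuot
  rw [add_right_comm S (Pi.single b 1), mul_comm (cornerDet H (S + Pi.single v 1 + Pi.single b 1))]

/-- The path from the edge towards v + 1 to the edge towards v + 3 is led through the move from S +
v + b to S + v + c. This move contributes the given rhombus, and the two remaining pieces lie in Q.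
-/
lemma edge_sub_edge_sub_rhombus_mem (hne : ∀ p, ∑ b, p b = n → cornerDet H p ≠ 0)
    (hQ : ∀ S v b c, ∑ a, S a + 2 = n → v ≠ b → v ≠ c → b ≠ c → rhombusQuot H S v b c ∈ Q)
    {S : Fin 4 → ℕ} {v b c : Fin 4} (hS : ∑ a, S a + 2 = n) (hvb : v ≠ b) (hvc : v ≠ c)
    (hbc : b ≠ c) :
    edgeQuot H v (S v + 1) (v + 3) - edgeQuot H v (S v + 1) (v + 1) - rhombusQuot H S v b c ∈ Q := by
  -- The rhombus quotient is symmetric in b and c, and exchanging them reverses the cyclic order of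
  -- v, b, c.
  wlog hs : sg K v b * sg K v c * sg K b c = 1 generalizing b c
  · rw [rhombusQuot_comm]
    refine this hvc hvb hbc.symm ?_
    have h1 : sg K c b = - sg K b c := by
      unfold sg
      rcases lt_or_gt_of_ne hbc with h | h
      · rw [if_pos h.le, if_neg h.not_ge]
      · rw [if_pos h.le, if_neg h.not_ge]; simp
    have h2 : ∀ a b, sg K a b = 1 ∨ sg K a b = -1 := fun a b => by
      unfold sg; split_ifs <;> simp
    rw [h1]
    rcases h2 v b with e1 | e1 <;> rcases h2 v c with e2 | e2 <;> rcases h2 b c with e3 | e3 <;>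
      simp [e1, e2, e3] at hs ⊢
  have s1 : ∑ a, (S + Pi.single v 1 + Pi.single b 1 : Fin 4 → ℕ) a = n := by
    rw [sum_add_single, sum_add_single]; exact hS
  have s2 : ∑ a, (S + Pi.single v 1 + Pi.single c 1 : Fin 4 → ℕ) a = n := by
    rw [sum_add_single, sum_add_single]; exact hS
  have h0 := skipQuot_sub H hS hvb hvc hbc hs (hne _ s1) (hne _ s2)
  have h1 := sub_edgeQuot_mem hne hQ v _ (S + Pi.single v 1 + Pi.single b 1) rfl (by simp; omega) s1
  have h2 := edgeQuot_sub_mem hne hQ v _ (S + Pi.single v 1 + Pi.single c 1) rfl (by simp; omega) s2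
  have e1 : (S + Pi.single v 1 + Pi.single b 1 : Fin 4 → ℕ) v = S v + 1 := by simp [hvb]
  have e2 : (S + Pi.single v 1 + Pi.single c 1 : Fin 4 → ℕ) v = S v + 1 := by simp [hvc]
  rw [e1] at h1
  rw [e2] at h2
  have h3 := Q.add_mem h1 h2
  rw [← h0]
  convert h3 using 1
  ring

variable {g : Fin 3 → Matrix (Fin n) (Fin n) K}

lemma potential_mem (hg : ∀ l, (g l).det ≠ 0)
    (hne : ∀ p, ∑ b, p b = n → cornerDet (prods g) p ≠ 0)
    (hQ : ∀ S v b c, ∑ a, S a + 2 = n → v ≠ b → v ≠ c → b ≠ c →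
      rhombusQuot (prods g) S v b c ∈ Q) : potential g ∈ Q := by
  rw [potential_eq hg]
  refine Q.sum_mem fun v _ => Q.sum_mem fun m hm => ?_
  obtain ⟨h1, h2⟩ := Finset.mem_Ico.1 hm
  exact edge_sub_edge_mem hne hQ v h1 h2

/-- The rhombus is taken out of the summand with block v and m = S v + 1, the number of columns of v
along the path through it; the other summands lie in Q. -/
lemma potential_sub_rhombus_mem (hg : ∀ l, (g l).det ≠ 0)
    (hne : ∀ p, ∑ b, p b = n → cornerDet (prods g) p ≠ 0)
    (hQ : ∀ S v b c, ∑ a, S a + 2 = n → v ≠ b → v ≠ c → b ≠ c →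
      rhombusQuot (prods g) S v b c ∈ Q)
    {S : Fin 4 → ℕ} {v b c : Fin 4} (hS : ∑ a, S a + 2 = n) (hvb : v ≠ b) (hvc : v ≠ c)
    (hbc : b ≠ c) : potential g - rhombusQuot (prods g) S v b c ∈ Q := by
  have hm : S v + 1 ∈ Finset.Ico 1 n := by
    have := Finset.single_le_sum (f := S) (fun _ _ => Nat.zero_le _) (Finset.mem_univ v)
    rw [Finset.mem_Ico]; omega
  rw [potential_eq hg, ← Finset.add_sum_erase _ _ (Finset.mem_univ v),
    ← Finset.add_sum_erase _ _ hm, add_assoc, add_sub_right_comm]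
  refine Q.add_mem (edge_sub_edge_sub_rhombus_mem hne hQ hS hvb hvc hbc)
    (Q.add_mem (Q.sum_mem fun m hm => ?_) (Q.sum_mem fun w _ => Q.sum_mem fun m hm => ?_))
  · obtain ⟨h1, h2⟩ := Finset.mem_Ico.1 (Finset.mem_of_mem_erase hm)
    exact edge_sub_edge_mem hne hQ v h1 h2
  · obtain ⟨h1, h2⟩ := Finset.mem_Ico.1 hm
    exact edge_sub_edge_mem hne hQ w h1 h2

end Monotone

/-! ### Positive functions and their tropicalizations -/

section Positive

lemma NonnegCoeffs.add {ι : Type} {p q : LaurentRing ι} (hp : NonnegCoeffs p)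
    (hq : NonnegCoeffs q) : NonnegCoeffs (p + q) := by
  intro m
  have e : (p + q).coeff m = p.coeff m + q.coeff m := by simp
  rw [e, Complex.add_re, Complex.add_im, (hp m).2, (hq m).2]
  exact ⟨add_nonneg (hp m).1 (hq m).1, by simp⟩

lemma NonnegCoeffs.mul {ι : Type} {p q : LaurentRing ι} (hp : NonnegCoeffs p)
    (hq : NonnegCoeffs q) : NonnegCoeffs (p * q) := by
  classical
  intro m
  rw [AddMonoidAlgebra.coeff_mul]
  simp only [Finsupp.sum, Complex.re_sum, Complex.im_sum]
  constructor
  · refine Finset.sum_nonneg fun a _ => Finset.sum_nonneg fun b _ => ?_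
    split_ifs
    · simp only [Complex.mul_re, (hp a).2, (hq b).2, mul_zero, sub_zero]
      exact mul_nonneg (hp a).1 (hq b).1
    · simp
  · refine Finset.sum_eq_zero fun a _ => Finset.sum_eq_zero fun b _ => ?_
    split_ifs
    · simp [Complex.mul_im, (hp a).2, (hq b).2]
    · simp

lemma nonnegCoeffs_one {ι : Type} : NonnegCoeffs (1 : LaurentRing ι) := by
  classical
  intro m
  have : (1 : LaurentRing ι).coeff m = if m = 0 then 1 else 0 := by
    rw [AddMonoidAlgebra.one_def]
    simp [Finsupp.single_apply, eq_comm]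
  rw [this]; split_ifs <;> simp

lemma nonnegCoeffs_zero {ι : Type} : NonnegCoeffs (0 : LaurentRing ι) := by
  intro m
  simp

/-- Nonnegative coefficients cannot cancel, so the support of the sum is the union of the supports.
-/
lemma tropPoly_add {ι : Type} {p q : LaurentRing ι} (hp : NonnegCoeffs p) (hq : NonnegCoeffs q)
    (ξ : ι → ℝ) : tropPoly (p + q) ξ = max (tropPoly p ξ) (tropPoly q ξ) := by
  classical
  have e : ∀ m, (p + q).coeff m = p.coeff m + q.coeff m := by simp
  have : (p + q).coeff.support = p.coeff.support ∪ q.coeff.support := by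
    ext m
    simp only [Finsupp.mem_support_iff, Finset.mem_union, e]
    constructor
    · intro h
      by_contra! h'
      exact h (by rw [h'.1, h'.2, add_zero])
    · intro h h0
      have hre := congrArg Complex.re h0
      rw [Complex.add_re, Complex.zero_re] at hre
      have h1 : (p.coeff m).re = 0 := by linarith [(hp m).1, (hq m).1]
      have h2 : (q.coeff m).re = 0 := by linarith [(hp m).1, (hq m).1]
      rcases h with h | h
      · exact h (Complex.ext h1 (hp m).2)
      · exact h (Complex.ext h2 (hq m).2)
  rw [tropPoly, this, Finset.sup_union]
  rfl

variable {K : Type} [Field K] [Algebra ℂ K] {A : Subalgebra ℂ K} {ι : Type} (θ : ToricChart A ι)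
  {f f' : K} {p q p' q' : LaurentRing ι}

namespace ToricChart

variable {θ}

lemma pullback_ne_zero {a : A} (ha : a ≠ 0) : θ.pullback a ≠ 0 := fun h =>
  ha (θ.pullback_injective (h.trans (map_zero _).symm))

lemma Represents.add (h : θ.Represents f p q) (h' : θ.Represents f' p' q') :
    θ.Represents (f + f') (p * q' + p' * q) (q * q') := by
  obtain ⟨hq, a, b, hb, hf, hab⟩ := h
  obtain ⟨hq', a', b', hb', hf', hab'⟩ := h'
  refine ⟨mul_ne_zero hq hq', a * b' + a' * b, b * b', mul_ne_zero hb hb', ?_, ?_⟩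
  · push_cast
    rw [← hf, ← hf']
    ring
  · simp only [map_add, map_mul]
    linear_combination (θ.pullback b' * q') * hab + (θ.pullback b * q) * hab'

lemma Represents.mul (h : θ.Represents f p q) (h' : θ.Represents f' p' q') :
    θ.Represents (f * f') (p * p') (q * q') := by
  obtain ⟨hq, a, b, hb, hf, hab⟩ := h
  obtain ⟨hq', a', b', hb', hf', hab'⟩ := h'
  refine ⟨mul_ne_zero hq hq', a * a', b * b', mul_ne_zero hb hb', ?_, ?_⟩
  · push_cast
    rw [← hf, ← hf']
    ring
  · simp only [map_mul]
    linear_combination (θ.pullback a' * q') * hab + (θ.pullback b * p) * hab'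

lemma Represents.ne_zero (h : θ.Represents f p q) (hf0 : f ≠ 0) : p ≠ 0 := by
  obtain ⟨hq, a, b, hb, hf, hab⟩ := h
  rintro rfl
  have hbK : (b : K) ≠ 0 := fun h => hb (Subtype.ext h)
  have ha : a ≠ 0 := by
    rintro rfl
    exact mul_ne_zero hf0 hbK (by simpa using hf)
  rw [mul_zero] at hab
  exact mul_ne_zero (pullback_ne_zero ha) hq hab

lemma Represents.inv (h : θ.Represents f p q) (hf0 : f ≠ 0) : θ.Represents f⁻¹ q p := by
  have hp := h.ne_zero hf0
  obtain ⟨hq, a, b, hb, hf, hab⟩ := h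
  have hbK : (b : K) ≠ 0 := fun h => hb (Subtype.ext h)
  have ha : a ≠ 0 := by
    rintro rfl
    exact mul_ne_zero hf0 hbK (by simpa using hf)
  refine ⟨hp, b, a, ha, ?_, hab.symm⟩
  rw [← hf, inv_mul_cancel_left₀ hf0]

lemma represents_one : θ.Represents 1 1 1 :=
  ⟨one_ne_zero, 1, 1, one_ne_zero, by simp, by simp⟩

lemma represents_zero : θ.Represents 0 0 1 :=
  ⟨one_ne_zero, 0, 1, one_ne_zero, by simp, by simp⟩

lemma IsPositive.add (h : θ.IsPositive f) (h' : θ.IsPositive f') : θ.IsPositive (f + f') := by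
  obtain ⟨p, q, hp, hq, h⟩ := h
  obtain ⟨p', q', hp', hq', h'⟩ := h'
  exact ⟨_, _, (hp.mul hq').add (hp'.mul hq), hq.mul hq', h.add h'⟩

lemma IsPositive.mul (h : θ.IsPositive f) (h' : θ.IsPositive f') : θ.IsPositive (f * f') := by
  obtain ⟨p, q, hp, hq, h⟩ := h
  obtain ⟨p', q', hp', hq', h'⟩ := h'
  exact ⟨_, _, hp.mul hp', hq.mul hq', h.mul h'⟩

lemma isPositive_zero : θ.IsPositive 0 := ⟨_, _, nonnegCoeffs_zero, nonnegCoeffs_one, represents_zero⟩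

lemma isPositive_one : θ.IsPositive 1 := ⟨_, _, nonnegCoeffs_one, nonnegCoeffs_one, represents_one⟩

lemma IsPositive.inv (h : θ.IsPositive f) : θ.IsPositive f⁻¹ := by
  rcases eq_or_ne f 0 with rfl | hf
  · rw [inv_zero]; exact isPositive_zero
  obtain ⟨p, q, hp, hq, h⟩ := h
  exact ⟨_, _, hq, hp, h.inv hf⟩

lemma IsPositive.div (h : θ.IsPositive f) (h' : θ.IsPositive f') : θ.IsPositive (f / f') := by
  rw [div_eq_mul_inv]; exact h.mul h'.inv

/-- The tropicalization of the sum is a maximum in which one term is finite, whereas the zero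
function has tropicalization `⊥`. It suffices to look at the point 0. -/
lemma IsPositive.add_ne_zero (h : θ.IsPositive f) (h' : θ.IsPositive f') (hf : f ≠ 0) :
    f + f' ≠ 0 := by
  obtain ⟨p, q, hp, hq, h⟩ := h
  obtain ⟨p', q', hp', hq', h'⟩ := h'
  have hp0 := h.ne_zero hf
  intro h0
  have hs := h.add h'
  rw [h0] at hs
  have e1 := θ.trop_eq ((hp.mul hq').add (hp'.mul hq)) (hq.mul hq') hs 0
  have e2 := θ.trop_eq nonnegCoeffs_zero nonnegCoeffs_one represents_zero 0
  rw [e2, tropQuot, tropQuot, tropPoly_add (hp.mul hq') (hp'.mul hq), tropPoly_mul hp hq'] at e1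
  obtain ⟨x, hx⟩ := exists_tropPoly_eq_coe hp0 0
  obtain ⟨y, hy⟩ := exists_tropPoly_eq_coe h'.1 0
  rw [hx, hy] at e1
  have e3 : tropPoly (0 : LaurentRing ι) 0 = ⊥ := by simp [tropPoly]
  rw [e3, WithBot.map_bot] at e1
  have e4 := WithBot.map_eq_bot_iff.1 e1.symm
  rw [max_eq_bot] at e4
  exact absurd e4.1 (by rw [← WithBot.coe_add]; exact WithBot.coe_ne_bot)

lemma trop_zero (ξ : ι → ℝ) : θ.trop 0 ξ = ⊥ := by
  rw [θ.trop_eq nonnegCoeffs_zero nonnegCoeffs_one represents_zero]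
  simp [tropQuot, tropPoly]

lemma IsPositive.exists_trop_eq (h : θ.IsPositive f) (hf : f ≠ 0) (ξ : ι → ℝ) :
    ∃ t : ℝ, θ.trop f ξ = t := by
  obtain ⟨p, q, hp, hq, h⟩ := h
  obtain ⟨x, hx⟩ := exists_tropPoly_eq_coe (h.ne_zero hf) ξ
  rw [θ.trop_eq hp hq h, tropQuot, hx]
  exact ⟨_, rfl⟩

lemma trop_mul (h : θ.IsPositive f) (h' : θ.IsPositive f') (ξ : ι → ℝ) :
    θ.trop (f * f') ξ = θ.trop f ξ + θ.trop f' ξ := by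
  obtain ⟨p, q, hp, hq, h⟩ := h
  obtain ⟨p', q', hp', hq', h'⟩ := h'
  rw [θ.trop_eq hp hq h, θ.trop_eq hp' hq' h', θ.trop_eq (hp.mul hp') (hq.mul hq') (h.mul h'),
    tropQuot, tropQuot, tropQuot, tropPoly_mul hp hp', tropPoly_mul hq hq']
  obtain ⟨s, hs⟩ := exists_tropPoly_eq_coe h.1 ξ
  obtain ⟨s', hs'⟩ := exists_tropPoly_eq_coe h'.1 ξ
  rw [hs, hs', ← WithBot.coe_add]
  generalize tropPoly p ξ = x
  generalize tropPoly p' ξ = x'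
  induction x using WithBot.recBotCoe with
  | bot => simp
  | coe x => induction x' using WithBot.recBotCoe with
    | bot => simp
    | coe x' =>
      simp only [← WithBot.coe_add, WithBot.map_coe, WithBot.unbotD_coe, WithBot.coe_inj]
      ring

lemma trop_add (h : θ.IsPositive f) (h' : θ.IsPositive f') (ξ : ι → ℝ) :
    θ.trop (f + f') ξ = max (θ.trop f ξ) (θ.trop f' ξ) := by
  obtain ⟨p, q, hp, hq, h⟩ := h
  obtain ⟨p', q', hp', hq', h'⟩ := h'
  rw [θ.trop_eq hp hq h, θ.trop_eq hp' hq' h',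
    θ.trop_eq ((hp.mul hq').add (hp'.mul hq)) (hq.mul hq') (h.add h'),
    tropQuot, tropQuot, tropQuot, tropPoly_add (hp.mul hq') (hp'.mul hq), tropPoly_mul hp hq',
    tropPoly_mul hp' hq, tropPoly_mul hq hq']
  obtain ⟨s, hs⟩ := exists_tropPoly_eq_coe h.1 ξ
  obtain ⟨s', hs'⟩ := exists_tropPoly_eq_coe h'.1 ξ
  rw [hs, hs', ← WithBot.coe_add]
  generalize tropPoly p ξ = x
  generalize tropPoly p' ξ = x'
  induction x using WithBot.recBotCoe with
  | bot => induction x' using WithBot.recBotCoe with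
    | bot => simp
    | coe x' =>
      simp only [← WithBot.coe_add, WithBot.map_coe, WithBot.unbotD_coe, WithBot.bot_add,
        WithBot.map_bot, bot_le, max_eq_right, WithBot.coe_inj]
      ring
  | coe x => induction x' using WithBot.recBotCoe with
    | bot =>
      simp only [← WithBot.coe_add, WithBot.map_coe, WithBot.unbotD_coe, WithBot.bot_add,
        WithBot.map_bot, bot_le, max_eq_left, WithBot.coe_inj]
      ring
    | coe x' =>
      simp only [← WithBot.coe_add, WithBot.map_coe, WithBot.unbotD_coe, ← WithBot.coe_max,
        WithBot.coe_inj]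
      rcases le_total (x + s') (x' + s) with hle | hle
      · rw [max_eq_right hle, max_eq_right (by linarith)]; ring
      · rw [max_eq_left hle, max_eq_left (by linarith)]; ring

variable (θ) in
/-- The positive functions form an additive submonoid. -/
def positives : AddSubmonoid K where
  carrier := {f | θ.IsPositive f}
  zero_mem' := isPositive_zero
  add_mem' := IsPositive.add

variable (θ) in
/-- The positive functions with nonpositive tropicalization at a point. -/
def tropNonpos (ξ : ι → ℝ) : AddSubmonoid K where
  carrier := {f | θ.IsPositive f ∧ θ.trop f ξ ≤ 0}
  zero_mem' := ⟨isPositive_zero, by rw [trop_zero]; exact bot_le⟩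
  add_mem' h h' := ⟨h.1.add h'.1, by rw [trop_add h.1 h'.1]; exact max_le h.2 h'.2⟩

end ToricChart

end Positive


/-- A set of nonzero elements of a field closed under addition, multiplication and inverses. -/
structure IsPositiveSet {K : Type*} [Field K] (Q : Set K) : Prop where
  add : ∀ {x y}, x ∈ Q → y ∈ Q → x + y ∈ Q
  mul : ∀ {x y}, x ∈ Q → y ∈ Q → x * y ∈ Q
  inv : ∀ {x}, x ∈ Q → x⁻¹ ∈ Q
  zero_notMem : (0 : K) ∉ Q

namespace IsPositiveSet

variable {K : Type*} [Field K] {Q : Set K}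

lemma ne_zero (hQ : IsPositiveSet Q) {x : K} (hx : x ∈ Q) : x ≠ 0 := fun h =>
  hQ.zero_notMem (h ▸ hx)

lemma div (hQ : IsPositiveSet Q) {x y : K} (hx : x ∈ Q) (hy : y ∈ Q) : x / y ∈ Q := by
  rw [div_eq_mul_inv]; exact hQ.mul hx (hQ.inv hy)

lemma mem_of_mul_mem (hQ : IsPositiveSet Q) {x y : K} (hxy : x * y ∈ Q) (hy : y ∈ Q) : x ∈ Q := by
  have := hQ.div hxy hy
  rwa [mul_div_cancel_right₀ _ (hQ.ne_zero hy)] at this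

end IsPositiveSet

/-! ### Propagation of positivity by the octahedron relation -/

section Octahedron

variable {K : Type*} [Field K] {n : ℕ}

/-- The octahedron recurrence recovers all corner determinants from those on two faces. -/
lemma cornerDet_mem {Q : Set K} (hQ : IsPositiveSet Q) {H : Fin 4 → Matrix (Fin n) (Fin n) K}
    (hface : ∀ p, ∑ b, p b = n → p 1 = 0 ∨ p 3 = 0 → cornerDet H p ∈ Q) (p : Fin 4 → ℕ)
    (hp : ∑ b, p b = n) : cornerDet H p ∈ Q := by
  induction hk : p 1 + p 3 using Nat.strong_induction_on generalizing p with
  | _ k ih =>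
    by_cases h : p 1 = 0 ∨ p 3 = 0
    · exact hface p hp h
    push Not at h
    -- The octahedron relation is solved for the vertex S + 1 + 3. All its other vertices have fewer
    -- columns in the blocks 1 and 3 together, and the only division is by the one at S + 0 + 2.
    obtain ⟨S, rfl⟩ := exists_add_single (q := p) (v := 1) (b := 3) (by decide) (by omega)
      (by omega)
    have hS := hp
    rw [sum_add_single, sum_add_single] at hS
    have hs : ∀ a b, ∑ x, (S + Pi.single a 1 + Pi.single b 1 : Fin 4 → ℕ) x = n := fun a b => by
      rw [sum_add_single, sum_add_single]; exact hS
    have m : ∀ a b, (S + Pi.single a 1 + Pi.single b 1 : Fin 4 → ℕ) 1 +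
        (S + Pi.single a 1 + Pi.single b 1 : Fin 4 → ℕ) 3 < k →
        cornerDet H (S + Pi.single a 1 + Pi.single b 1) ∈ Q := fun a b h => ih _ h _ (hs a b) rfl
    simp at hk
    have hoct := octahedron H hS
    have h02 := m 0 2 (by simp; omega)
    refine hQ.mem_of_mul_mem ?_ h02
    rw [mul_comm, hoct]
    exact hQ.add (hQ.mul (m 0 1 (by simp; omega))
      (m 2 3 (by simp; omega)))
      (hQ.mul (m 0 3 (by simp; omega)) (m 1 2 (by simp; omega)))

end Octahedron

/-! ### Small rhombi in terms of column multiplicities -/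

lemma mem_simplex_iff {n : ℕ} {a b c : ℤ} :
    (![a, b, c] : Fin 3 → ℤ) ∈ simplex n ↔ 0 ≤ a ∧ 0 ≤ b ∧ 0 ≤ c ∧ a + b + c ≤ n := by
  simp [simplex, Fin.forall_fin_succ, and_assoc]

lemma vertex_apply (b : Fin 4) (l : Fin 3) : vertex b l = (Pi.single b 1 : Fin 4 → ℤ) l.succ := by
  fin_cases b <;> fin_cases l <;> rfl

lemma mult_succ {n : ℕ} {α : Fin 3 → ℤ} (hα : α ∈ simplex n) (l : Fin 3) :
    (mult n α l.succ : ℤ) = α l := by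
  have := hα.1 l
  fin_cases l <;> simp [mult] <;> exact this

lemma mult_zero {n : ℕ} {α : Fin 3 → ℤ} (hα : α ∈ simplex n) :
    (mult n α 0 : ℤ) = n - (α 0 + α 1 + α 2) := by
  have := hα.2
  simp [mult]; omega

/-- The multiplicities are the barycentric coordinates, so a step from vertex a to vertex b moves
one column. The additive form avoids truncated subtraction. -/
lemma mult_add_single {n : ℕ} {α α' : Fin 3 → ℤ} (hα : α ∈ simplex n) (hα' : α' ∈ simplex n)
    {a b : Fin 4} (h : α' = α + (vertex b - vertex a)) :
    mult n α' + Pi.single a 1 = mult n α + Pi.single b 1 := by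
  have hl : ∀ l : Fin 3, α' l + (Pi.single a 1 : Fin 4 → ℤ) l.succ =
      α l + (Pi.single b 1 : Fin 4 → ℤ) l.succ := by
    intro l
    rw [h]
    simp only [Pi.add_apply, Pi.sub_apply, vertex_apply]
    ring
  have hc : ∀ (a x : Fin 4), ((Pi.single a 1 : Fin 4 → ℕ) x : ℤ) = (Pi.single a 1 : Fin 4 → ℤ) x := by
    intro a x
    rcases eq_or_ne x a with rfl | h
    · simp
    · simp [h]
  have hsum : ∀ a : Fin 4, (Pi.single a 1 : Fin 4 → ℤ) 0 + (Pi.single a 1 : Fin 4 → ℤ) 1 +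
      (Pi.single a 1 : Fin 4 → ℤ) 2 + (Pi.single a 1 : Fin 4 → ℤ) 3 = 1 := by
    intro a
    fin_cases a <;> simp
  ext1 x
  zify
  simp only [Pi.add_apply, Nat.cast_add, hc]
  refine Fin.cases ?_ (fun l => ?_) x
  · rw [mult_zero hα, mult_zero hα']
    have h0 := hl 0
    have h1 := hl 1
    have h2 := hl 2
    change _ + (Pi.single a 1 : Fin 4 → ℤ) 1 = _ + (Pi.single b 1 : Fin 4 → ℤ) 1 at h0
    change _ + (Pi.single a 1 : Fin 4 → ℤ) 2 = _ + (Pi.single b 1 : Fin 4 → ℤ) 2 at h1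
    change _ + (Pi.single a 1 : Fin 4 → ℤ) 3 = _ + (Pi.single b 1 : Fin 4 → ℤ) 3 at h2
    have := hsum a
    have := hsum b
    omega
  · rw [mult_succ hα, mult_succ hα']
    exact hl l

/-- The multiplicities of the vertices of a small rhombus. -/
lemma IsSmallRhombus.exists_mult {n : ℕ} {α₁ α₂ α₃ α₄ : Fin 3 → ℤ}
    (h : IsSmallRhombus n α₁ α₂ α₃ α₄) :
    ∃ (S : Fin 4 → ℕ) (v b c : Fin 4), ∑ a, S a + 2 = n ∧ v ≠ b ∧ v ≠ c ∧ b ≠ c ∧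
      mult n α₁ = S + Pi.single v 1 + Pi.single v 1 ∧
      mult n α₂ = S + Pi.single v 1 + Pi.single b 1 ∧
      mult n α₃ = S + Pi.single b 1 + Pi.single c 1 ∧
      mult n α₄ = S + Pi.single v 1 + Pi.single c 1 := by
  obtain ⟨⟨a, b, c, hab, hac, hbc, e2, e4, e3⟩, h1, h2, h3, h4⟩ := h
  have m2 := mult_add_single h1 h2 e2
  have m4 := mult_add_single h1 h4 e4
  have m3 := mult_add_single h2 h3 (show α₃ = α₂ + (vertex c - vertex a) by rw [e3, e2])
  have hsum := sum_mult h1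
  -- The vertex α₃ arises from α₁ by removing two columns from block a, and it still lies in the
  -- simplex.
  have ha : 2 ≤ mult n α₁ a := by
    have f2 := congrFun m2 a
    have f3 := congrFun m3 a
    simp [hab, hac] at f2 f3
    omega
  have hS : mult n α₁ = mult n α₁ - Pi.single a 1 - Pi.single a 1 + Pi.single a 1 +
      Pi.single a 1 := by
    ext1 x
    rcases eq_or_ne x a with rfl | h
    · simp; omega
    · simp [h]
  generalize mult n α₁ - Pi.single a 1 - Pi.single a 1 = S at hS
  rw [hS] at m2 m4 hsum
  have k2 : mult n α₂ = S + Pi.single a 1 + Pi.single b 1 :=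
    add_right_cancel (b := Pi.single a 1) (m2.trans (by ring))
  have k4 : mult n α₄ = S + Pi.single a 1 + Pi.single c 1 :=
    add_right_cancel (b := Pi.single a 1) (m4.trans (by ring))
  rw [k2] at m3
  refine ⟨S, a, b, c, ?_, hab, hac, hbc, hS, k2, ?_, k4⟩
  · rw [sum_add_single, sum_add_single] at hsum; exact hsum
  · exact add_right_cancel (b := Pi.single a 1) (m3.trans (by ring))

lemma isSmallRhombus_of_mult {n : ℕ} {S : Fin 4 → ℕ} {v b c : Fin 4} (hS : ∑ a, S a + 2 = n)
    (hvb : v ≠ b) (hvc : v ≠ c) (hbc : b ≠ c) :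
    IsSmallRhombus n (fun l => ((S + Pi.single v 1 + Pi.single v 1 : Fin 4 → ℕ) l.succ : ℤ))
      (fun l => ((S + Pi.single v 1 + Pi.single b 1 : Fin 4 → ℕ) l.succ : ℤ))
      (fun l => ((S + Pi.single b 1 + Pi.single c 1 : Fin 4 → ℕ) l.succ : ℤ))
      (fun l => ((S + Pi.single v 1 + Pi.single c 1 : Fin 4 → ℕ) l.succ : ℤ)) := by
  have hmem : ∀ a d, (fun l : Fin 3 => ((S + Pi.single a 1 + Pi.single d 1 : Fin 4 → ℕ) l.succ : ℤ))
      ∈ simplex n := by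
    intro a d
    refine ⟨fun l => Int.natCast_nonneg _, ?_⟩
    have : ∑ x, (S + Pi.single a 1 + Pi.single d 1 : Fin 4 → ℕ) x = n := by
      rw [sum_add_single, sum_add_single]; exact hS
    rw [Fin.sum_univ_four] at this
    change ((S + Pi.single a 1 + Pi.single d 1 : Fin 4 → ℕ) 1 : ℤ) +
      ((S + Pi.single a 1 + Pi.single d 1 : Fin 4 → ℕ) 2 : ℤ) +
      ((S + Pi.single a 1 + Pi.single d 1 : Fin 4 → ℕ) 3 : ℤ) ≤ n
    omega
  have hc : ∀ (a x : Fin 4), ((Pi.single a 1 : Fin 4 → ℕ) x : ℤ) = (Pi.single a 1 : Fin 4 → ℤ) x := by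
    intro a x
    rcases eq_or_ne x a with rfl | h
    · simp
    · simp [h]
  refine ⟨⟨v, b, c, hvb, hvc, hbc, ?_, ?_, ?_⟩, hmem _ _, hmem _ _, hmem _ _, hmem _ _⟩ <;>
  · ext1 l
    simp only [Pi.add_apply, Pi.sub_apply, vertex_apply, Nat.cast_add, hc]
    ring

/-! ### Tropical octahedron recurrence and rhombus inequalities -/

section Tropical

variable {K : Type} [Field K] [Algebra ℂ K] {A : Subalgebra ℂ K} {ι : Type} (θ : ToricChart A ι)

/-- The nonzero positive functions. -/
def posSet : Set K := {f | f ≠ 0 ∧ θ.IsPositive f}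

lemma isPositiveSet_posSet : IsPositiveSet (posSet θ) where
  add h h' := ⟨h.2.add_ne_zero h'.2 h.1, h.2.add h'.2⟩
  mul h h' := ⟨mul_ne_zero h.1 h'.1, h.2.mul h'.2⟩
  inv h := ⟨inv_ne_zero h.1, h.2.inv⟩
  zero_notMem h := h.1 rfl

variable {θ} {n : ℕ}

/-- All four corner determinants are nonzero, so their tropicalizations are real numbers, and those
of numerator and denominator can be subtracted. -/
lemma trop_rhombusQuot_nonpos_iff {H : Fin 4 → Matrix (Fin n) (Fin n) K}
    (hM : ∀ p, ∑ b, p b = n → cornerDet H p ∈ posSet θ) {S : Fin 4 → ℕ} (hS : ∑ a, S a + 2 = n)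
    (v b c : Fin 4) (ξ : ι → ℝ) :
    θ.trop (rhombusQuot H S v b c) ξ ≤ 0 ↔
      θ.trop (cornerDet H (S + Pi.single v 1 + Pi.single v 1)) ξ +
        θ.trop (cornerDet H (S + Pi.single b 1 + Pi.single c 1)) ξ ≤
      θ.trop (cornerDet H (S + Pi.single v 1 + Pi.single b 1)) ξ +
        θ.trop (cornerDet H (S + Pi.single v 1 + Pi.single c 1)) ξ := by
  have hm : ∀ a b, cornerDet H (S + Pi.single a 1 + Pi.single b 1) ∈ posSet θ := fun a b =>
    hM _ (by rw [sum_add_single, sum_add_single]; exact hS)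
  have m1 := hm v v
  have m2 := hm v b
  have m3 := hm b c
  have m4 := hm v c
  have hρ : rhombusQuot H S v b c ∈ posSet θ :=
    (isPositiveSet_posSet θ).div ((isPositiveSet_posSet θ).mul m1 m3)
      ((isPositiveSet_posSet θ).mul m2 m4)
  have e : rhombusQuot H S v b c * (cornerDet H (S + Pi.single v 1 + Pi.single b 1) *
      cornerDet H (S + Pi.single v 1 + Pi.single c 1)) =
      cornerDet H (S + Pi.single v 1 + Pi.single v 1) *
        cornerDet H (S + Pi.single b 1 + Pi.single c 1) :=
    div_mul_cancel₀ _ (mul_ne_zero m2.1 m4.1)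
  have ht := congrArg (fun f => θ.trop f ξ) e
  simp only [ToricChart.trop_mul hρ.2 (m2.2.mul m4.2), ToricChart.trop_mul m2.2 m4.2,
    ToricChart.trop_mul m1.2 m3.2] at ht
  obtain ⟨r, hr⟩ := hρ.2.exists_trop_eq hρ.1 ξ
  obtain ⟨t1, h1⟩ := m1.2.exists_trop_eq m1.1 ξ
  obtain ⟨t2, h2⟩ := m2.2.exists_trop_eq m2.1 ξ
  obtain ⟨t3, h3⟩ := m3.2.exists_trop_eq m3.1 ξ
  obtain ⟨t4, h4⟩ := m4.2.exists_trop_eq m4.1 ξ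
  rw [h1, h2, h3, h4, hr] at ht
  rw [h1, h2, h3, h4, hr]
  norm_cast at ht ⊢
  constructor <;> intro <;> linarith

variable {g : Fin 3 → Matrix (Fin n) (Fin n) K}

lemma isPositive_multiCorner
    (hM : ∀ p, ∑ b, p b = n → cornerDet (prods g) p ∈ posSet θ) (α : Fin 3 → ℤ) :
    θ.IsPositive (multiCorner g α) := by
  by_cases hα : α ∈ simplex n
  · rw [multiCorner_eq _ hα]
    exact (hM _ (sum_mult hα)).2
  · rw [multiCorner_of_notMem _ hα]
    exact ToricChart.isPositive_zero

lemma isPositive_rhombusQuot {H : Fin 4 → Matrix (Fin n) (Fin n) K}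
    (hM : ∀ p, ∑ b, p b = n → cornerDet H p ∈ posSet θ) {S : Fin 4 → ℕ} (hS : ∑ a, S a + 2 = n)
    (v b c : Fin 4) : θ.IsPositive (rhombusQuot H S v b c) := by
  have hm : ∀ a b, θ.IsPositive (cornerDet H (S + Pi.single a 1 + Pi.single b 1)) := fun a b =>
    (hM _ (by rw [sum_add_single, sum_add_single]; exact hS)).2
  exact ((hm _ _).mul (hm _ _)).div ((hm _ _).mul (hm _ _))

lemma isPositive_potential (hg : ∀ l, (g l).det ≠ 0)
    (hM : ∀ p, ∑ b, p b = n → cornerDet (prods g) p ∈ posSet θ) :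
    θ.IsPositive (potential g) :=
  potential_mem (Q := θ.positives) hg (fun p hp => (hM p hp).1)
    fun _ v b c hS _ _ _ => isPositive_rhombusQuot hM hS v b c

/-- If i, j, k ≥ 0 and i + j + k + 2 ≤ n, this is the tropicalization of `octahedron`, whose two
sides are subtraction-free. The convention M_α = 0 outside the simplex takes care of all other i, j,
k. -/
lemma octahedronRecurrence_trop
    (hM : ∀ p, ∑ b, p b = n → cornerDet (prods g) p ∈ posSet θ) (ξ : ι → ℝ) :
    OctahedronRecurrence fun α => θ.trop (multiCorner g α) ξ := by
  intro i j k
  have hbot : ∀ a b c : ℤ, ¬(0 ≤ a ∧ 0 ≤ b ∧ 0 ≤ c ∧ a + b + c ≤ n) →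
      θ.trop (multiCorner g ![a, b, c]) ξ = ⊥ := by
    intro a b c h
    rw [multiCorner_of_notMem _ (fun h' => h (mem_simplex_iff.1 h')), ToricChart.trop_zero]
  by_cases h : 0 ≤ i ∧ 0 ≤ j ∧ 0 ≤ k ∧ i + j + k + 2 ≤ n
  · obtain ⟨hi, hj, hk, hs⟩ := h
    lift i to ℕ using hi
    lift j to ℕ using hj
    lift k to ℕ using hk
    have hS : ∑ a, (![n - 2 - i - j - k, i, j, k] : Fin 4 → ℕ) a + 2 = n := by
      rw [Fin.sum_univ_four]; simp; omega
    have hoct := octahedron (prods g) hS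
    set S : Fin 4 → ℕ := ![n - 2 - i - j - k, i, j, k]
    have s1 : S 1 = i := rfl
    have s2 : S 2 = j := rfl
    have s3 : S 3 = k := rfl
    clear_value S
    have hm : ∀ a b, cornerDet (prods g) (S + Pi.single a 1 + Pi.single b 1) ∈ posSet θ := fun a b =>
      hM _ (by rw [sum_add_single, sum_add_single]; exact hS)
    have e : ∀ (a b : Fin 4) (x y z : ℤ), x = (S + Pi.single a 1 + Pi.single b 1 : Fin 4 → ℕ) 1 →
        y = (S + Pi.single a 1 + Pi.single b 1 : Fin 4 → ℕ) 2 →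
        z = (S + Pi.single a 1 + Pi.single b 1 : Fin 4 → ℕ) 3 →
        multiCorner g ![x, y, z] = cornerDet (prods g) (S + Pi.single a 1 + Pi.single b 1) := by
      intro a b x y z hx hy hz
      exact multiCorner_of_mult g (by rw [sum_add_single, sum_add_single]; exact hS) hx hy hz
    have ht := congrArg (fun f => θ.trop f ξ) hoct
    simp only [ToricChart.trop_mul (hm 0 2).2 (hm 1 3).2,
      ToricChart.trop_add ((hm 0 1).2.mul (hm 2 3).2) ((hm 0 3).2.mul (hm 1 2).2),
      ToricChart.trop_mul (hm 0 1).2 (hm 2 3).2, ToricChart.trop_mul (hm 0 3).2 (hm 1 2).2] at ht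
    simp only
    rw [e 1 3 (i + 1) j (k + 1), e 0 2 i (j + 1) k, e 2 3 i (j + 1) (k + 1), e 0 1 (i + 1) j k,
      e 0 3 i j (k + 1), e 1 2 (i + 1) (j + 1) k, add_comm, ht,
      add_comm (θ.trop (cornerDet (prods g) (S + Pi.single 0 1 + Pi.single 1 1)) ξ)]
    all_goals
      rw [Pi.add_apply, Pi.add_apply]
      simp [s1, s2, s3]
  -- Each of the three pairs is a diagonal of the octahedron, and both its ends lie in the simplex
  -- only if the whole octahedron does. So otherwise all three sums are `⊥`.
  · have l : θ.trop (multiCorner g ![i + 1, j, k + 1]) ξ + θ.trop (multiCorner g ![i, j + 1, k]) ξ =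
        ⊥ := by
      by_cases h' : 0 ≤ i + 1 ∧ 0 ≤ j ∧ 0 ≤ k + 1 ∧ i + 1 + j + (k + 1) ≤ n
      · rw [hbot i (j + 1) k (by omega), WithBot.add_bot]
      · rw [hbot _ _ _ h', WithBot.bot_add]
    have r1 : θ.trop (multiCorner g ![i, j + 1, k + 1]) ξ +
        θ.trop (multiCorner g ![i + 1, j, k]) ξ = ⊥ := by
      by_cases h' : 0 ≤ i ∧ 0 ≤ j + 1 ∧ 0 ≤ k + 1 ∧ i + (j + 1) + (k + 1) ≤ n
      · rw [hbot (i + 1) j k (by omega), WithBot.add_bot]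
      · rw [hbot _ _ _ h', WithBot.bot_add]
    have r2 : θ.trop (multiCorner g ![i, j, k + 1]) ξ +
        θ.trop (multiCorner g ![i + 1, j + 1, k]) ξ = ⊥ := by
      by_cases h' : 0 ≤ i ∧ 0 ≤ j ∧ 0 ≤ k + 1 ∧ i + j + (k + 1) ≤ n
      · rw [hbot (i + 1) (j + 1) k (by omega), WithBot.add_bot]
      · rw [hbot _ _ _ h', WithBot.bot_add]
    simp only [l, r1, r2, max_self]

/-- The difference of the potential and any rhombus quotient is positive, hence the tropical
potential bounds every tropical rhombus quotient. Conversely, the potential lies in every submonoid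
containing all rhombus quotients, in particular in `tropNonpos`. -/
lemma trop_potential_nonpos_iff (hg : ∀ l, (g l).det ≠ 0)
    (hM : ∀ p, ∑ b, p b = n → cornerDet (prods g) p ∈ posSet θ) (ξ : ι → ℝ) :
    θ.trop (potential g) ξ ≤ 0 ↔
      RhombusInequalities n fun α => θ.trop (multiCorner g α) ξ := by
  constructor
  · intro h α₁ α₂ α₃ α₄ hα
    obtain ⟨S, v, b, c, hS, hvb, hvc, hbc, e1, e2, e3, e4⟩ := hα.exists_mult
    obtain ⟨-, h1, h2, h3, h4⟩ := hα
    simp only [multiCorner_eq _ h1, multiCorner_eq _ h2, multiCorner_eq _ h3, multiCorner_eq _ h4,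
      e1, e2, e3, e4]
    rw [← trop_rhombusQuot_nonpos_iff hM hS]
    have hd := potential_sub_rhombus_mem (Q := θ.positives) hg (fun p hp => (hM p hp).1)
      (fun _ v b c hS _ _ _ => isPositive_rhombusQuot hM hS v b c) hS hvb hvc hbc
    have hd' : θ.IsPositive (potential g - rhombusQuot (prods g) S v b c) := hd
    have e : potential g = potential g - rhombusQuot (prods g) S v b c +
      rhombusQuot (prods g) S v b c := by ring
    rw [e, ToricChart.trop_add hd' (isPositive_rhombusQuot hM hS v b c)] at h
    exact (le_max_right _ _).trans h
  · intro h
    refine (potential_mem (Q := θ.tropNonpos ξ) hg (fun p hp => (hM p hp).1) ?_).2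
    intro S v b c hS hvb hvc hbc
    refine ⟨isPositive_rhombusQuot hM hS v b c, ?_⟩
    rw [trop_rhombusQuot_nonpos_iff hM hS]
    have := h _ _ _ _ (isSmallRhombus_of_mult hS hvb hvc hbc)
    have hs : ∀ a b, ∑ x, (S + Pi.single a 1 + Pi.single b 1 : Fin 4 → ℕ) x = n := fun a b => by
      rw [sum_add_single, sum_add_single]; exact hS
    simp only at this
    rw [multiCorner_of_mult g (hs v v) rfl rfl rfl, multiCorner_of_mult g (hs b c) rfl rfl rfl,
      multiCorner_of_mult g (hs v b) rfl rfl rfl, multiCorner_of_mult g (hs v c) rfl rfl rfl] at this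
    exact this

end Tropical


/-! ### Construction of toric charts -/

section ChartConstruction

variable {K : Type} [Field K] [Algebra ℂ K] {ι : Type}

/-- The evaluation of Laurent polynomials at a family of nonzero elements of a field. -/
def laurentEval (f : ι → K) (hf : ∀ i, f i ≠ 0) : LaurentRing ι →ₐ[ℂ] K :=
  AddMonoidAlgebra.lift ℂ K (ι →₀ ℤ)
    { toFun := fun m => (Multiplicative.toAdd m).prod fun i e => f i ^ e
      map_one' := by simp
      map_mul' := fun m m' => by
        classical
        rw [toAdd_mul, Finsupp.prod_add_index']
        · simp
        · intro i a b; exact zpow_add₀ (hf i) a b }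

variable {f : ι → K} (hf : ∀ i, f i ≠ 0)

lemma laurentEval_single (m : ι →₀ ℤ) (c : ℂ) :
    laurentEval f hf (AddMonoidAlgebra.single m c) = c • m.prod fun i e => f i ^ e :=
  AddMonoidAlgebra.lift_single _ _ _

lemma laurentEval_coordX (i : ι) : laurentEval f hf (coordX i) = f i := by
  rw [coordX, laurentEval_single, one_smul, Finsupp.prod_single_index] <;> simp

lemma mem_range_laurentEval (i : ι) : f i ∈ (laurentEval f hf).range :=
  ⟨coordX i, laurentEval_coordX hf i⟩

lemma inv_mem_range_laurentEval (i : ι) : (f i)⁻¹ ∈ (laurentEval f hf).range := by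
  refine ⟨AddMonoidAlgebra.single (Finsupp.single i (-1)) 1, ?_⟩
  change laurentEval f hf _ = _
  rw [laurentEval_single, one_smul, Finsupp.prod_single_index] <;> simp

lemma range_laurentEval_le {S : Subalgebra ℂ K} (hS : ∀ i, f i ∈ S ∧ (f i)⁻¹ ∈ S) :
    (laurentEval f hf).range ≤ S := by
  rintro _ ⟨z, rfl⟩
  change laurentEval f hf z ∈ S
  induction z using AddMonoidAlgebra.induction_on with
  | of m =>
    have : (AddMonoidAlgebra.of ℂ (ι →₀ ℤ)) (Multiplicative.ofAdd m) =
      AddMonoidAlgebra.single m 1 := rfl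
    rw [this, laurentEval_single, one_smul]
    refine S.prod_mem fun i _ => ?_
    change f i ^ m i ∈ S
    cases m i with
    | ofNat k => rw [Int.ofNat_eq_natCast, zpow_natCast]; exact S.pow_mem (hS i).1 k
    | negSucc k => rw [zpow_negSucc, ← inv_pow]; exact S.pow_mem (hS i).2 _
  | add x y hx hy => rw [map_add]; exact S.add_mem hx hy
  | smul r x hx => rw [map_smul]; exact S.smul_mem hx r

/-- Clearing denominators in a Laurent polynomial. -/
lemma exists_mul_monomial [Finite ι] (z : LaurentRing ι) :
    ∃ (m : ι →₀ ℤ) (q : MvPolynomial ι ℂ), z * AddMonoidAlgebra.single m 1 =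
      MvPolynomial.aeval (fun i => (coordX i : LaurentRing ι)) q := by
  have hmon : ∀ m : ι →₀ ℕ, MvPolynomial.aeval (fun i => (coordX i : LaurentRing ι))
      (MvPolynomial.monomial m (1 : ℂ)) =
      AddMonoidAlgebra.single (m.mapRange (fun k : ℕ => (k : ℤ)) (by simp)) 1 := by
    classical
    intro m
    rw [MvPolynomial.aeval_monomial, map_one, one_mul]
    induction m using Finsupp.induction with
    | zero => simp [AddMonoidAlgebra.one_def]
    | single_add i k m hi hk ih =>
      rw [Finsupp.prod_add_index', ih, Finsupp.prod_single_index, Finsupp.mapRange_add]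
      · rw [coordX, AddMonoidAlgebra.single_pow, AddMonoidAlgebra.single_mul_single]
        congr 1
        · rw [Finsupp.mapRange_single]
          simp
        · simp
      · intros; push_cast; rfl
      · simp
      · simp
      · intros; rw [pow_add]
  have hpos : ∀ m : ι →₀ ℤ, (∀ i, 0 ≤ m i) → ∃ q : MvPolynomial ι ℂ,
      (AddMonoidAlgebra.single m 1 : LaurentRing ι) =
        MvPolynomial.aeval (fun i => (coordX i : LaurentRing ι)) q := by
    intro m hm
    refine ⟨MvPolynomial.monomial (m.mapRange Int.toNat (by simp)) 1, ?_⟩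
    rw [hmon]
    congr 1
    ext i
    simp [hm i]
  induction z using AddMonoidAlgebra.induction_on with
  | of m =>
    refine ⟨-m, 1, ?_⟩
    have : (AddMonoidAlgebra.of ℂ (ι →₀ ℤ)) (Multiplicative.ofAdd m) =
      AddMonoidAlgebra.single m 1 := rfl
    rw [this, AddMonoidAlgebra.single_mul_single, add_neg_cancel, one_mul, map_one,
      AddMonoidAlgebra.one_def]
  | add x y hx hy =>
    obtain ⟨m, q, hq⟩ := hx
    obtain ⟨m', q', hq'⟩ := hy
    -- The supremum of the two exponents clears the denominators of both summands, since it exceeds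
    -- each by a nonnegative exponent.
    let a : ι →₀ ℤ := m ⊔ m'
    obtain ⟨r, hr⟩ := hpos (a - m) (fun i => by simp [a])
    obtain ⟨r', hr'⟩ := hpos (a - m') (fun i => by simp [a])
    refine ⟨a, q * r + q' * r', ?_⟩
    rw [map_add, map_mul, map_mul, ← hq, ← hq', ← hr, ← hr', mul_assoc, mul_assoc,
      AddMonoidAlgebra.single_mul_single, AddMonoidAlgebra.single_mul_single, add_sub_cancel,
      add_sub_cancel, one_mul, add_mul]
  | smul r x hx =>
    obtain ⟨m, q, hq⟩ := hx
    exact ⟨m, r • q, by rw [map_smul, ← hq, smul_mul_assoc]⟩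

/-- A monomial factor turns a Laurent polynomial in the kernel into a polynomial relation between
the f i, which is trivial by independence. Monomials are units, so the Laurent polynomial vanishes,
too. -/
lemma laurentEval_injective [Finite ι] (h : AlgebraicIndependent ℂ f) :
    Function.Injective (laurentEval f hf) := by
  rw [injective_iff_map_eq_zero]
  intro z hz
  obtain ⟨m, q, hq⟩ := exists_mul_monomial z
  have h1 := congrArg (laurentEval f hf) hq
  rw [map_mul, hz, zero_mul, ← AlgHom.comp_apply, MvPolynomial.comp_aeval] at h1
  simp only [laurentEval_coordX] at h1
  have h2 : q = 0 := (injective_iff_map_eq_zero _).1 h q h1.symm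
  rw [h2, map_zero] at hq
  have h3 : (AddMonoidAlgebra.single m 1 : LaurentRing ι) * AddMonoidAlgebra.single (-m) 1 = 1 := by
    rw [AddMonoidAlgebra.single_mul_single]
    simp [AddMonoidAlgebra.one_def]
  calc z = z * (AddMonoidAlgebra.single m 1 * AddMonoidAlgebra.single (-m) 1) := by
        rw [h3, mul_one]
    _ = 0 := by rw [← mul_assoc, hq, zero_mul]

/-- A toric chart whose coordinates are a given family of algebraically independent rational
functions. -/
lemma exists_toricChart [Finite ι] {A : Subalgebra ℂ K} (h : AlgebraicIndependent ℂ f)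
    (hA : A ≤ (laurentEval f hf).range) {F : K} (hF : F ∈ A) (hF0 : F ≠ 0)
    (hFinv : F⁻¹ ∈ (laurentEval f hf).range)
    (hmul : ∀ i, f i * F ∈ A ∧ (f i)⁻¹ * F ∈ A) :
    ∃ θ : ToricChart A ι, ∀ a, laurentEval f hf (θ.pullback a) = a := by
  have hinj := laurentEval_injective hf h
  let e : LaurentRing ι ≃ₐ[ℂ] (laurentEval f hf).range := AlgEquiv.ofInjective _ hinj
  let pb : A →ₐ[ℂ] LaurentRing ι := e.symm.toAlgHom.comp (Subalgebra.inclusion hA)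
  have hpb : ∀ a : A, laurentEval f hf (pb a) = a := by
    intro a
    have : e (pb a) = Subalgebra.inclusion hA a := e.apply_symm_apply _
    exact congrArg Subtype.val this
  let _ : Algebra A (LaurentRing ι) := pb.toRingHom.toAlgebra
  -- These are the elements of K that lie in A after multiplication by a power of F. They include
  -- all f i and their inverses, hence all Laurent polynomials in the f i.
  let S : Subalgebra ℂ K :=
    { carrier := {z | ∃ N : ℕ, z * F ^ N ∈ A}
      mul_mem' := by
        rintro x y ⟨N, hN⟩ ⟨N', hN'⟩
        refine ⟨N + N', ?_⟩
        have := A.mul_mem hN hN'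
        rwa [show x * F ^ N * (y * F ^ N') = x * y * F ^ (N + N') by ring] at this
      add_mem' := by
        rintro x y ⟨N, hN⟩ ⟨N', hN'⟩
        refine ⟨N + N', ?_⟩
        have := A.add_mem (A.mul_mem hN (A.pow_mem hF N')) (A.mul_mem hN' (A.pow_mem hF N))
        rwa [show x * F ^ N * F ^ N' + y * F ^ N' * F ^ N = (x + y) * F ^ (N + N') by ring] at this
      algebraMap_mem' := fun r => ⟨0, by simp⟩ }
  have hS : (laurentEval f hf).range ≤ S := range_laurentEval_le hf fun i =>
    ⟨⟨1, by simpa using (hmul i).1⟩, ⟨1, by simpa using (hmul i).2⟩⟩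
  -- The Laurent ring is the localization of A at F, so the torus is the basic open subset of Spec A
  -- where F does not vanish.
  have hloc : IsLocalization.Away (⟨F, hF⟩ : A) (LaurentRing ι) := by
    refine IsLocalization.Away.mk _ ?_ ?_ ?_
    · obtain ⟨y, hy⟩ := hFinv
      refine IsUnit.of_mul_eq_one y ?_
      apply hinj
      change laurentEval f hf (pb ⟨F, hF⟩ * y) = _
      rw [map_mul, hpb, map_one]
      change F * laurentEval f hf y = 1
      have hy' : laurentEval f hf y = F⁻¹ := hy
      rw [hy', mul_inv_cancel₀ hF0]
    · intro z
      obtain ⟨N, hN⟩ := hS ⟨z, rfl⟩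
      refine ⟨N, ⟨_, hN⟩, ?_⟩
      apply hinj
      change laurentEval f hf (z * (pb ⟨F, hF⟩) ^ N) = laurentEval f hf (pb _)
      rw [map_mul, map_pow, hpb, hpb]
      rfl
    · intro a b hab
      refine ⟨0, ?_⟩
      have := congrArg (laurentEval f hf) hab
      change laurentEval f hf (pb a) = laurentEval f hf (pb b) at this
      rw [hpb, hpb] at this
      rw [Subtype.ext this]
  exact ⟨⟨pb, IsOpenImmersion.of_isLocalization (S := LaurentRing ι) (⟨F, hF⟩ : A)⟩, hpb⟩

lemma isCoordinate_of_eval [Finite ι] {A : Subalgebra ℂ K} (h : AlgebraicIndependent ℂ f)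
    {θ : ToricChart A ι} (hθ : ∀ a, laurentEval f hf (θ.pullback a) = a) (i : ι) {a b : K}
    (ha : a ∈ A) (hb : b ∈ A) (hb0 : b ≠ 0) (hab : f i = a / b) : θ.IsCoordinate i (f i) := by
  refine ⟨one_ne_zero, ⟨a, ha⟩, ⟨b, hb⟩, fun h0 => hb0 (congrArg Subtype.val h0), ?_, ?_⟩
  · rw [hab, div_mul_cancel₀ _ hb0]
  · apply laurentEval_injective hf h
    rw [map_mul, map_mul, hθ, hθ, map_one, laurentEval_coordX, hab]
    field_simp

end ChartConstruction

/-! ### Algebraic independence by counting generators -/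

section Independence

variable {σ ι : Type} [Fintype σ] [Fintype ι]

/-- A family over which the field is algebraic, and which has no more members than the transcendence
degree, is a transcendence basis. The variables bound this degree below by the cardinality of σ. -/
lemma algebraicIndependent_of_generate {f : ι → FractionRing (MvPolynomial σ ℂ)}
    (hcard : Fintype.card ι ≤ Fintype.card σ)
    (h : ∀ s, algebraMap (MvPolynomial σ ℂ) (FractionRing (MvPolynomial σ ℂ)) (MvPolynomial.X s) ∈
      IntermediateField.adjoin ℂ (Set.range f)) : AlgebraicIndependent ℂ f := by
  have htop : ∀ x, x ∈ IntermediateField.adjoin ℂ (Set.range f) := by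
    have hp : ∀ p : MvPolynomial σ ℂ, algebraMap _ (FractionRing (MvPolynomial σ ℂ)) p ∈
        IntermediateField.adjoin ℂ (Set.range f) := by
      intro p
      induction p using MvPolynomial.induction_on with
      | C a =>
        have : algebraMap _ (FractionRing (MvPolynomial σ ℂ)) (MvPolynomial.C a : MvPolynomial σ ℂ) =
          algebraMap ℂ _ a := by
          rw [IsScalarTower.algebraMap_apply ℂ (MvPolynomial σ ℂ)]; rfl
        rw [this]
        exact (IntermediateField.adjoin ℂ (Set.range f)).algebraMap_mem a
      | add p q hp hq => rw [map_add]; exact add_mem hp hq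
      | mul_X p s hp => rw [map_mul]; exact mul_mem hp (h s)
    intro x
    obtain ⟨a, b, -, rfl⟩ := IsFractionRing.div_surjective (A := MvPolynomial σ ℂ) x
    exact div_mem (hp a) (hp b)
  have halg : Algebra.IsAlgebraic (Algebra.adjoin ℂ (Set.range f))
      (FractionRing (MvPolynomial σ ℂ)) := by
    constructor
    intro x
    obtain ⟨a, ha, b, hb, rfl⟩ := IntermediateField.mem_adjoin_iff_div.1 (htop x)
    have h1 : IsAlgebraic (Algebra.adjoin ℂ (Set.range f)) a :=
      isAlgebraic_algebraMap (⟨a, ha⟩ : Algebra.adjoin ℂ (Set.range f))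
    have h2 : IsAlgebraic (Algebra.adjoin ℂ (Set.range f)) b :=
      isAlgebraic_algebraMap (⟨b, hb⟩ : Algebra.adjoin ℂ (Set.range f))
    rw [div_eq_mul_inv]
    exact h1.mul h2.inv
  have hX : AlgebraicIndependent ℂ fun s : σ =>
      algebraMap (MvPolynomial σ ℂ) (FractionRing (MvPolynomial σ ℂ)) (MvPolynomial.X s) :=
    (MvPolynomial.algebraicIndependent_X σ ℂ).map'
      (f := IsScalarTower.toAlgHom ℂ (MvPolynomial σ ℂ) (FractionRing (MvPolynomial σ ℂ)))
      (IsFractionRing.injective _ _)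
  have htr := hX.cardinalMk_le_trdeg
  refine (Algebra.IsAlgebraic.isTranscendenceBasis_of_le_trdeg_of_finite ℂ f (le_trans ?_ htr)).1
  rw [Cardinal.mk_fintype, Cardinal.mk_fintype]
  exact_mod_cast hcard

end Independence


/-! ### Determinants with triangular blocks -/

section Triangular

variable {R : Type*} [CommRing R] {n : ℕ}

/-- Lower triangular matrices. -/
def IsLower (b : Matrix (Fin n) (Fin n) R) : Prop := ∀ r c, r < c → b r c = 0

/-- Unipotent upper triangular matrices. -/
def IsUnipUpper (u : Matrix (Fin n) (Fin n) R) : Prop :=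
  (∀ i, u i i = 1) ∧ ∀ i j, j < i → u i j = 0

/-- Antidiagonal matrices. -/
def IsAnti (m : Matrix (Fin n) (Fin n) R) : Prop := ∀ r c : Fin n, (r : ℕ) + c + 1 ≠ n → m r c = 0

lemma vec_eq_sum (x : Fin n → R) : x = ∑ r, x r • mcol 1 (r : ℕ) := by
  ext j
  simp [mcol, Matrix.one_apply]

lemma mcol_eq_sum (M u : Matrix (Fin n) (Fin n) R) {k : ℕ} (hk : k < n) :
    mcol (M * u) k = ∑ r, u r ⟨k, hk⟩ • mcol M (r : ℕ) := by
  ext j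
  simp [mcol, hk, Matrix.mul_apply, mul_comm]

lemma listDet_eq_zero_of_mem_append {l₁ l₂ : List (Fin n → R)} {x : Fin n → R}
    (hx : x ∈ l₁ ++ l₂) (h : l₁.length + l₂.length < n) : listDet (l₁ ++ x :: l₂) = 0 := by
  rcases List.mem_append.1 hx with hx | hx
  · exact listDet_eq_zero_of_mem _ hx (by omega)
  · obtain ⟨s, t, rfl⟩ := List.append_of_mem hx
    have := listDet_eq_zero_of_mem (l₁ := l₁ ++ x :: s) t (x := x) (by simp)
      (by simp at h ⊢; omega)
    simpa using this

lemma listDet_blk_one (a k : ℕ) (h : a + k = n) :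
    listDet (blk (1 : Matrix (Fin n) (Fin n) R) 0 a ++ blk 1 a k) = 1 := by
  have := blk_append (1 : Matrix (Fin n) (Fin n) R) 0 a k
  rw [zero_add, h] at this
  rw [this, listDet_blk_full, Matrix.det_one]

/-- Expanding a vector along the standard basis, when all but one basis vectors are present. -/
lemma listDet_expand {l₁ l₂ : List (Fin n → R)} (x : Fin n → R) (j : Fin n)
    (h : l₁.length + l₂.length + 1 = n)
    (hmem : ∀ r : Fin n, r ≠ j → x r = 0 ∨ mcol 1 (r : ℕ) ∈ l₁ ++ l₂) :
    listDet (l₁ ++ x :: l₂) = x j * listDet (l₁ ++ mcol 1 (j : ℕ) :: l₂) := by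
  conv_lhs => rw [vec_eq_sum x]
  rw [listDet_sum _ _ _ _ _ (by omega)]
  refine Finset.sum_eq_single j (fun r _ hr => ?_) (by simp)
  rcases hmem r hr with h0 | h0
  · rw [h0, zero_mul]
  · rw [listDet_eq_zero_of_mem_append h0 (by omega), mul_zero]

/-- The columns from a on are combinations of the standard basis vectors from a on, so replacing
them costs a factor that does not depend on l. -/
lemma exists_listDet_lower {b : Matrix (Fin n) (Fin n) R} (hb : IsLower b) (a k : ℕ)
    (h : a + k = n) : ∃ c : R, ∀ l : List (Fin n → R), l.length = a →
      listDet (l ++ blk b a k) = c * listDet (l ++ blk 1 a k) := by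
  induction k generalizing a with
  | zero => exact ⟨1, fun l _ => by simp⟩
  | succ k ih =>
    obtain ⟨c, hc⟩ := ih (a + 1) (by omega)
    have ha : a < n := by omega
    refine ⟨c * b ⟨a, ha⟩ ⟨a, ha⟩, fun l hl => ?_⟩
    have h1 := hc (l ++ [mcol b a]) (by simp [hl])
    rw [List.append_assoc, List.append_assoc, List.singleton_append, List.singleton_append] at h1
    rw [blk_succ', blk_succ', h1, listDet_expand (mcol b a) ⟨a, ha⟩ (by simp [hl]; omega)]
    · simp only [mcol, ha, dite_true]
      ring
    · intro r hr
      rcases lt_or_ge (r : ℕ) a with hlt | hge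
      · left
        simp only [mcol, ha, dite_true]
        exact hb _ _ hlt
      · right
        have : (r : ℕ) ≠ a := fun h => hr (Fin.ext h)
        exact List.mem_append_right _ (mem_blk (by omega) (by omega))

/-- The minor of the last `k` rows and the columns `x, …, x + k - 1`. -/
def intervalMinor (b : Matrix (Fin n) (Fin n) R) (x k : ℕ) : R :=
  listDet (blk 1 0 (n - k) ++ blk b x k)

/-- The factor is found by taking the first a standard basis vectors for l. -/
lemma listDet_lower {b : Matrix (Fin n) (Fin n) R} (hb : IsLower b) {a k : ℕ}
    (h : a + k = n) {l : List (Fin n → R)} (hl : l.length = a) :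
    listDet (l ++ blk b a k) = intervalMinor b a k * listDet (l ++ blk 1 a k) := by
  obtain ⟨c, hc⟩ := exists_listDet_lower hb a k h
  have h1 := hc (blk 1 0 a) (by simp)
  rw [listDet_blk_one a k h, mul_one] at h1
  rw [hc l hl, intervalMinor, show n - k = a by omega, h1]

/-- Column k of M * u is column k of M plus multiples of earlier columns of M, which are already in
the list. -/
lemma listDet_unip {u : Matrix (Fin n) (Fin n) R} (hu : IsUnipUpper u)
    (M : Matrix (Fin n) (Fin n) R) (k : ℕ) (l l' : List (Fin n → R))
    (h : l.length + k + l'.length = n) :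
    listDet (l ++ blk (M * u) 0 k ++ l') = listDet (l ++ blk M 0 k ++ l') := by
  induction k generalizing l' with
  | zero => rfl
  | succ k ih =>
    have hk : k < n := by omega
    have h1 := ih (mcol (M * u) k :: l') (by simp; omega)
    simp only [blk_succ, zero_add, List.append_assoc, List.singleton_append] at h1 ⊢
    rw [h1, mcol_eq_sum M u hk]
    have h2 := listDet_sum Finset.univ (l ++ blk M 0 k) l' (fun r : Fin n => u r ⟨k, hk⟩)
      (fun r => mcol M (r : ℕ)) (by simp; omega)
    simp only [List.append_assoc] at h2
    rw [h2, Finset.sum_eq_single ⟨k, hk⟩]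
    · rw [hu.1, one_mul]
    · intro r _ hr
      rcases lt_or_ge (r : ℕ) k with hlt | hge
      · have h3 := listDet_eq_zero_of_mem (l₁ := l ++ blk M 0 k) l' (x := mcol M (r : ℕ))
          (List.mem_append_right _ (mem_blk (by omega) (by omega))) (by simp; omega)
        simp only [List.append_assoc] at h3
        rw [h3, mul_zero]
      · have : k ≠ (r : ℕ) := fun h => hr (Fin.ext h.symm)
        rw [hu.2 _ _ (Fin.mk_lt_of_lt_val (by omega)), zero_mul]
    · simp

/-- Corner determinants are invariant under unipotent upper triangular column operations. -/
lemma cornerDet_unip {H u : Fin 4 → Matrix (Fin n) (Fin n) R} (hu : ∀ b, IsUnipUpper (u b))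
    {p : Fin 4 → ℕ} (hp : ∑ b, p b = n) : cornerDet (fun b => H b * u b) p = cornerDet H p := by
  rw [Fin.sum_univ_four] at hp
  simp only [cornerDet, flat, blocks]
  have h0 := listDet_unip (hu 0) (H 0) (p 0) [] (blk (H 1 * u 1) 0 (p 1) ++
    (blk (H 2 * u 2) 0 (p 2) ++ blk (H 3 * u 3) 0 (p 3))) (by simp; omega)
  have h1 := listDet_unip (hu 1) (H 1) (p 1) (blk (H 0) 0 (p 0))
    (blk (H 2 * u 2) 0 (p 2) ++ blk (H 3 * u 3) 0 (p 3)) (by simp; omega)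
  have h2 := listDet_unip (hu 2) (H 2) (p 2) (blk (H 0) 0 (p 0) ++ blk (H 1) 0 (p 1))
    (blk (H 3 * u 3) 0 (p 3)) (by simp; omega)
  have h3 := listDet_unip (hu 3) (H 3) (p 3) (blk (H 0) 0 (p 0) ++ blk (H 1) 0 (p 1) ++
    blk (H 2) 0 (p 2)) [] (by simp; omega)
  simp only [List.append_assoc, List.nil_append, List.append_nil] at h0 h1 h2 h3 ⊢
  rw [h0, h1, h2, h3]

/-- Corner determinants and multiplication from the left. -/
lemma cornerDet_mul_left (M : Matrix (Fin n) (Fin n) R) (H : Fin 4 → Matrix (Fin n) (Fin n) R)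
    {p : Fin 4 → ℕ} (hp : ∑ b, p b = n) :
    cornerDet (fun b => M * H b) p = M.det * cornerDet H p := by
  rw [cornerDet, cornerDet, ← listDet_map_mulVec _ _ (by rw [length_flat_blocks, hp])]
  simp [flat, blocks, blk_mul]

/-- The sign and scalar with which the first `s` columns of an antidiagonal matrix contribute. -/
def antiMinor (m : Matrix (Fin n) (Fin n) R) (s : ℕ) : R :=
  listDet (blk m 0 s ++ blk 1 0 (n - s))

lemma listDet_anti {m : Matrix (Fin n) (Fin n) R} (hm : IsAnti m) (s : ℕ) (hs : s ≤ n) :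
    ∃ c : R, ∀ l : List (Fin n → R), l.length + s = n →
      listDet (blk m 0 s ++ l) = c * listDet (l ++ blk 1 (n - s) s) := by
  induction s with
  | zero => exact ⟨1, fun l _ => by simp⟩
  | succ s ih =>
    obtain ⟨c, hc⟩ := ih (by omega)
    have h1 : s < n := hs
    have h2 : n - 1 - s < n := by omega
    -- Column s is a multiple of the standard basis vector n - 1 - s. It has to pass the n - 1 - s
    -- vectors of l to join the later basis vectors.
    refine ⟨c * ((-1) ^ (n - 1 - s) * m ⟨n - 1 - s, h2⟩ ⟨s, h1⟩), fun l hl => ?_⟩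
    have hll : l.length = n - 1 - s := by omega
    have h3 := hc (mcol m s :: l) (by simp; omega)
    have h4 := listDet_move [] l (blk 1 (n - s) s) (mcol m s) (by simp; omega)
    rw [List.nil_append, List.nil_append] at h4
    rw [blk_succ, zero_add, List.append_assoc, List.singleton_append, h3, List.cons_append]
    have h5 : listDet (l ++ mcol m s :: blk 1 (n - s) s) =
        m ⟨n - 1 - s, h2⟩ ⟨s, h1⟩ * listDet (l ++ blk 1 (n - (s + 1)) (s + 1)) := by
      rw [listDet_expand (mcol m s) ⟨n - 1 - s, h2⟩ (by simp; omega), blk_succ']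
      · rw [show n - (s + 1) + 1 = n - s by omega, show n - (s + 1) = n - 1 - s by omega]
        simp [mcol, h1]
      · intro r hr
        left
        simp only [mcol, h1, dite_true]
        refine hm _ _ fun h => hr (Fin.ext ?_)
        simp only at h ⊢
        omega
    rw [h5, hll] at h4
    have h6 : ((-1 : R) ^ (n - 1 - s)) * (-1) ^ (n - 1 - s) = 1 := by
      rw [← mul_pow]; simp
    linear_combination (c * (-1) ^ (n - 1 - s)) * (-h4) - c * listDet (mcol m s :: (l ++ blk 1 (n - s) s)) * h6

lemma listDet_anti_append {m : Matrix (Fin n) (Fin n) R} (hm : IsAnti m) {s : ℕ}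
    {l : List (Fin n → R)} (hl : l.length + s = n) :
    listDet (blk m 0 s ++ l) = antiMinor m s * listDet (l ++ blk 1 (n - s) s) := by
  obtain ⟨c, hc⟩ := listDet_anti hm s (by omega)
  have h1 := hc (blk 1 0 (n - s)) (by simp; omega)
  rw [listDet_blk_one (n - s) s (by omega), mul_one] at h1
  rw [hc l hl, antiMinor, h1]

lemma antiMinor_zero (m : Matrix (Fin n) (Fin n) R) : antiMinor m 0 = 1 := by
  rw [antiMinor, blk_zero, List.nil_append, Nat.sub_zero, listDet_blk_full, Matrix.det_one]

lemma antiMinor_succ {m : Matrix (Fin n) (Fin n) R} (hm : IsAnti m) {s : ℕ} (hs : s < n) :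
    antiMinor m (s + 1) =
      antiMinor m s * ((-1) ^ (n - 1 - s) * m ⟨n - 1 - s, by omega⟩ ⟨s, hs⟩) := by
  have h2 : n - 1 - s < n := by omega
  have h1 := listDet_anti_append hm (s := s) (l := mcol m s :: blk 1 0 (n - (s + 1)))
    (by simp; omega)
  rw [antiMinor, blk_succ, zero_add, List.append_assoc, List.singleton_append, h1]
  congr 1
  have h4 := listDet_move [] (blk 1 0 (n - (s + 1))) (blk 1 (n - s) s) (mcol m s) (by simp; omega)
  rw [List.nil_append, List.nil_append, length_blk] at h4
  rw [listDet_expand (mcol m s) ⟨n - 1 - s, h2⟩ (by simp; omega)] at h4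
  · have h5 : blk 1 0 (n - (s + 1)) ++ mcol 1 (n - 1 - s) :: blk 1 (n - s) s =
        blk (1 : Matrix (Fin n) (Fin n) R) 0 (n - 1 - s) ++ blk 1 (n - 1 - s) (s + 1) := by
      rw [blk_succ', show n - 1 - s + 1 = n - s by omega, show n - (s + 1) = n - 1 - s by omega]
    simp only at h4
    rw [h5, listDet_blk_one _ _ (by omega), mul_one] at h4
    have h6 : ((-1 : R) ^ (n - 1 - s)) * (-1) ^ (n - 1 - s) = 1 := by
      rw [← mul_pow]; simp
    have h7 : mcol m s ⟨n - 1 - s, h2⟩ = m ⟨n - 1 - s, h2⟩ ⟨s, hs⟩ := by simp [mcol, hs]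
    rw [h7, show n - (s + 1) = n - 1 - s by omega] at h4
    rw [List.cons_append, show n - (s + 1) = n - 1 - s by omega]
    linear_combination (-(-1) ^ (n - 1 - s)) * h4 - listDet (mcol m s :: (blk 1 0 (n - 1 - s) ++
      blk 1 (n - s) s)) * h6
  · intro r hr
    left
    simp only [mcol, hs, dite_true]
    refine hm _ _ fun h => hr (Fin.ext ?_)
    simp only at h ⊢
    omega

/-- The minor of the rows `p, …, p + i - 1` and the first `i` columns. -/
def flagMinor (b : Matrix (Fin n) (Fin n) R) (p i : ℕ) : R :=
  listDet (blk 1 0 p ++ blk b 0 i ++ blk 1 (p + i) (n - p - i))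

end Triangular


/-! ### Positivity of the minors of triangular matrices -/

section Pluecker

variable {R : Type*} [CommRing R] {n : ℕ}

lemma plucker_append (A B C D : List (Fin n → R)) (x y z t : Fin n → R)
    (h : A.length + B.length + C.length + D.length + 2 = n) :
    listDet (A ++ x :: (B ++ (C ++ z :: D))) * listDet (A ++ (B ++ y :: (C ++ (D ++ [t])))) =
      listDet (A ++ x :: (B ++ y :: (C ++ D))) * listDet (A ++ (B ++ (C ++ z :: (D ++ [t])))) +
      listDet (A ++ x :: (B ++ (C ++ (D ++ [t])))) * listDet (A ++ (B ++ y :: (C ++ z :: D))) := by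
  have := plucker_ins ![A, B, C, D] x y z t (by rw [length_flat]; simpa using h)
  simpa [flat, ins, Function.update] using this

lemma intervalMinor_zero (b : Matrix (Fin n) (Fin n) R) (x : ℕ) : intervalMinor b x 0 = 1 := by
  rw [intervalMinor, blk_zero, List.append_nil, Nat.sub_zero, listDet_blk_full, Matrix.det_one]

/-- The minor of the last `k + l` rows and the columns from two intervals. -/
def twoIntervalMinor (b : Matrix (Fin n) (Fin n) R) (x k y l : ℕ) : R :=
  listDet (blk 1 0 (n - k - l) ++ (blk b x k ++ blk b y l))

/-- The four vectors of the Plücker relation are one standard basis vector, the first column of the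
left interval, the column following its remaining k columns, and the last column of the right
interval. -/
lemma twoIntervalMinor_rec (b : Matrix (Fin n) (Fin n) R) {x k y l : ℕ} (h : k + l + 2 ≤ n) :
    twoIntervalMinor b (x + 1) (k + 1) y l * twoIntervalMinor b x (k + 1) y (l + 1) =
      twoIntervalMinor b x (k + 1) y l * twoIntervalMinor b (x + 1) (k + 1) y (l + 1) +
      twoIntervalMinor b (x + 1) k y (l + 1) * twoIntervalMinor b x (k + 2) y l := by
  have key := plucker_append (blk 1 0 (n - k - l - 2)) [] (blk b (x + 1) k) (blk b y l)
    (mcol 1 (n - k - l - 2)) (mcol b x) (mcol b (x + 1 + k)) (mcol b (y + l)) (by simp; omega)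
  have e1 : n - (k + 1) - l = n - k - l - 2 + 1 := by omega
  have e2 : n - k - (l + 1) = n - k - l - 2 + 1 := by omega
  have e3 : n - (k + 1) - (l + 1) = n - k - l - 2 := by omega
  have e4 : n - (k + 2) - l = n - k - l - 2 := by omega
  have b1 : blk b x (k + 1) = mcol b x :: blk b (x + 1) k := blk_succ' _ _ _
  have b2 : blk b x (k + 2) = mcol b x :: (blk b (x + 1) k ++ [mcol b (x + 1 + k)]) := by
    rw [blk_succ' _ _ (k + 1), blk_succ]
  simp only [twoIntervalMinor, e1, e2, e3, e4, b1, b2, blk_succ _ 0 (n - k - l - 2),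
    blk_succ _ (x + 1) k, blk_succ _ y l, zero_add, List.append_assoc, List.nil_append,
    List.cons_append] at key ⊢
  exact key

end Pluecker

section Positive

variable {K : Type*} [Field K] {n : ℕ} {Q : Set K}

/-- The recursion is subtraction-free, and all other minors in it span a smaller range of columns.
It stops when the intervals become adjacent or one of them becomes empty; then they form a single
interval. -/
lemma twoIntervalMinor_mem (hQ : IsPositiveSet Q) {b : Matrix (Fin n) (Fin n) K}
    (hb : ∀ x k, x + k ≤ n → intervalMinor b x k ∈ Q) {x k y l : ℕ} (h1 : x + k ≤ y)
    (h2 : y + l ≤ n) : twoIntervalMinor b x k y l ∈ Q := by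
  induction hN : y + l - x using Nat.strong_induction_on generalizing x k l with
  | _ N ih =>
    rcases Nat.eq_zero_or_pos k with rfl | hk
    · exact hb y l h2
    rcases Nat.eq_zero_or_pos l with rfl | hl
    · have := hb x k (by omega)
      simpa [twoIntervalMinor, intervalMinor] using this
    rcases h1.eq_or_lt with rfl | h1
    · have := hb x (k + l) (by omega)
      rwa [intervalMinor, ← blk_append, ← Nat.sub_sub] at this
    obtain ⟨k, rfl⟩ := Nat.exists_eq_succ_of_ne_zero hk.ne'
    obtain ⟨l, rfl⟩ := Nat.exists_eq_succ_of_ne_zero hl.ne'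
    simp only [Nat.succ_eq_add_one] at *
    have key := twoIntervalMinor_rec b (x := x) (k := k) (y := y) (l := l) (by omega)
    refine hQ.mem_of_mul_mem (y := twoIntervalMinor b (x + 1) (k + 1) y l) ?_
      (ih (y + l - (x + 1)) (by omega) (by omega) (by omega) rfl)
    rw [mul_comm, key]
    refine hQ.add (hQ.mul ?_ ?_) (hQ.mul ?_ ?_)
    · exact ih (y + l - x) (by omega) (by omega) (by omega) rfl
    · exact ih (y + (l + 1) - (x + 1)) (by omega) (by omega) (by omega) rfl
    · exact ih (y + (l + 1) - (x + 1)) (by omega) (by omega) (by omega) rfl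
    · exact ih (y + l - x) (by omega) (by omega) (by omega) rfl

/-- By triangularity the last r columns of b act like the last r standard basis vectors, up to the
interval minor. This yields flag minors as quotients of minors on the last rows. -/
lemma intervalMinor_mul_flagMinor {R : Type*} [CommRing R] {b : Matrix (Fin n) (Fin n) R}
    (hb : IsLower b) {p q r : ℕ} (h : p + q + r = n) :
    intervalMinor b (p + q) r * flagMinor b p q = twoIntervalMinor b 0 q (p + q) r := by
  have := listDet_lower hb h (l := blk 1 0 p ++ blk b 0 q) (by simp)
  rw [flagMinor, show n - p - q = r by omega, ← this, twoIntervalMinor,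
    show n - q - r = p by omega, List.append_assoc]

lemma intervalMinor_mul_flagMinor_zero {R : Type*} [CommRing R] {b : Matrix (Fin n) (Fin n) R}
    (hb : IsLower b) {q r : ℕ} (h : q + r = n) :
    intervalMinor b q r * flagMinor b 0 q = b.det := by
  have := intervalMinor_mul_flagMinor hb (p := 0) (q := q) (r := r) (by omega)
  rw [zero_add] at this
  rw [this, twoIntervalMinor, show n - q - r = 0 by omega, blk_zero, List.nil_append]
  have h2 := blk_append b 0 q r
  rw [zero_add] at h2
  rw [h2, h, listDet_blk_full]

lemma flagMinor_zero {R : Type*} [CommRing R] (b : Matrix (Fin n) (Fin n) R) {p : ℕ} (h : p ≤ n) :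
    flagMinor b p 0 = 1 := by
  rw [flagMinor, blk_zero, List.append_nil, add_zero, Nat.sub_zero, listDet_blk_one _ _ (by omega)]

lemma flagMinor_full {R : Type*} [CommRing R] (b : Matrix (Fin n) (Fin n) R) :
    flagMinor b 0 n = b.det := by
  rw [flagMinor, Nat.sub_zero, Nat.sub_self, blk_zero, blk_zero, List.nil_append, List.append_nil,
    listDet_blk_full]

lemma flagMinor_mem (hQ : IsPositiveSet Q) {b : Matrix (Fin n) (Fin n) K} (hl : IsLower b)
    (hb : ∀ x k, x + k ≤ n → intervalMinor b x k ∈ Q) {p q : ℕ} (h : p + q ≤ n) :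
    flagMinor b p q ∈ Q := by
  refine hQ.mem_of_mul_mem (y := intervalMinor b (p + q) (n - p - q)) ?_ (hb _ _ (by omega))
  rw [mul_comm, intervalMinor_mul_flagMinor hl (by omega)]
  exact twoIntervalMinor_mem hQ hb (by omega) (by omega)

/-- The antidiagonal matrix all of whose antidiagonal minors are equal to `1`. -/
def signedAnti (R : Type*) [CommRing R] (n : ℕ) : Matrix (Fin n) (Fin n) R :=
  Matrix.of fun r c => if (r : ℕ) + c + 1 = n then (-1) ^ (r : ℕ) else 0

lemma isAnti_signedAnti (R : Type*) [CommRing R] (n : ℕ) : IsAnti (signedAnti R n) :=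
  fun _ _ h => if_neg h

lemma antiMinor_signedAnti (R : Type*) [CommRing R] (n : ℕ) {s : ℕ} (hs : s ≤ n) :
    antiMinor (signedAnti R n) s = 1 := by
  induction s with
  | zero => exact antiMinor_zero _
  | succ s ih =>
    rw [antiMinor_succ (isAnti_signedAnti R n) hs, ih (by omega), one_mul, signedAnti,
      Matrix.of_apply, if_pos (by simp only; omega), ← mul_pow]
    simp

section Product

variable {b b' : Matrix (Fin n) (Fin n) K}

/-- The antidiagonal block is the same as standard basis vectors appended at the end, without a
sign. So flag minors are corner determinants of four matrices, and the octahedron relation applies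
to them. -/
lemma cornerDet_signedAnti {p : Fin 4 → ℕ} (hp : ∑ a, p a = n) :
    cornerDet ![signedAnti K n, 1, b, b * b'] p =
      listDet (blk 1 0 (p 1) ++ blk b 0 (p 2) ++ blk (b * b') 0 (p 3) ++ blk 1 (n - p 0) (p 0)) := by
  rw [Fin.sum_univ_four] at hp
  have := listDet_anti_append (isAnti_signedAnti K n) (s := p 0)
    (l := blk 1 0 (p 1) ++ blk b 0 (p 2) ++ blk (b * b') 0 (p 3)) (by simp; omega)
  rw [antiMinor_signedAnti K n (by omega), one_mul] at this
  rw [← this]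
  simp [cornerDet, flat, blocks]

/-- It suffices to treat two faces. Without columns of b * b' one has a flag minor of b. Without
columns of 1, the factor b can be pulled out, and a flag minor of b' remains. -/
lemma cornerDet_signedAnti_mem (hQ : IsPositiveSet Q) (hb : IsLower b)
    (h : ∀ p q, p + q ≤ n → flagMinor b p q ∈ Q) (h' : ∀ p q, p + q ≤ n → flagMinor b' p q ∈ Q)
    (p : Fin 4 → ℕ) (hp : ∑ a, p a = n) :
    cornerDet ![signedAnti K n, 1, b, b * b'] p ∈ Q := by
  refine cornerDet_mem hQ (fun p hp hf => ?_) p hp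
  rw [cornerDet_signedAnti hp]
  rw [Fin.sum_univ_four] at hp
  rcases hf with hf | hf
  · rw [hf, blk_zero, List.nil_append]
    have hdet : b.det ∈ Q := flagMinor_full b ▸ h 0 n (by omega)
    have hi : intervalMinor b (n - p 0) (p 0) ∈ Q := by
      refine hQ.mem_of_mul_mem ?_ (h 0 (n - p 0) (by omega))
      rwa [intervalMinor_mul_flagMinor_zero hb (by omega)]
    refine hQ.mem_of_mul_mem ?_ hi
    -- The interval minor replaces the trailing basis vectors by columns of b, so that b becomes a
    -- common left factor of all columns.
    rw [mul_comm, ← listDet_lower hb (by omega) (by simp; omega)]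
    have h1 := listDet_map_mulVec b (blk 1 0 (p 2) ++ blk b' 0 (p 3) ++ blk 1 (n - p 0) (p 0))
      (by simp; omega)
    simp only [List.map_append, ← blk_mul, mul_one] at h1
    rw [h1]
    refine hQ.mul hdet ?_
    have := h' (p 2) (p 3) (by omega)
    rwa [flagMinor, show p 2 + p 3 = n - p 0 by omega, show n - p 2 - p 3 = p 0 by omega] at this
  · rw [hf, blk_zero, List.append_nil]
    have := h (p 1) (p 2) (by omega)
    rwa [flagMinor, show p 1 + p 2 = n - p 0 by omega, show n - p 1 - p 2 = p 0 by omega] at this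

/-- A flag minor of the product is the corner determinant without columns of b; the octahedron
relation takes the place of a Cauchy–Binet expansion. -/
lemma flagMinor_mul_mem (hQ : IsPositiveSet Q) (hb : IsLower b)
    (h : ∀ p q, p + q ≤ n → flagMinor b p q ∈ Q) (h' : ∀ p q, p + q ≤ n → flagMinor b' p q ∈ Q)
    {p q : ℕ} (hpq : p + q ≤ n) : flagMinor (b * b') p q ∈ Q := by
  have hs : ∑ a, (![n - p - q, p, 0, q] : Fin 4 → ℕ) a = n := by
    rw [Fin.sum_univ_four]; simp; omega
  have := cornerDet_signedAnti_mem hQ hb h h' _ hs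
  rw [cornerDet_signedAnti hs] at this
  simpa [flagMinor, show n - (n - p - q) = p + q by omega] using this

end Product

lemma IsLower.mul {R : Type*} [CommRing R] {b b' : Matrix (Fin n) (Fin n) R} (hb : IsLower b)
    (hb' : IsLower b') : IsLower (b * b') := by
  intro r c hrc
  rw [Matrix.mul_apply]
  refine Finset.sum_eq_zero fun k _ => ?_
  rcases lt_or_ge r k with h | h
  · rw [hb r k h, zero_mul]
  · rw [hb' k c (h.trans_lt hrc), mul_zero]

/-- For triangular matrices, positivity of the flag minors implies positivity of the corner
determinants. -/
theorem cornerDet_prods_mem_of_isLower (hQ : IsPositiveSet Q)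
    {g : Fin 3 → Matrix (Fin n) (Fin n) K} (hg : ∀ l, IsLower (g l))
    (h : ∀ l p q, p + q ≤ n → flagMinor (g l) p q ∈ Q) (p : Fin 4 → ℕ) (hp : ∑ a, p a = n) :
    cornerDet (prods g) p ∈ Q := by
  refine cornerDet_mem hQ (fun p hp hf => ?_) p hp
  have hp' := hp
  rw [Fin.sum_univ_four] at hp'
  rcases hf with hf | hf
  -- The matrices left on this face are 1, g₁g₂, g₁g₂g₃, a pair of factors g₁g₂ and g₃. On the other
  -- face the factors are g₁ and g₂. The antidiagonal block stays empty.
  · have hs : ∑ a, (![0, p 0, p 2, p 3] : Fin 4 → ℕ) a = n := by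
      rw [Fin.sum_univ_four]; simp; omega
    have := cornerDet_signedAnti_mem hQ ((hg 0).mul (hg 1))
      (fun p q hpq => flagMinor_mul_mem hQ (hg 0) (h 0) (h 1) hpq) (h 2) _ hs
    rw [cornerDet_signedAnti hs] at this
    simpa [cornerDet, flat, blocks, prods, hf] using this
  · have hs : ∑ a, (![0, p 0, p 1, p 2] : Fin 4 → ℕ) a = n := by
      rw [Fin.sum_univ_four]; simp; omega
    have := cornerDet_signedAnti_mem hQ (hg 0) (h 0) (h 1) _ hs
    rw [cornerDet_signedAnti hs] at this
    simpa [cornerDet, flat, blocks, prods, hf] using this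

end Positive


/-! ### The entries of a triangular matrix as Laurent polynomials in its minors -/

section Laurent

variable {K : Type*} [Field K] {n : ℕ} {S : Subring K}

lemma mem_of_mul_eq {x y z : K} (h : x * y = z) (hy : y⁻¹ ∈ S) (hy0 : y ≠ 0) (hz : z ∈ S) :
    x ∈ S := by
  have : x = z * y⁻¹ := by rw [← h, mul_inv_cancel_right₀ hy0]
  exact this ▸ S.mul_mem hz hy

lemma listDet_eq_or_neg {l l' : List (Fin n → K)} (h : l.Perm l') (hl : l.length = n) :
    listDet l = listDet l' ∨ listDet l = -listDet l' := by
  simpa using listDet_perm h [] (by simpa using hl)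

lemma listDet_mem_of_perm {l l' : List (Fin n → K)} (h : l.Perm l') (hl : l.length = n)
    (h' : listDet l' ∈ S) : listDet l ∈ S := by
  rcases listDet_eq_or_neg h hl with h1 | h1
  · exact h1 ▸ h'
  · exact h1 ▸ S.neg_mem h'

/-- The minor of the last `l + 1` rows, the column `c` and the columns `y, …, y + l - 1`. -/
def columnIntervalMinor (b : Matrix (Fin n) (Fin n) K) (c y l : ℕ) : K :=
  listDet (blk 1 0 (n - l - 1) ++ mcol b c :: blk b y l)

/-- The Plücker relation is taken for a standard basis vector and the columns c, y, y + 1 + l. The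
factor to be divided by is an interval minor, which keeps the recursion within Laurent polynomials
in interval minors. -/
lemma columnIntervalMinor_rec (b : Matrix (Fin n) (Fin n) K) (c : ℕ) {y l : ℕ} (h : l + 2 ≤ n) :
    columnIntervalMinor b c (y + 1) (l + 1) * intervalMinor b y (l + 1) =
      columnIntervalMinor b c (y + 1) l * intervalMinor b y (l + 2) +
      intervalMinor b (y + 1) (l + 1) * columnIntervalMinor b c y (l + 1) := by
  have key := plucker_append (blk 1 0 (n - l - 2)) [] [] (blk b (y + 1) l)
    (mcol 1 (n - l - 2)) (mcol b c) (mcol b y) (mcol b (y + 1 + l)) (by simp; omega)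
  have e1 : n - (l + 1) = n - l - 2 + 1 := by omega
  have e2 : n - (l + 1) - 1 = n - l - 2 := by omega
  have e3 : n - (l + 2) = n - l - 2 := by omega
  have e4 : n - l - 1 = n - l - 2 + 1 := by omega
  have b1 : blk b y (l + 1) = mcol b y :: blk b (y + 1) l := blk_succ' _ _ _
  have b2 : blk b y (l + 2) = mcol b y :: (blk b (y + 1) l ++ [mcol b (y + 1 + l)]) := by
    rw [blk_succ' _ _ (l + 1), blk_succ]
  simp only [columnIntervalMinor, intervalMinor, e2, e3, e4]
  simp only [e1, b1, b2, blk_succ _ 0 (n - l - 2),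
    blk_succ _ (y + 1) l, zero_add, List.append_assoc, List.nil_append,
    List.cons_append] at key ⊢
  rw [mul_comm, key]

/-- The recursion shortens the interval or shifts it towards c. It ends with the single column c or
with an interval starting at c. -/
lemma columnIntervalMinor_mem {b : Matrix (Fin n) (Fin n) K}
    (h0 : ∀ x k, x + k ≤ n → intervalMinor b x k ≠ 0)
    (h1 : ∀ x k, x + k ≤ n → intervalMinor b x k ∈ S)
    (h2 : ∀ x k, x + k ≤ n → (intervalMinor b x k)⁻¹ ∈ S) {c y l : ℕ} (hc : c < y)
    (hy : y + l ≤ n) : columnIntervalMinor b c y l ∈ S := by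
  induction hN : y + l using Nat.strong_induction_on generalizing y l with
  | _ N ih =>
    rcases Nat.eq_zero_or_pos l with rfl | hl
    · have := h1 c 1 (by omega)
      simpa [columnIntervalMinor, intervalMinor, blk_succ] using this
    obtain ⟨y, rfl⟩ := Nat.exists_eq_succ_of_ne_zero (by omega : y ≠ 0)
    obtain ⟨l, rfl⟩ := Nat.exists_eq_succ_of_ne_zero hl.ne'
    simp only [Nat.succ_eq_add_one] at *
    rcases (Nat.lt_succ_iff.1 hc).eq_or_lt with rfl | hc'
    · have := h1 c (l + 2) (by omega)
      rwa [intervalMinor, blk_succ', Nat.sub_add_eq n (l + 1) 1] at this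
    · refine mem_of_mul_eq (columnIntervalMinor_rec b c (by omega)) (h2 _ _ (by omega))
        (h0 _ _ (by omega)) (S.add_mem (S.mul_mem ?_ ?_) (S.mul_mem ?_ ?_))
      · exact ih (y + 1 + l) (by omega) hc (by omega) rfl
      · exact h1 _ _ (by omega)
      · exact h1 _ _ (by omega)
      · exact ih (y + (l + 1)) (by omega) hc' (by omega) rfl

/-- The columns after r vanish in row r, so the minor of the rows from r on, with column c and the
columns after r, is block triangular. -/
lemma entry_mul_intervalMinor {b : Matrix (Fin n) (Fin n) K} (hb : IsLower b) (r c : Fin n) :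
    b r c * intervalMinor b (r + 1) (n - r - 1) = columnIntervalMinor b c (r + 1) (n - r - 1) := by
  have hr := r.2
  have h1 := listDet_lower hb (a := r + 1) (k := n - r - 1) (by omega)
    (l := blk 1 0 r ++ [mcol b c]) (by simp)
  have h2 := listDet_expand (l₁ := blk 1 0 r) (l₂ := blk 1 (r + 1) (n - r - 1)) (mcol b c) r
    (by simp; omega) (fun s hs => Or.inr ?_)
  · have h3 : listDet (blk 1 0 (r : ℕ) ++ mcol 1 (r : ℕ) ::
        blk (1 : Matrix (Fin n) (Fin n) K) (r + 1) (n - r - 1)) = 1 := by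
      rw [← blk_succ', listDet_blk_one _ _ (by omega)]
    have h4 : mcol b (c : ℕ) r = b r c := by simp [mcol]
    rw [List.append_assoc, List.append_assoc, List.singleton_append, List.singleton_append] at h1
    rw [columnIntervalMinor, show n - (n - (r : ℕ) - 1) - 1 = r by omega, h1, h2, h3, h4]
    ring
  · have : (s : ℕ) ≠ r := fun h => hs (Fin.ext h)
    rcases lt_or_gt_of_ne this with h | h
    · exact List.mem_append_left _ (mem_blk (by omega) (by omega))
    · exact List.mem_append_right _ (mem_blk (by omega) (by omega))

lemma entry_mem_of_intervalMinor {b : Matrix (Fin n) (Fin n) K} (hb : IsLower b)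
    (h0 : ∀ x k, x + k ≤ n → intervalMinor b x k ≠ 0)
    (h1 : ∀ x k, x + k ≤ n → intervalMinor b x k ∈ S)
    (h2 : ∀ x k, x + k ≤ n → (intervalMinor b x k)⁻¹ ∈ S) (r c : Fin n) : b r c ∈ S := by
  have hr := r.2
  rcases lt_or_ge r c with h | h
  · rw [hb r c h]
    exact S.zero_mem
  · have h' : (c : ℕ) ≤ r := h
    exact mem_of_mul_eq (entry_mul_intervalMinor hb r c) (h2 _ _ (by omega)) (h0 _ _ (by omega))
      (columnIntervalMinor_mem h0 h1 h2 (by omega) (by omega))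

/-- Up to sign, the minor of the first `k + 1` columns and the rows `x, …, x + k - 1` and `r`. -/
def rowFlagMinor (b : Matrix (Fin n) (Fin n) K) (x k r : ℕ) : K :=
  listDet (blk b 0 (k + 1) ++ blk 1 0 x ++ blk 1 (x + k) (r - x - k) ++ blk 1 (r + 1) (n - r - 1))

/-- The Plücker relation exchanges column k + 1 of b with the standard basis vectors x, x + k + 1
and r. It divides only by a flag minor and brings x closer to r. The recursion ends when the rows
are contiguous or only row r is left; both are flag minors up to sign. -/
lemma rowFlagMinor_mem {b : Matrix (Fin n) (Fin n) K}
    (h0 : ∀ p i, p + i ≤ n → flagMinor b p i ≠ 0)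
    (h1 : ∀ p i, p + i ≤ n → flagMinor b p i ∈ S)
    (h2 : ∀ p i, p + i ≤ n → (flagMinor b p i)⁻¹ ∈ S) {x k r : ℕ} (hx : x + k ≤ r)
    (hr : r < n) : rowFlagMinor b x k r ∈ S := by
  induction hN : r - x using Nat.strong_induction_on generalizing x k with
  | _ N ih =>
    rcases hx.eq_or_lt with rfl | hx
    · refine listDet_mem_of_perm ?_ (by simp; omega) (h1 x (k + 1) (by omega))
      rw [show x + k - x - k = 0 by omega, show n - (x + k) - 1 = n - x - (k + 1) by omega, blk_zero,
        List.append_nil, add_assoc]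
      exact List.Perm.append_right _ List.perm_append_comm
    rcases Nat.eq_zero_or_pos k with rfl | hk
    · refine listDet_mem_of_perm ?_ (by simp; omega) (h1 r 1 (by omega))
      have e := blk_append (1 : Matrix (Fin n) (Fin n) K) 0 x (r - x)
      rw [zero_add, show x + (r - x) = r by omega] at e
      rw [add_zero, Nat.sub_zero, List.append_assoc (blk b 0 _), e]
      exact List.Perm.append_right _ List.perm_append_comm
    obtain ⟨k, rfl⟩ := Nat.exists_eq_succ_of_ne_zero hk.ne'
    simp only [Nat.succ_eq_add_one] at *
    set S0 := blk b 0 (k + 1) ++ blk 1 0 x ++ blk 1 (x + k + 2) (r - x - k - 2) ++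
      blk 1 (r + 1) (n - r - 1) with hS0
    have key := listDet_plucker S0 (mcol b (k + 1)) (mcol 1 (x + k + 1)) (mcol 1 x) (mcol 1 r)
      (by simp [hS0]; omega)
    have len (u v : Fin n → K) : (u :: v :: S0).length = n := by
      simp [hS0]; omega
    have bb : blk b 0 (k + 2) = blk b 0 (k + 1) ++ [mcol b (k + 1)] := by
      rw [blk_succ, zero_add]
    have bx : blk (1 : Matrix (Fin n) (Fin n) K) 0 (x + 1) = blk 1 0 x ++ [mcol 1 x] := by
      rw [blk_succ, zero_add]
    have bm : blk (1 : Matrix (Fin n) (Fin n) K) (x + k + 1) (r - x - k - 1) =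
        mcol 1 (x + k + 1) :: blk 1 (x + k + 2) (r - x - k - 2) := by
      rw [show r - x - k - 1 = r - x - k - 2 + 1 by omega, blk_succ']
    have br : blk (1 : Matrix (Fin n) (Fin n) K) (x + k + 2) (n - x - k - 2) =
        blk 1 (x + k + 2) (r - x - k - 2) ++ mcol 1 r :: blk 1 (r + 1) (n - r - 1) := by
      rw [← blk_succ', show (r : ℕ) = x + k + 2 + (r - x - k - 2) by omega, show
        x + k + 2 + (r - x - k - 2) - x - k - 2 = r - x - k - 2 by omega, blk_append]
      congr 1
      omega
    have bmr : blk (1 : Matrix (Fin n) (Fin n) K) (x + k + 1) (n - x - k - 1) =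
        mcol 1 (x + k + 1) :: blk 1 (x + k + 2) (r - x - k - 2) ++
          mcol 1 r :: blk 1 (r + 1) (n - r - 1) := by
      rw [show n - x - k - 1 = n - x - k - 2 + 1 by omega, blk_succ', br, List.cons_append]
    have t1 := ih (r - (x + 1)) (by omega) (x := x + 1) (k := k + 1) (by omega) rfl
    have t2 := ih (r - (x + 1)) (by omega) (x := x + 1) (k := k) (by omega) rfl
    have f1 := h1 x (k + 1) (by omega)
    have f2 := h1 x (k + 2) (by omega)
    -- Signs do not matter for membership in a subring, so the lists are compared only as multisets.
    -- This determinant is the one to be divided by.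
    have f0 : flagMinor b (x + 1) (k + 1) = listDet (mcol 1 x :: mcol 1 r :: S0) ∨
        flagMinor b (x + 1) (k + 1) = -listDet (mcol 1 x :: mcol 1 r :: S0) := by
      rw [flagMinor, bx, show n - (x + 1) - (k + 1) = n - x - k - 2 by omega,
        show x + 1 + (k + 1) = x + k + 2 by omega, br]
      refine listDet_eq_or_neg ?_ (by simp; omega)
      refine Multiset.coe_eq_coe.1 ?_
      simp only [hS0, ← Multiset.cons_coe, ← Multiset.coe_add, ← Multiset.singleton_add,
        Multiset.coe_nil]
      abel
    rw [rowFlagMinor, show x + 1 + (k + 1) = x + k + 2 by omega,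
      show r - (x + 1) - (k + 1) = r - x - k - 2 by omega, bx, bb] at t1
    rw [rowFlagMinor, show x + 1 + k = x + k + 1 by omega,
      show r - (x + 1) - k = r - x - k - 1 by omega, bx, bm] at t2
    rw [flagMinor, ← add_assoc, show n - x - (k + 1) = n - x - k - 1 by omega, bmr] at f1
    rw [flagMinor, ← add_assoc, show n - x - (k + 2) = n - x - k - 2 by omega, br, bb] at f2
    rw [rowFlagMinor, show x + (k + 1) = x + k + 1 by omega,
      show r - x - (k + 1) = r - x - k - 1 by omega, bb, bm]
    have g0 : (listDet (mcol 1 x :: mcol 1 r :: S0))⁻¹ ∈ S ∧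
        listDet (mcol 1 x :: mcol 1 r :: S0) ≠ 0 := by
      have i0 := h0 (x + 1) (k + 1) (by omega)
      have i2 := h2 (x + 1) (k + 1) (by omega)
      rcases f0 with f0 | f0
      · exact f0 ▸ ⟨i2, i0⟩
      · rw [f0] at i0 i2
        rw [inv_neg] at i2
        exact ⟨neg_neg ((listDet (mcol 1 x :: mcol 1 r :: S0))⁻¹) ▸ S.neg_mem i2,
          fun h => i0 (by rw [h, neg_zero])⟩
    refine listDet_mem_of_perm (l' := mcol b (k + 1) :: mcol 1 (x + k + 1) :: S0) ?_
      (by simp; omega) (mem_of_mul_eq key g0.1 g0.2 (S.sub_mem (S.mul_mem ?_ ?_) (S.mul_mem ?_ ?_)))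
    · refine Multiset.coe_eq_coe.1 ?_
      simp only [hS0, ← Multiset.cons_coe, ← Multiset.coe_add, ← Multiset.singleton_add,
        Multiset.coe_nil]
      abel
    · refine listDet_mem_of_perm ?_ (len _ _) t1
      refine Multiset.coe_eq_coe.1 ?_
      simp only [hS0, ← Multiset.cons_coe, ← Multiset.coe_add, ← Multiset.singleton_add,
        Multiset.coe_nil]
      abel
    · refine listDet_mem_of_perm ?_ (len _ _) f1
      refine Multiset.coe_eq_coe.1 ?_
      simp only [hS0, ← Multiset.cons_coe, ← Multiset.coe_add, ← Multiset.singleton_add]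
      abel
    · refine listDet_mem_of_perm ?_ (len _ _) f2
      refine Multiset.coe_eq_coe.1 ?_
      simp only [hS0, ← Multiset.cons_coe, ← Multiset.coe_add, ← Multiset.singleton_add,
        Multiset.coe_nil]
      abel
    · refine listDet_mem_of_perm ?_ (len _ _) t2
      refine Multiset.coe_eq_coe.1 ?_
      simp only [hS0, ← Multiset.cons_coe, ← Multiset.coe_add, ← Multiset.singleton_add,
        Multiset.coe_nil]
      abel

/-- For x = 0 and k = c, column c vanishes in the rows above c, so the minor is the entry times a
principal flag minor, up to sign. -/
lemma entry_mem_of_flagMinor {b : Matrix (Fin n) (Fin n) K} (hb : IsLower b)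
    (h0 : ∀ p i, p + i ≤ n → flagMinor b p i ≠ 0)
    (h1 : ∀ p i, p + i ≤ n → flagMinor b p i ∈ S)
    (h2 : ∀ p i, p + i ≤ n → (flagMinor b p i)⁻¹ ∈ S) (r c : Fin n) : b r c ∈ S := by
  have hr := r.2
  have hc := c.2
  rcases lt_or_ge r c with h | h
  · rw [hb r c h]
    exact S.zero_mem
  have hrc : (c : ℕ) ≤ r := h
  have h3 := rowFlagMinor_mem h0 h1 h2 (x := 0) (k := c) (r := r) (by omega) hr
  rw [rowFlagMinor, blk_succ, zero_add, blk_zero, List.append_nil, Nat.sub_zero,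
    List.append_assoc, List.append_assoc, List.singleton_append] at h3
  rw [listDet_expand (mcol b c) r (by simp; omega)] at h3
  · have e : mcol b (c : ℕ) r = b r c := by simp [mcol]
    rw [e] at h3
    have f0 : listDet (blk b 0 c ++ mcol 1 (r : ℕ) :: (blk 1 c (r - c) ++
        blk 1 (r + 1) (n - r - 1))) = flagMinor b 0 c ∨
      listDet (blk b 0 c ++ mcol 1 (r : ℕ) :: (blk 1 c (r - c) ++
        blk 1 (r + 1) (n - r - 1))) = -flagMinor b 0 c := by
      refine listDet_eq_or_neg ?_ (by simp; omega)
      have e1 : blk (1 : Matrix (Fin n) (Fin n) K) (0 + c) (n - 0 - c) =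
          blk 1 c (r - c) ++ mcol 1 (r : ℕ) :: blk 1 (r + 1) (n - r - 1) := by
        have := blk_append (1 : Matrix (Fin n) (Fin n) K) c (r - c) (n - r - 1 + 1)
        rw [show (c : ℕ) + (r - c) = r by omega, show (r : ℕ) - c + (n - r - 1 + 1) = n - c by omega,
          blk_succ'] at this
        rw [zero_add, Nat.sub_zero, this]
      refine Multiset.coe_eq_coe.1 ?_
      rw [e1]
      simp only [← Multiset.cons_coe, ← Multiset.coe_add, ← Multiset.singleton_add,
        Multiset.coe_nil, blk_zero]
      abel
    have i0 := h0 0 c (by omega)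
    have i2 := h2 0 c (by omega)
    refine mem_of_mul_eq (y := flagMinor b 0 c) (z := b r c * flagMinor b 0 c) rfl i2 i0 ?_
    rcases f0 with f0 | f0
    · rwa [f0] at h3
    · rw [f0, mul_neg] at h3
      exact neg_neg (b r c * flagMinor b 0 c) ▸ S.neg_mem h3
  · intro s hs
    have hne : (s : ℕ) ≠ r := fun h => hs (Fin.ext h)
    have hs2 := s.2
    rcases lt_or_ge (s : ℕ) c with h | h
    · left
      simp only [mcol, hc, dite_true]
      exact hb _ _ h
    · right
      refine List.mem_append_right _ ?_
      rcases lt_or_gt_of_ne hne with h' | h'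
      · exact List.mem_append_left _ (mem_blk (by omega) (by omega))
      · exact List.mem_append_right _ (mem_blk (by omega) (by omega))

end Laurent


/-! ### Auxiliary facts on subrings and charts -/

section Subrings

variable {K : Type*} [Field K] {n : ℕ}

lemma det_mem {S : Subring K} {M : Matrix (Fin n) (Fin n) K} (h : ∀ r c, M r c ∈ S) :
    M.det ∈ S := by
  let N : Matrix (Fin n) (Fin n) S := Matrix.of fun r c => ⟨M r c, h r c⟩
  have : M = S.subtype.mapMatrix N := rfl
  rw [this, ← RingHom.map_det]
  exact N.det.2

lemma inv_entry_mem {S : Subring K} {M : Matrix (Fin n) (Fin n) K} (h : ∀ r c, M r c ∈ S)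
    (hd : M.det⁻¹ ∈ S) (r c : Fin n) : M⁻¹ r c ∈ S := by
  let N : Matrix (Fin n) (Fin n) S := Matrix.of fun r c => ⟨M r c, h r c⟩
  have : M = S.subtype.mapMatrix N := rfl
  rw [Matrix.inv_def, Ring.inverse_eq_inv', Matrix.smul_apply, smul_eq_mul]
  refine S.mul_mem hd ?_
  rw [this, ← RingHom.map_adjugate]
  exact (N.adjugate r c).2

lemma mul_entry_mem {S : Subring K} {M N : Matrix (Fin n) (Fin n) K} (h : ∀ r c, M r c ∈ S)
    (h' : ∀ r c, N r c ∈ S) (r c : Fin n) : (M * N) r c ∈ S := by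
  rw [Matrix.mul_apply]
  exact S.sum_mem fun k _ => S.mul_mem (h r k) (h' k c)

lemma one_entry_mem {S : Subring K} (r c : Fin n) : (1 : Matrix (Fin n) (Fin n) K) r c ∈ S := by
  rw [Matrix.one_apply]
  split_ifs
  exacts [S.one_mem, S.zero_mem]

lemma mem_of_mem_blk {S : Subring K} {M : Matrix (Fin n) (Fin n) K} (h : ∀ r c, M r c ∈ S)
    {a k : ℕ} {v : Fin n → K} (hv : v ∈ blk M a k) (i : Fin n) : v i ∈ S := by
  obtain ⟨j, -, rfl⟩ := List.mem_map.1 hv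
  rw [mcol]
  split_ifs
  exacts [h _ _, S.zero_mem]

lemma listDet_mem {S : Subring K} {l : List (Fin n → K)} (h : ∀ v ∈ l, ∀ i, v i ∈ S) :
    listDet l ∈ S := by
  refine det_mem fun r c => ?_
  simp only [listMat, Matrix.of_apply]
  rcases lt_or_ge (r : ℕ) l.length with hr | hr
  · rw [List.getD_eq_getElem _ _ hr]
    exact h _ (List.getElem_mem hr) _
  · rw [List.getD_eq_default _ _ hr]
    exact S.zero_mem

lemma intervalMinor_mem_subring {S : Subring K} {M : Matrix (Fin n) (Fin n) K}
    (h : ∀ r c, M r c ∈ S) (x k : ℕ) : intervalMinor M x k ∈ S := by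
  refine listDet_mem fun v hv => ?_
  rcases List.mem_append.1 hv with hv | hv
  · exact mem_of_mem_blk one_entry_mem hv
  · exact mem_of_mem_blk h hv

lemma cornerDet_mem_subring {S : Subring K} {H : Fin 4 → Matrix (Fin n) (Fin n) K}
    (h : ∀ b r c, H b r c ∈ S) (p : Fin 4 → ℕ) : cornerDet H p ∈ S := by
  refine listDet_mem fun v hv => ?_
  simp only [flat, blocks, List.mem_append] at hv
  rcases hv with ((hv | hv) | hv) | hv <;> exact mem_of_mem_blk (h _) hv

/-- The elements of a subring of a field whose inverses lie in it, too. -/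
def unitsIn (S : Subring K) : Submonoid K where
  carrier := {x | x ∈ S ∧ x⁻¹ ∈ S}
  one_mem' := ⟨S.one_mem, by rw [inv_one]; exact S.one_mem⟩
  mul_mem' h h' := ⟨S.mul_mem h.1 h'.1, by rw [mul_inv]; exact S.mul_mem h.2 h'.2⟩

lemma inv_mul_prod_mem {S : Subring K} {κ : Type*} [Fintype κ] {D : κ → K} (h : ∀ k, D k ∈ S)
    (h0 : ∀ k, D k ≠ 0) (k : κ) : (D k)⁻¹ * ∏ j, D j ∈ S := by
  classical
  rw [← Finset.mul_prod_erase _ _ (Finset.mem_univ k), inv_mul_cancel_left₀ (h0 k)]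
  exact S.prod_mem fun j _ => h j

end Subrings

section Coordinates

variable {K : Type} [Field K] [Algebra ℂ K] {A : Subalgebra ℂ K} {ι κ : Type}

lemma ToricChart.IsCoordinate.unique {θ : ToricChart A ι} {i : ι} {f f' : K}
    (h : θ.IsCoordinate i f) (h' : θ.IsCoordinate i f') : f = f' := by
  obtain ⟨-, a, b, hb, hab, hθ⟩ := h
  obtain ⟨-, a', b', hb', hab', hθ'⟩ := h'
  have h1 : a * b' = a' * b := by
    apply θ.pullback_injective
    rw [mul_one] at hθ hθ'
    rw [map_mul, map_mul, hθ, hθ']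
    ring
  have h2 : (a : K) * b' = a' * b := congrArg Subtype.val h1
  have hb0 : (b : K) ≠ 0 := fun h => hb (Subtype.ext h)
  have hb0' : (b' : K) ≠ 0 := fun h => hb' (Subtype.ext h)
  apply mul_right_cancel₀ (mul_ne_zero hb0 hb0')
  linear_combination b' * hab - b * hab' + h2

/-- Positive equivalence only provides some function that restricts to the coordinate; by uniqueness
it is the given one. -/
lemma ToricChart.PosEquiv.isPositive {θ : ToricChart A ι} {θ₀ : ToricChart A κ}
    (h : θ.PosEquiv θ₀) {j : κ} {f : K} (hf : θ₀.IsCoordinate j f) : θ.IsPositive f := by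
  obtain ⟨f', hf', hpos⟩ := h.2 j
  exact hf.unique hf' ▸ hpos

end Coordinates

/-! ### The Gelfand–Zeitlin chart -/

section Shift

variable {R : Type*} [CommRing R] {n : ℕ}

/-- The matrix that maps the `c`-th basis vector to the `(c + s)`-th one. -/
def shiftMat (R : Type*) [CommRing R] (n s : ℕ) : Matrix (Fin n) (Fin n) R :=
  Matrix.of fun r c => if (r : ℕ) = c + s then 1 else 0

lemma blk_shiftMat (R : Type*) [CommRing R] {n s a k : ℕ} (h : a + k + s ≤ n) :
    blk (shiftMat R n s) a k = blk 1 (a + s) k := by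
  induction k with
  | zero => simp
  | succ k ih =>
    rw [blk_succ, blk_succ, ih (by omega)]
    congr 2
    ext r
    have h1 : a + k < n := by omega
    have h2 : a + s + k < n := by omega
    have h3 : (r : ℕ) = a + k + s ↔ r = ⟨a + s + k, h2⟩ := by
      rw [Fin.ext_iff, show a + k + s = a + s + k by omega]
    simp [mcol, shiftMat, h1, h2, Matrix.one_apply, h3]

lemma intervalMinor_map {R' : Type*} [CommRing R'] (φ : R →+* R') (M : Matrix (Fin n) (Fin n) R)
    (x k : ℕ) : φ (intervalMinor M x k) = intervalMinor (M.map φ) x k := by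
  rw [intervalMinor, listDet_map, intervalMinor, List.map_append, ← blk_map, ← blk_map,
    Matrix.map_one _ (map_zero _) (map_one _)]

lemma intervalMinor_full (M : Matrix (Fin n) (Fin n) R) : intervalMinor M 0 n = M.det := by
  rw [intervalMinor, Nat.sub_self, blk_zero, List.nil_append, listDet_blk_full]

end Shift

section GelfandZeitlin

variable {n : ℕ}

lemma isLower_genericLower (l : Fin 3) : IsLower (genericLower n l) := by
  intro r c h
  simp [genericLower, not_le.2 h]

lemma genericLower_mem_iff {S : Subring (LowerField n)} :
    (∀ l r c, genericLower n l r c ∈ S) ↔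
      ∀ s, algebraMap (LowerPoly n) (LowerField n) (MvPolynomial.X s) ∈ S := by
  constructor
  · rintro h ⟨l, ⟨r, c⟩, hrc⟩
    have := h l r c
    rwa [genericLower, Matrix.of_apply, dif_pos hrc] at this
  · intro h l r c
    rw [genericLower, Matrix.of_apply]
    split_ifs
    exacts [h _, S.zero_mem]

/-- The generic matrix is specialized to the lower triangular shift that carries the columns x, …, x
+ k - 1 to the last k standard basis vectors. There the minor is 1. -/
lemma intervalMinor_genericLower_ne_zero (l : Fin 3) {x k : ℕ} (h : x + k ≤ n) :
    intervalMinor (genericLower n l) x k ≠ 0 := by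
  let P : Matrix (Fin n) (Fin n) (LowerPoly n) := Matrix.of fun r c =>
    if h : c ≤ r then MvPolynomial.X (l, ⟨(r, c), h⟩) else 0
  have hP : genericLower n l = P.map (algebraMap (LowerPoly n) (LowerField n)) := by
    ext r c
    simp only [genericLower, P, Matrix.of_apply, Matrix.map_apply]
    split_ifs <;> simp
  rw [hP, ← intervalMinor_map]
  intro h0
  rw [map_eq_zero_iff _ (IsFractionRing.injective _ _)] at h0
  let φ : LowerPoly n →+* ℂ :=
    MvPolynomial.eval fun s => if (s.2.1.1 : ℕ) = s.2.1.2 + (n - k - x) then 1 else 0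
  have hφ : P.map φ = shiftMat ℂ n (n - k - x) := by
    ext r c
    simp only [P, Matrix.of_apply, Matrix.map_apply, shiftMat]
    split_ifs with h1 h2 h2
    · simp [φ, h2]
    · simp [φ, h2]
    · exact absurd (Fin.le_def.2 (by omega)) h1
    · simp
  have h1 := congrArg φ h0
  rw [intervalMinor_map, hφ, map_zero, intervalMinor, blk_shiftMat _ (by omega),
    show x + (n - k - x) = n - k by omega, listDet_blk_one _ _ (by omega)] at h1
  exact one_ne_zero h1

lemma det_genericLower_ne_zero (l : Fin 3) : (genericLower n l).det ≠ 0 := by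
  rw [← intervalMinor_full]
  exact intervalMinor_genericLower_ne_zero l (by omega)

lemma gzCoord_eq {K : Type*} [Field K] (b : Matrix (Fin n) (Fin n) K) (x : GZIndex n) :
    gzCoord b x = intervalMinor b x.1.1 x.1.2 / intervalMinor b x.1.1 (x.1.2 - 1) := by
  obtain ⟨⟨i, j⟩, h1, h2⟩ := x
  simp only at h1 h2 ⊢
  rw [gzCoord, minor_opp_initial_interval _ h2, minor_opp_initial_interval _ (show i + (j - 1) ≤ n by omega)]
  rfl

lemma intervalMinor_mem_of_gzCoord {K : Type*} [Field K] {b : Matrix (Fin n) (Fin n) K}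
    {M : Submonoid K} (h0 : ∀ x k, x + k ≤ n → intervalMinor b x k ≠ 0)
    (h : ∀ x, gzCoord b x ∈ M) (x k : ℕ) (hx : x + k ≤ n) : intervalMinor b x k ∈ M := by
  induction k with
  | zero => rw [intervalMinor_zero]; exact M.one_mem
  | succ k ih =>
    have h1 := h ⟨(x, k + 1), by simp; omega⟩
    rw [gzCoord_eq] at h1
    simp only [Nat.add_sub_cancel] at h1
    have h2 := M.mul_mem h1 (ih (by omega))
    rwa [div_mul_cancel₀ _ (h0 x k (by omega))] at h2

lemma gzCoord_genericLower_ne_zero (x : Fin 3 × GZIndex n) :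
    gzCoord (genericLower n x.1) x.2 ≠ 0 := by
  obtain ⟨l, ⟨⟨i, j⟩, h1, h2⟩⟩ := x
  rw [gzCoord_eq]
  exact div_ne_zero (intervalMinor_genericLower_ne_zero l h2)
    (intervalMinor_genericLower_ne_zero l (le_trans (Nat.add_le_add_left (Nat.sub_le _ _) _) h2))

instance : Finite (GZIndex n) :=
  Finite.of_injective (β := Fin (n + 1) × Fin (n + 1))
    (fun x => (⟨x.1.1, by have := x.2; omega⟩, ⟨x.1.2, by have := x.2; omega⟩))
    (fun x y h => by
      simp only [Prod.mk.injEq, Fin.mk.injEq] at h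
      exact Subtype.ext (Prod.ext h.1 h.2))

lemma genericLower_mem_of_gzCoord {S : Subring (LowerField n)}
    (h : ∀ x : Fin 3 × GZIndex n, gzCoord (genericLower n x.1) x.2 ∈ unitsIn S) (l : Fin 3) :
    (∀ r c, genericLower n l r c ∈ S) ∧
      ∀ x k, x + k ≤ n → intervalMinor (genericLower n l) x k ∈ unitsIn S := by
  have h0 : ∀ x k, x + k ≤ n → intervalMinor (genericLower n l) x k ≠ 0 := fun x k =>
    intervalMinor_genericLower_ne_zero l
  have h1 := intervalMinor_mem_of_gzCoord h0 fun x => h (l, x)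
  exact ⟨entry_mem_of_intervalMinor (isLower_genericLower l) h0 (fun x k hx => (h1 x k hx).1)
    fun x k hx => (h1 x k hx).2, h1⟩

/-- The coordinates generate the function field, because the matrix entries are Laurent polynomials
in the interval minors, and these are products of coordinates. -/
lemma algebraicIndependent_gzCoord :
    AlgebraicIndependent ℂ fun x : Fin 3 × GZIndex n => gzCoord (genericLower n x.1) x.2 := by
  classical
  have := Fintype.ofFinite (GZIndex n)
  refine algebraicIndependent_of_generate ?_ ?_
  -- The index (i, j) goes to the upper left corner of its minor, in row n - j and column i.
  · refine Fintype.card_le_of_injective (fun x => (x.1, ⟨(⟨n - x.2.1.2, ?_⟩, ⟨x.2.1.1, ?_⟩), ?_⟩)) ?_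
    · have := x.2.2; omega
    · have := x.2.2; omega
    · have := x.2.2
      rw [Fin.le_def]
      simp only
      omega
    · rintro ⟨l, ⟨i, j⟩, h1, h2⟩ ⟨l', ⟨i', j'⟩, h1', h2'⟩ h
      simp only [Prod.mk.injEq, Subtype.mk.injEq, Fin.mk.injEq] at h h1 h2 h1' h2' ⊢
      omega
  · intro s
    set E := IntermediateField.adjoin ℂ
      (Set.range fun x : Fin 3 × GZIndex n => gzCoord (genericLower n x.1) x.2)
    have h1 := genericLower_mem_iff (S := E.toSubfield.toSubring).1 fun l =>
      (genericLower_mem_of_gzCoord (fun x => ?_) l).1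
    · exact h1 s
    · have : gzCoord (genericLower n x.1) x.2 ∈ E := IntermediateField.subset_adjoin _ _ ⟨x, rfl⟩
      exact ⟨this, E.inv_mem this⟩

lemma coordinateRing_mem {K : Type} [Field K] [Algebra ℂ K] (g : Fin 3 → Matrix (Fin n) (Fin n) K)
    (l : Fin 3) (r c : Fin n) : g l r c ∈ coordinateRing g :=
  Algebra.subset_adjoin ⟨l, r, c, Or.inl rfl⟩

/-- The torus is the locus where no interval minor vanishes. Their product is inverted, which clears
the denominators of the coordinates and of their inverses. -/
theorem exists_gzChart (n : ℕ) : ∃ θ₀ : ToricChart (coordinateRing (genericLower n))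
    (Fin 3 × GZIndex n), ∀ x, θ₀.IsCoordinate x (gzCoord (genericLower n x.1) x.2) := by
  have := Fintype.ofFinite (GZIndex n)
  set f := fun x : Fin 3 × GZIndex n => gzCoord (genericLower n x.1) x.2 with hfdef
  set A := coordinateRing (genericLower n) with hAdef
  have hf : ∀ x, f x ≠ 0 := gzCoord_genericLower_ne_zero
  have hind : AlgebraicIndependent ℂ f := algebraicIndependent_gzCoord
  have hgen := genericLower_mem_of_gzCoord (S := (laurentEval f hf).range.toSubring)
    fun x => ⟨mem_range_laurentEval hf x, inv_mem_range_laurentEval hf x⟩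
  have hA : A ≤ (laurentEval f hf).range := by
    refine Algebra.adjoin_le ?_
    rintro _ ⟨l, r, c, rfl | rfl⟩
    · exact (hgen l).1 r c
    · refine inv_entry_mem (hgen l).1 ?_ r c
      rw [← intervalMinor_full]
      exact ((hgen l).2 0 n (by omega)).2
  have hΔ : ∀ l x k, intervalMinor (genericLower n l) x k ∈ A := fun l x k =>
    intervalMinor_mem_subring (S := A.toSubring) (coordinateRing_mem _ l) x k
  set D : Fin 3 × GZIndex n → LowerField n := fun x =>
    intervalMinor (genericLower n x.1) x.2.1.1 x.2.1.2 with hD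
  have hD0 : ∀ x, D x ≠ 0 := fun x => intervalMinor_genericLower_ne_zero x.1 x.2.2.2
  have hquot : ∀ l x k, x + k ≤ n →
      (intervalMinor (genericLower n l) x k)⁻¹ * ∏ j, D j ∈ A := by
    intro l x k hx
    rcases Nat.eq_zero_or_pos k with rfl | hk
    · rw [intervalMinor_zero, inv_one, one_mul]
      exact A.prod_mem fun j _ => hΔ _ _ _
    · exact inv_mul_prod_mem (S := A.toSubring) (D := D) (fun _ => hΔ _ _ _) hD0
        (l, ⟨(x, k), hk, hx⟩)
  obtain ⟨θ, hθ⟩ := exists_toricChart hf hind hA (F := ∏ j, D j)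
    (A.prod_mem fun j _ => hΔ _ _ _) (Finset.prod_ne_zero_iff.2 fun j _ => hD0 j)
    ((unitsIn (laurentEval f hf).range.toSubring).prod_mem
      fun j _ => (hgen j.1).2 _ _ j.2.2.2).2 (by
      rintro ⟨l, ⟨i, j⟩, h1, h2⟩
      simp only at h1 h2
      simp only [hfdef, gzCoord_eq]
      constructor
      · rw [div_eq_mul_inv, mul_assoc]
        exact A.mul_mem (hΔ _ _ _) (hquot _ _ _ (by omega))
      · rw [inv_div, div_eq_mul_inv, mul_assoc]
        exact A.mul_mem (hΔ _ _ _) (hquot _ _ _ h2))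
  refine ⟨θ, fun x => isCoordinate_of_eval hf hind hθ x (hΔ _ _ _) (hΔ _ _ _) ?_ (gzCoord_eq _ _)⟩
  have := x.2.2
  exact intervalMinor_genericLower_ne_zero _ (by omega)

/-- The positive structure on triples of triangular matrices. -/
theorem cornerDet_genericLower_mem {ι : Type} {θ : ToricChart (coordinateRing (genericLower n)) ι}
    (h : ∀ x : Fin 3 × GZIndex n, θ.IsPositive (gzCoord (genericLower n x.1) x.2)) (p : Fin 4 → ℕ)
    (hp : ∑ b, p b = n) : cornerDet (prods (genericLower n)) p ∈ posSet θ := by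
  have hQ := isPositiveSet_posSet θ
  refine cornerDet_prods_mem_of_isLower hQ isLower_genericLower (fun l p q hpq => ?_) p hp
  refine flagMinor_mem hQ (isLower_genericLower l) ?_ hpq
  let M : Submonoid (LowerField n) :=
    { carrier := posSet θ
      one_mem' := ⟨one_ne_zero, θ.isPositive_one⟩
      mul_mem' := fun h h' => hQ.mul h h' }
  exact intervalMinor_mem_of_gzCoord (M := M)
    (fun x k => intervalMinor_genericLower_ne_zero l)
    fun x => ⟨gzCoord_genericLower_ne_zero (l, x), h (l, x)⟩

end GelfandZeitlin


/-! ### Normal forms under the action of unipotent matrices -/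

section TriangularInverse

variable {K : Type*} [Field K] {n : ℕ}

lemma IsLower.inv {L : Matrix (Fin n) (Fin n) K} (h : IsLower L) (hd : L.det ≠ 0) :
    IsLower L⁻¹ := by
  have : Invertible L := Matrix.invertibleOfIsUnitDet L (isUnit_iff_ne_zero.2 hd)
  have h1 : L.BlockTriangular OrderDual.toDual := fun r c hrc => h r c hrc
  have h2 := Matrix.blockTriangular_inv_of_blockTriangular h1
  exact fun r c hrc => h2 hrc

lemma IsLower.mul_apply_self {L N : Matrix (Fin n) (Fin n) K} (h : IsLower L) (h' : IsLower N)
    (i : Fin n) : (L * N) i i = L i i * N i i := by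
  rw [Matrix.mul_apply, Finset.sum_eq_single i]
  · intro k _ hk
    rcases lt_or_gt_of_ne hk with hk | hk
    · rw [h' k i hk, mul_zero]
    · rw [h i k hk, zero_mul]
  · simp

lemma IsUnipUpper.isLower_transpose {u : Matrix (Fin n) (Fin n) K} (hu : IsUnipUpper u) :
    IsLower u.transpose := fun r c h => hu.2 c r h

lemma IsUnipUpper.det {R : Type*} [CommRing R] {u : Matrix (Fin n) (Fin n) R}
    (hu : IsUnipUpper u) : u.det = 1 := by
  have := listDet_unip hu 1 n [] [] (by simp)
  rwa [List.nil_append, List.append_nil, one_mul, listDet_blk_full, List.nil_append,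
    List.append_nil, listDet_blk_full, Matrix.det_one] at this

lemma IsUnipUpper.inv {u : Matrix (Fin n) (Fin n) K} (hu : IsUnipUpper u) : IsUnipUpper u⁻¹ := by
  have hd : u.transpose.det ≠ 0 := by rw [Matrix.det_transpose, hu.det]; exact one_ne_zero
  have hl := hu.isLower_transpose
  have hli := hl.inv hd
  rw [← Matrix.transpose_nonsing_inv] at hli
  refine ⟨fun i => ?_, fun i j h => hli j i h⟩
  have h1 := hl.mul_apply_self hli i
  rw [← Matrix.transpose_mul, Matrix.nonsing_inv_mul _ (by rw [hu.det]; exact isUnit_one),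
    Matrix.transpose_one, Matrix.one_apply_eq, Matrix.transpose_apply, hu.1, one_mul] at h1
  exact h1.symm

lemma isUnipUpper_one {R : Type*} [CommRing R] : IsUnipUpper (1 : Matrix (Fin n) (Fin n) R) :=
  ⟨fun i => Matrix.one_apply_eq i, fun _ _ h => Matrix.one_apply_ne h.ne'⟩

/-- Gaussian elimination by columns. -/
lemma exists_isUnipUpper_mul_isLower {A : Matrix (Fin n) (Fin n) K}
    (h : ∀ k ≤ n, flagMinor A 0 k ≠ 0) : ∃ u, IsUnipUpper u ∧ IsLower (A * u) := by
  -- The first c columns of A are completed by the standard basis vectors from c on; the determinant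
  -- is a leading principal minor. Solving for column c of A expresses it by earlier columns and
  -- basis vectors from c on, and subtracting the former clears the rows above c.
  let B : Fin n → Matrix (Fin n) (Fin n) K := fun c =>
    Matrix.of fun r j => if j < c then A r j else (1 : Matrix (Fin n) (Fin n) K) r j
  have hB : ∀ c, IsUnit (B c).det := by
    intro c
    have hc := c.2
    have h1 := h c hc.le
    rw [flagMinor, blk_zero, List.nil_append, zero_add, Nat.sub_zero] at h1
    have h2 : blk A 0 c ++ blk 1 c (n - c) = blk (B c) 0 n := by
      have h3 := blk_append (B c) 0 c (n - c)
      rw [zero_add, show (c : ℕ) + (n - c) = n by omega] at h3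
      rw [← h3]
      congr 1
      · refine List.map_congr_left fun j hj => ?_
        have hj := List.mem_range'_1.1 hj
        have hjn : j < n := by omega
        have hjc : (⟨j, hjn⟩ : Fin n) < c := Fin.lt_def.2 (by simp only; omega)
        ext r
        simp [mcol, B, hjn, hjc]
      · refine List.map_congr_left fun j hj => ?_
        have hj := List.mem_range'_1.1 hj
        have hjn : j < n := by omega
        have hjc : ¬ (⟨j, hjn⟩ : Fin n) < c := by rw [Fin.lt_def]; simp only; omega
        ext r
        simp [mcol, B, hjn, hjc]
    rw [h2, listDet_blk_full] at h1
    exact isUnit_iff_ne_zero.2 h1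
  let y : Fin n → Fin n → K := fun c => (B c)⁻¹.mulVec fun r => A r c
  have hy : ∀ c r, A r c = ∑ j, B c r j * y c j := by
    intro c r
    have h1 : (B c).mulVec (y c) = fun r => A r c := by
      simp only [y]
      rw [Matrix.mulVec_mulVec, Matrix.mul_nonsing_inv _ (hB c), Matrix.one_mulVec]
    exact (congrFun h1 r).symm
  refine ⟨Matrix.of fun j c => if j < c then -y c j else if j = c then 1 else 0, ⟨fun i => by simp,
    fun i j hij => by simp [hij.not_gt, hij.ne']⟩, fun r c hrc => ?_⟩
  have h1 : ∀ j, A r j * (if j < c then -y c j else if j = c then 1 else 0) + B c r j * y c j =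
      if j = c then A r c else 0 := by
    intro j
    simp only [B, Matrix.of_apply]
    rcases lt_trichotomy j c with hj | rfl | hj
    · simp [hj, hj.ne]
    · simp [hrc.ne]
    · simp [hj.not_gt, hj.ne', (hrc.trans hj).ne]
  have h2 : ∑ j, (A r j * (if j < c then -y c j else if j = c then 1 else 0) + B c r j * y c j) =
      A r c := by
    rw [Finset.sum_congr rfl fun j _ => h1 j]
    simp
  rw [Finset.sum_add_distrib, ← hy] at h2
  rw [Matrix.mul_apply]
  simpa using h2

lemma signedAnti_apply (R : Type*) [CommRing R] (r c : Fin n) :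
    signedAnti R n r c = if c = r.rev then (-1) ^ (r : ℕ) else 0 := by
  have : (r : ℕ) + c + 1 = n ↔ c = r.rev := by
    rw [Fin.ext_iff, Fin.val_rev]
    omega
  simp [signedAnti, this]

lemma signedAnti_transpose_mul_apply {R : Type*} [CommRing R] (M : Matrix (Fin n) (Fin n) R)
    (r c : Fin n) :
    ((signedAnti R n).transpose * M) r c = (-1) ^ (r.rev : ℕ) * M r.rev c := by
  have : ∀ k : Fin n, r = k.rev ↔ k = r.rev := fun k =>
    ⟨fun h => by rw [h, Fin.rev_rev], fun h => by rw [h, Fin.rev_rev]⟩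
  simp [Matrix.mul_apply, signedAnti_apply, this]

lemma mul_signedAnti_apply {R : Type*} [CommRing R] (M : Matrix (Fin n) (Fin n) R) (r c : Fin n) :
    (M * signedAnti R n) r c = M r c.rev * (-1) ^ (c.rev : ℕ) := by
  have : ∀ k : Fin n, c = k.rev ↔ k = c.rev := fun k =>
    ⟨fun h => by rw [h, Fin.rev_rev], fun h => by rw [h, Fin.rev_rev]⟩
  simp [Matrix.mul_apply, signedAnti_apply, this]

lemma signedAnti_transpose_mul_signedAnti (R : Type*) [CommRing R] (n : ℕ) :
    (signedAnti R n).transpose * signedAnti R n = 1 := by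
  ext r c
  rw [signedAnti_transpose_mul_apply, signedAnti_apply, Fin.rev_rev, Matrix.one_apply]
  simp only [eq_comm (a := c)]
  split_ifs
  · rw [← mul_pow]
    simp
  · simp

/-- Reversing the order of the rows exchanges the minors on the first and on the last k rows. -/
lemma flagMinor_signedAnti_mul (A : Matrix (Fin n) (Fin n) K) {k : ℕ} (hk : k ≤ n) :
    flagMinor (signedAnti K n * A) 0 k = (signedAnti K n).det * intervalMinor A 0 k := by
  have h1 := listDet_anti_append (isAnti_signedAnti K n) (s := n - k)
    (l := blk (signedAnti K n * A) 0 k) (by simp; omega)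
  have h2 := listDet_map_mulVec (signedAnti K n) (blk 1 0 (n - k) ++ blk A 0 k) (by simp; omega)
  rw [List.map_append, ← blk_mul, ← blk_mul, mul_one, h1, antiMinor_signedAnti K n (by omega),
    one_mul, show n - (n - k) = k by omega] at h2
  rw [flagMinor, blk_zero, List.nil_append, zero_add, Nat.sub_zero, h2, intervalMinor]

/-- Elimination by rows and columns. -/
lemma exists_mul_mul_isAnti {A : Matrix (Fin n) (Fin n) K}
    (h : ∀ k ≤ n, intervalMinor A 0 k ≠ 0) :
    ∃ v u, IsUnipUpper v ∧ IsUnipUpper u ∧ IsAnti (v * A * u) := by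
  have hw := signedAnti_transpose_mul_signedAnti K n
  have hwd : (signedAnti K n).det ≠ 0 := by
    intro h0
    have h1 := congrArg Matrix.det hw
    rw [Matrix.det_mul, h0, mul_zero, Matrix.det_one] at h1
    exact zero_ne_one h1
  obtain ⟨u, hu, hL⟩ := exists_isUnipUpper_mul_isLower (A := signedAnti K n * A) fun k hk => by
    rw [flagMinor_signedAnti_mul A hk]
    exact mul_ne_zero hwd (h k hk)
  set L := signedAnti K n * A * u with hLdef
  have hLd : L.det ≠ 0 := by
    have h1 := h n le_rfl
    rw [intervalMinor_full] at h1
    rw [hLdef, Matrix.det_mul, Matrix.det_mul, hu.det, mul_one]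
    exact mul_ne_zero hwd h1
  have hLi := hL.inv hLd
  have hdiag : ∀ i, L i i * L⁻¹ i i = 1 := by
    intro i
    rw [← hL.mul_apply_self hLi, Matrix.mul_nonsing_inv _ (isUnit_iff_ne_zero.2 hLd),
      Matrix.one_apply_eq]
  let D : Matrix (Fin n) (Fin n) K := Matrix.diagonal fun i => L i i
  -- With w the signed antidiagonal matrix and L = w A u, the matrix D L⁻¹ is lower unipotent. Its
  -- conjugate v = wᵀ D L⁻¹ w is upper unipotent, and v A u = wᵀ D is antidiagonal.
  refine ⟨(signedAnti K n).transpose * (D * L⁻¹ * signedAnti K n), u, ⟨fun i => ?_,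
    fun i j hij => ?_⟩, hu, ?_⟩
  · rw [signedAnti_transpose_mul_apply, mul_signedAnti_apply, Matrix.diagonal_mul, hdiag, one_mul,
      ← mul_pow]
    simp
  · rw [signedAnti_transpose_mul_apply, mul_signedAnti_apply, Matrix.diagonal_mul,
      hLi _ _ (Fin.rev_lt_rev.2 hij)]
    simp
  · have h1 : (signedAnti K n).transpose * (D * L⁻¹ * signedAnti K n) * A * u =
        (signedAnti K n).transpose * D := by
      have h2 : L⁻¹ * L = 1 := Matrix.nonsing_inv_mul _ (isUnit_iff_ne_zero.2 hLd)
      rw [hLdef] at h2 ⊢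
      simp only [Matrix.mul_assoc] at h2 ⊢
      rw [h2, mul_one]
    rw [h1]
    intro r c hrc
    have hD : r.rev ≠ c → D r.rev c = 0 := fun h => Matrix.diagonal_apply_ne _ h
    rw [signedAnti_transpose_mul_apply, hD, mul_zero]
    intro h3
    apply hrc
    rw [← h3, Fin.val_rev]
    omega

end TriangularInverse

section NormalForm

variable {K : Type*} [Field K] {n : ℕ}

/-- The columns of m contribute a scalar and the last p 2 standard basis vectors. Together with the
first p 0 basis vectors and the columns of b₁ these form a flag minor. -/
lemma cornerDet_anti_fst {b₁ m b₃ : Matrix (Fin n) (Fin n) K} (hm : IsAnti m) {p : Fin 4 → ℕ}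
    (hp : ∑ b, p b = n) (h3 : p 3 = 0) :
    cornerDet ![1, b₁, m, b₃] p = antiMinor m (p 2) * flagMinor b₁ (p 0) (p 1) ∨
      cornerDet ![1, b₁, m, b₃] p = -(antiMinor m (p 2) * flagMinor b₁ (p 0) (p 1)) := by
  rw [Fin.sum_univ_four] at hp
  have h1 := listDet_anti_append hm (s := p 2) (l := blk 1 0 (p 0) ++ blk b₁ 0 (p 1))
    (by simp; omega)
  rw [flagMinor, show p 0 + p 1 = n - p 2 by omega, show n - p 0 - p 1 = p 2 by omega, ← h1]
  refine listDet_eq_or_neg ?_ (by simp [flat, blocks]; omega)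
  simp only [flat, blocks, h3, blk_zero, List.append_nil]
  exact List.perm_append_comm

lemma cornerDet_anti_snd {b₁ m b₃ : Matrix (Fin n) (Fin n) K} (hm : IsAnti m) {p : Fin 4 → ℕ}
    (hp : ∑ b, p b = n) (h1 : p 1 = 0) :
    cornerDet ![1, b₁, m, b₃] p = antiMinor m (p 2) * flagMinor b₃ (p 0) (p 3) ∨
      cornerDet ![1, b₁, m, b₃] p = -(antiMinor m (p 2) * flagMinor b₃ (p 0) (p 3)) := by
  rw [Fin.sum_univ_four] at hp
  have h2 := listDet_anti_append hm (s := p 2) (l := blk 1 0 (p 0) ++ blk b₃ 0 (p 3))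
    (by simp; omega)
  rw [flagMinor, show p 0 + p 3 = n - p 2 by omega, show n - p 0 - p 3 = p 2 by omega, ← h2]
  refine listDet_eq_or_neg ?_ (by simp [flat, blocks]; omega)
  simp only [flat, blocks, h1, blk_zero, List.append_nil]
  refine (List.perm_append_comm (l₁ := blk 1 0 (p 0)) (l₂ := blk m 0 (p 2))).append_right _ |>.trans
    ?_
  rw [List.append_assoc]
  exact List.Perm.refl _

/-- A common left factor v of determinant 1 is harmless, and so are unipotent column operations in
each block. In the first block, v * 1 is turned back into 1 by v⁻¹. -/
lemma cornerDet_normalize {v u₁ u₂ u₃ : Matrix (Fin n) (Fin n) K} (hv : IsUnipUpper v)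
    (h1 : IsUnipUpper u₁) (h2 : IsUnipUpper u₂) (h3 : IsUnipUpper u₃)
    (H₁ H₂ H₃ : Matrix (Fin n) (Fin n) K) {p : Fin 4 → ℕ} (hp : ∑ b, p b = n) :
    cornerDet ![1, v * H₁ * u₁, v * H₂ * u₂, v * H₃ * u₃] p = cornerDet ![1, H₁, H₂, H₃] p := by
  have hu : ∀ b, IsUnipUpper ((![v⁻¹, u₁, u₂, u₃] : Fin 4 → Matrix (Fin n) (Fin n) K) b) := by
    intro b
    fin_cases b
    exacts [hv.inv, h1, h2, h3]
  have e1 := cornerDet_unip (H := fun b => v * ![1, H₁, H₂, H₃] b) hu hp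
  rw [cornerDet_mul_left _ _ hp, hv.det, one_mul] at e1
  rw [← e1]
  congr 1
  ext1 b
  fin_cases b
  · change 1 = v * 1 * v⁻¹
    rw [mul_one, Matrix.mul_nonsing_inv _ (by rw [hv.det]; exact isUnit_one)]
  all_goals rfl

/-- The normal form of a triple of matrices with nonvanishing corner determinants. -/
lemma exists_normalForm {H₁ H₂ H₃ : Matrix (Fin n) (Fin n) K}
    (hne : ∀ p, ∑ b, p b = n → cornerDet ![1, H₁, H₂, H₃] p ≠ 0) :
    ∃ v u₁ u₂ u₃ : Matrix (Fin n) (Fin n) K, IsUnipUpper v ∧ IsUnipUpper u₁ ∧ IsUnipUpper u₂ ∧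
      IsUnipUpper u₃ ∧ IsLower (v * H₁ * u₁) ∧ IsAnti (v * H₂ * u₂) ∧ IsLower (v * H₃ * u₃) := by
  obtain ⟨v, u₂, hv, hu₂, hm⟩ := exists_mul_mul_isAnti (A := H₂) fun k hk => by
    have := hne ![n - k, 0, k, 0] (by rw [Fin.sum_univ_four]; simp; omega)
    simpa [cornerDet, flat, blocks, intervalMinor] using this
  -- Once the middle matrix is antidiagonal, this flag minor is a factor of a corner determinant
  -- without columns of 1. So elimination by columns applies, and it leaves v untouched.
  have h1 : ∀ k ≤ n, flagMinor (v * H₁) 0 k ≠ 0 := by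
    intro k hk h0
    have hs : ∑ b, (![0, k, n - k, 0] : Fin 4 → ℕ) b = n := by
      rw [Fin.sum_univ_four]; simp; omega
    have e := cornerDet_normalize hv isUnipUpper_one hu₂ isUnipUpper_one H₁ H₂ H₃ hs
    rw [mul_one] at e
    have e2 := cornerDet_anti_fst (b₁ := v * H₁) (b₃ := v * H₃ * 1) hm hs rfl
    simp only [Matrix.cons_val] at e2
    rw [h0, mul_zero, neg_zero, or_self, e] at e2
    exact hne _ hs e2
  have h3 : ∀ k ≤ n, flagMinor (v * H₃) 0 k ≠ 0 := by
    intro k hk h0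
    have hs : ∑ b, (![0, 0, n - k, k] : Fin 4 → ℕ) b = n := by
      rw [Fin.sum_univ_four]; simp; omega
    have e := cornerDet_normalize hv isUnipUpper_one hu₂ isUnipUpper_one H₁ H₂ H₃ hs
    rw [mul_one (v * H₃)] at e
    have e2 := cornerDet_anti_snd (b₁ := v * H₁ * 1) (b₃ := v * H₃) hm hs rfl
    simp only [Matrix.cons_val] at e2
    rw [h0, mul_zero, neg_zero, or_self, e] at e2
    exact hne _ hs e2
  obtain ⟨u₁, hu₁, hl₁⟩ := exists_isUnipUpper_mul_isLower h1
  obtain ⟨u₃, hu₃, hl₃⟩ := exists_isUnipUpper_mul_isLower h3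
  exact ⟨v, u₁, u₂, u₃, hv, hu₁, hu₂, hu₃, hl₁, hm, hl₃⟩

end NormalForm


/-! ### Invariants of `U⁴` -/

section Evaluation

variable {n : ℕ}

/-- The value of a polynomial at a triple of matrices. -/
def evalAt {R : Type*} [CommRing R] [Algebra ℂ R] (X : Fin 3 → Matrix (Fin n) (Fin n) R) :
    MatPoly n →ₐ[ℂ] R :=
  MvPolynomial.aeval fun s => X s.1 s.2.1 s.2.2

lemma map_evalAt {R R' : Type*} [CommRing R] [Algebra ℂ R] [CommRing R'] [Algebra ℂ R']
    (φ : R →ₐ[ℂ] R') (X : Fin 3 → Matrix (Fin n) (Fin n) R) (P : MatPoly n) :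
    φ (evalAt X P) = evalAt (fun l => (X l).map φ) P :=
  congrArg (fun f : MatPoly n →ₐ[ℂ] R' => f P) (MvPolynomial.comp_aeval _ φ)

lemma evalAt_mem {R : Type*} [CommRing R] [Algebra ℂ R] {S : Subalgebra ℂ R}
    {X : Fin 3 → Matrix (Fin n) (Fin n) R} (h : ∀ l r c, X l r c ∈ S) (P : MatPoly n) :
    evalAt X P ∈ S := by
  induction P using MvPolynomial.induction_on with
  | C a => rw [evalAt, MvPolynomial.aeval_C]; exact S.algebraMap_mem a
  | add p q hp hq => rw [map_add]; exact S.add_mem hp hq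
  | mul_X p s hp =>
    rw [map_mul]
    refine S.mul_mem hp ?_
    rw [evalAt, MvPolynomial.aeval_X]
    exact h _ _ _

lemma evalAt_genericGL (P : MatPoly n) :
    evalAt (genericGL n) P = algebraMap (MatPoly n) (GLField n) P := by
  have : evalAt (genericGL n) = IsScalarTower.toAlgHom ℂ (MatPoly n) (GLField n) := by
    apply MvPolynomial.algHom_ext
    intro s
    rw [evalAt, MvPolynomial.aeval_X]
    rfl
  rw [this]
  rfl

lemma IsUnipUpper.adjugate_mul {R : Type*} [CommRing R] {u : Matrix (Fin n) (Fin n) R}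
    (hu : IsUnipUpper u) : u.adjugate * u = 1 := by
  rw [Matrix.adjugate_mul, hu.det, one_smul]

lemma IsUnipUpper.mul_adjugate {R : Type*} [CommRing R] {u : Matrix (Fin n) (Fin n) R}
    (hu : IsUnipUpper u) : u * u.adjugate = 1 := by
  rw [Matrix.mul_adjugate, hu.det, one_smul]

/-- A unipotent matrix with given entries above the diagonal. -/
def unipOf {R : Type*} [CommRing R] (y : Fin n → Fin n → R) : Matrix (Fin n) (Fin n) R :=
  Matrix.of fun i j => if i < j then y i j else if i = j then 1 else 0

lemma isUnipUpper_unipOf {R : Type*} [CommRing R] (y : Fin n → Fin n → R) :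
    IsUnipUpper (unipOf y) :=
  ⟨fun i => by simp [unipOf], fun i j h => by simp [unipOf, h.not_gt, h.ne']⟩

lemma IsUnipUpper.eq_unipOf {R : Type*} [CommRing R] {u : Matrix (Fin n) (Fin n) R}
    (hu : IsUnipUpper u) : unipOf (fun i j => u i j) = u := by
  ext i j
  simp only [unipOf, Matrix.of_apply]
  split_ifs with h1 h2
  · rfl
  · rw [h2, hu.1]
  · exact (hu.2 i j (lt_of_le_of_ne (not_lt.1 h1) (Ne.symm h2))).symm

lemma unipOf_map {R R' : Type*} [CommRing R] [CommRing R'] (φ : R →+* R') (y : Fin n → Fin n → R) :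
    (unipOf y).map φ = unipOf fun i j => φ (y i j) := by
  ext i j
  simp only [unipOf, Matrix.map_apply, Matrix.of_apply]
  split_ifs <;> simp

/-- A polynomial that is invariant under the complex unipotent matrices is invariant under the
unipotent matrices with entries in any commutative algebra. -/
lemma evalAt_eq_of_invariant {P : MatPoly n}
    (hP : ∀ u : Fin 4 → GL (Fin n) ℂ, (∀ l, IsUnipotentUpper (u l)) → substHom u P = P)
    {R : Type} [CommRing R] [Algebra ℂ R] {U : Fin 4 → Matrix (Fin n) (Fin n) R}
    (hU : ∀ l, IsUnipUpper (U l)) {X X' : Fin 3 → Matrix (Fin n) (Fin n) R}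
    (hX : ∀ l : Fin 3, U l.castSucc * X l = X' l * U l.succ) : evalAt X' P = evalAt X P := by
  -- The variables are those of a universal quadruple of unipotent matrices and a universal triple.
  -- The adjugate serves as a polynomial inverse of a unipotent matrix.
  let τ := (Fin 4 × Fin n × Fin n) ⊕ (Fin 3 × Fin n × Fin n)
  let Y : Fin 4 → Matrix (Fin n) (Fin n) (MvPolynomial τ ℂ) := fun l =>
    unipOf fun i j => MvPolynomial.X (Sum.inl (l, i, j))
  let Z : Fin 3 → Matrix (Fin n) (Fin n) (MvPolynomial τ ℂ) := fun l =>
    Matrix.of fun i j => MvPolynomial.X (Sum.inr (l, i, j))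
  let Z' : Fin 3 → Matrix (Fin n) (Fin n) (MvPolynomial τ ℂ) := fun l =>
    Y l.castSucc * Z l * (Y l.succ).adjugate
  have hmap : ∀ {R' : Type} [CommRing R'] [Algebra ℂ R'] (φ : MvPolynomial τ ℂ →ₐ[ℂ] R') (l),
      (Z' l).map φ = (Y l.castSucc).map φ * (Z l).map φ * ((Y l.succ).map φ).adjugate := by
    intro R' _ _ φ l
    have h1 := φ.toRingHom.map_adjugate (Y l.succ)
    simp only [Z']
    rw [Matrix.map_mul, Matrix.map_mul]
    exact congrArg _ h1
  have key : evalAt Z' P = evalAt Z P := by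
    -- Polynomials over the infinite field ℂ may be compared at complex points, where the assumed
    -- invariance applies.
    apply MvPolynomial.funext
    intro z
    let φ : MvPolynomial τ ℂ →ₐ[ℂ] ℂ := MvPolynomial.aeval z
    have hφ : ∀ q, MvPolynomial.eval z q = φ q := fun q => by
      rw [← MvPolynomial.coe_aeval_eq_eval]; rfl
    rw [hφ, hφ, map_evalAt, map_evalAt]
    let v : Fin 4 → Matrix (Fin n) (Fin n) ℂ := fun l => (Y l).map φ
    have hv : ∀ l, IsUnipUpper (v l) := fun l => by
      have : v l = _ := unipOf_map φ.toRingHom _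
      rw [this]
      exact isUnipUpper_unipOf _
    let u : Fin 4 → GL (Fin n) ℂ := fun l =>
      ⟨v l, (v l).adjugate, (hv l).mul_adjugate, (hv l).adjugate_mul⟩
    have h1 := congrArg (evalAt fun l => (Z l).map φ) (hP u fun l => hv l)
    have h2 : substHom u = evalAt (fun l => constMat (u l.castSucc).val * polyMat n l *
      constMat (u l.succ)⁻¹.val) := rfl
    rw [h2, map_evalAt] at h1
    rw [← h1]
    congr 2
    ext1 l
    have h3 : ∀ M : Matrix (Fin n) (Fin n) ℂ,
        (constMat M).map (evalAt fun l => (Z l).map φ) = M := by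
      intro M
      ext i j
      exact (evalAt fun l => (Z l).map φ).commutes _
    have h4 : (polyMat n l).map (evalAt fun l => (Z l).map φ) = (Z l).map φ := by
      ext i j
      exact MvPolynomial.aeval_X _ _
    rw [hmap, Matrix.map_mul, Matrix.map_mul, h3, h3, h4]
    rfl
  -- The universal identity is specialized to the given matrices over R.
  let ψ : MvPolynomial τ ℂ →ₐ[ℂ] R :=
    MvPolynomial.aeval (Sum.elim (fun s => U s.1 s.2.1 s.2.2) fun s => X s.1 s.2.1 s.2.2)
  have h1 := congrArg ψ key
  rw [map_evalAt, map_evalAt] at h1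
  have hY : ∀ l, (Y l).map ψ = U l := fun l => by
    have : (Y l).map ψ = _ := unipOf_map ψ.toRingHom _
    refine this.trans (Eq.trans ?_ (hU l).eq_unipOf)
    congr 1
    ext i j
    exact MvPolynomial.aeval_X _ _
  have hZ : (fun l => (Z l).map ψ) = X := by
    ext l i j
    exact MvPolynomial.aeval_X _ _
  have hZ' : (fun l => (Z' l).map ψ) = X' := by
    ext1 l
    rw [hmap, hY, hY, congrFun hZ l, hX, Matrix.mul_assoc, (hU _).mul_adjugate, mul_one]
  rw [hZ, hZ'] at h1
  exact h1

end Evaluation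

section Invariants

variable {n : ℕ}

/-- The inner unipotent factors cancel in the partial products: U 0 times the b-th product of X is
the b-th product of X' times U b. -/
lemma cornerDet_prods_eq {R : Type*} [CommRing R] {U : Fin 4 → Matrix (Fin n) (Fin n) R}
    (hU : ∀ l, IsUnipUpper (U l)) {X X' : Fin 3 → Matrix (Fin n) (Fin n) R}
    (hX : ∀ l : Fin 3, U l.castSucc * X l = X' l * U l.succ) {p : Fin 4 → ℕ}
    (hp : ∑ b, p b = n) : cornerDet (prods X') p = cornerDet (prods X) p := by
  have h1 := cornerDet_unip (H := prods X') hU hp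
  have h2 := cornerDet_mul_left (U 0) (prods X) hp
  rw [(hU 0).det, one_mul] at h2
  rw [← h1, ← h2]
  congr 1
  have x0 : U 0 * X 0 = X' 0 * U 1 := hX 0
  have x1 : U 1 * X 1 = X' 1 * U 2 := hX 1
  have x2 : U 2 * X 2 = X' 2 * U 3 := hX 2
  ext1 b
  fin_cases b
  · change 1 * U 0 = U 0 * 1
    rw [one_mul, mul_one]
  · exact x0.symm
  · change X' 0 * X' 1 * U 2 = U 0 * (X 0 * X 1)
    rw [← Matrix.mul_assoc, x0, Matrix.mul_assoc, Matrix.mul_assoc, x1]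
  · change X' 0 * X' 1 * X' 2 * U 3 = U 0 * (X 0 * X 1 * X 2)
    rw [← Matrix.mul_assoc, ← Matrix.mul_assoc, x0, Matrix.mul_assoc _ (U 1), x1,
      Matrix.mul_assoc _ _ (U 3), ← x2]
    simp only [Matrix.mul_assoc]

lemma constMat_isUnipUpper {u : GL (Fin n) ℂ} (hu : IsUnipotentUpper u) :
    IsUnipUpper (constMat u.val) :=
  ⟨fun i => by rw [constMat, Matrix.map_apply, hu.1, map_one],
    fun i j h => by rw [constMat, Matrix.map_apply, hu.2 i j h, map_zero]⟩

lemma act_algebraMap (u : Fin 4 → GL (Fin n) ℂ) (P : MatPoly n) :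
    act u (algebraMap _ (GLField n) P) = algebraMap _ (GLField n) (substHom u P) :=
  IsFractionRing.algEquivOfAlgEquiv_algebraMap _ _

lemma substHom_cornerDet {u : Fin 4 → GL (Fin n) ℂ} (hu : ∀ l, IsUnipotentUpper (u l))
    {p : Fin 4 → ℕ} (hp : ∑ b, p b = n) :
    substHom u (cornerDet (prods (polyMat n)) p) = cornerDet (prods (polyMat n)) p := by
  have h1 := cornerDet_map (substHom u).toRingHom (prods (polyMat n)) p
  rw [prods_map] at h1
  refine h1.trans (cornerDet_prods_eq (U := fun l => constMat (u l).val)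
    (fun l => constMat_isUnipUpper (hu l)) (fun l => ?_) hp)
  have h2 : (polyMat n l).map (substHom u).toRingHom = _ := substHom_polyMat u l
  rw [h2, Matrix.mul_assoc _ (constMat (u l.succ)⁻¹.val), ← constMat_mul, ← Units.val_mul,
    inv_mul_cancel, Units.val_one, constMat_one, mul_one]

lemma prods_genericGL (p : Fin 4 → ℕ) :
    cornerDet (prods (genericGL n)) p =
      algebraMap _ (GLField n) (cornerDet (prods (polyMat n)) p) := by
  rw [cornerDet_map, prods_map]
  rfl

lemma mem_invariantRing_iff {f : GLField n} : f ∈ invariantRing n ↔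
    f ∈ coordinateRing (genericGL n) ∧
      ∀ u : Fin 4 → GL (Fin n) ℂ, (∀ l, IsUnipotentUpper (u l)) → act u f = f := by
  rw [invariantRing, Algebra.mem_inf, Algebra.mem_iInf]
  refine and_congr_right fun _ => ⟨fun h u hu => h ⟨u, hu⟩, fun h u => h u.1 u.2⟩

lemma cornerDet_genericGL_mem {p : Fin 4 → ℕ} (hp : ∑ b, p b = n) :
    cornerDet (prods (genericGL n)) p ∈ invariantRing n := by
  rw [mem_invariantRing_iff]
  constructor
  · have h1 := coordinateRing_mem (genericGL n)
    refine cornerDet_mem_subring (S := (coordinateRing (genericGL n)).toSubring) (fun b => ?_) p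
    fin_cases b
    · exact one_entry_mem
    · exact h1 0
    · exact mul_entry_mem (h1 0) (h1 1)
    · exact mul_entry_mem (mul_entry_mem (h1 0) (h1 1)) (h1 2)
  · intro u hu
    rw [prods_genericGL, act_algebraMap, substHom_cornerDet hu hp]

lemma multiCorner_genericGL_mem (α : Fin 3 → ℤ) :
    multiCorner (genericGL n) α ∈ invariantRing n := by
  by_cases h : α ∈ simplex n
  · rw [multiCorner_eq _ h]
    exact cornerDet_genericGL_mem (sum_mult h)
  · rw [multiCorner_of_notMem _ h]
    exact (invariantRing n).zero_mem

lemma shiftMat_mul (R : Type*) [CommRing R] (a b : ℕ) :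
    shiftMat R n a * shiftMat R n b = shiftMat R n (a + b) := by
  ext r c
  rw [Matrix.mul_apply]
  simp only [shiftMat, Matrix.of_apply, mul_ite, mul_one, mul_zero]
  rw [Finset.sum_congr rfl (g := fun k : Fin n => if (k : ℕ) = c + b then
    (if (r : ℕ) = c + (a + b) then (1 : R) else 0) else 0)]
  · rcases lt_or_ge ((c : ℕ) + b) n with h | h
    · rw [Finset.sum_eq_single ⟨c + b, h⟩]
      · simp
      · intro k _ hk
        exact if_neg fun h => hk (Fin.ext h)
      · simp
    · have hr := r.2
      rw [if_neg (by omega)]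
      simp
  · intro k _
    split_ifs <;> first | rfl | omega

/-- The three matrices are specialized to shifts by p 0, p 1, p 2. Then the four blocks consist of
consecutive standard basis vectors, and the determinant is 1. -/
lemma cornerDet_genericGL_ne_zero {p : Fin 4 → ℕ} (hp : ∑ b, p b = n) :
    cornerDet (prods (genericGL n)) p ≠ 0 := by
  rw [prods_genericGL]
  intro h0
  rw [map_eq_zero_iff _ (IsFractionRing.injective _ _)] at h0
  let X : Fin 3 → Matrix (Fin n) (Fin n) ℂ := fun l => shiftMat ℂ n (p l.castSucc)
  have h1 := congrArg (evalAt X).toRingHom h0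
  rw [cornerDet_map, prods_map, map_zero] at h1
  have h2 : (fun l => (polyMat n l).map (evalAt X).toRingHom) = X := by
    ext l r c
    exact MvPolynomial.aeval_X _ _
  rw [Fin.sum_univ_four] at hp
  have e1 : prods X 1 = shiftMat ℂ n (p 0) := rfl
  have e2 : prods X 2 = shiftMat ℂ n (p 0 + p 1) := shiftMat_mul _ _ _
  have e3 : prods X 3 = shiftMat ℂ n (p 0 + p 1 + p 2) := by
    rw [← shiftMat_mul, ← e2]; rfl
  have e0 : prods X 0 = 1 := rfl
  rw [h2, cornerDet] at h1
  simp only [flat, blocks, e0, e1, e2, e3] at h1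
  rw [blk_shiftMat _ (by omega), blk_shiftMat _ (by omega), blk_shiftMat _ (by omega), zero_add,
    zero_add, zero_add] at h1
  have b1 := blk_append (1 : Matrix (Fin n) (Fin n) ℂ) 0 (p 0) (p 1)
  have b2 := blk_append (1 : Matrix (Fin n) (Fin n) ℂ) 0 (p 0 + p 1) (p 2)
  have b3 := blk_append (1 : Matrix (Fin n) (Fin n) ℂ) 0 (p 0 + p 1 + p 2) (p 3)
  rw [zero_add] at b1 b2 b3
  rw [b1, b2, b3, hp, listDet_blk_full, Matrix.det_one] at h1
  exact one_ne_zero h1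

end Invariants


/-! ### The chart on `GL_n³ // U⁴` -/

section NormalFormEntries

variable {K : Type*} [Field K] {n : ℕ} {S : Subring K}

lemma neg_mem_unitsIn {x : K} (h : x ∈ unitsIn S) : -x ∈ unitsIn S :=
  ⟨S.neg_mem h.1, by rw [inv_neg]; exact S.neg_mem h.2⟩

lemma mem_unitsIn_of_mul {x y : K} (hx : x ∈ unitsIn S) (hx0 : x ≠ 0) (hxy : x * y ∈ unitsIn S) :
    y ∈ unitsIn S := by
  have h := (unitsIn S).mul_mem (show x⁻¹ ∈ unitsIn S from ⟨hx.2, by rw [inv_inv]; exact hx.1⟩) hxy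
  rwa [inv_mul_cancel_left₀ hx0] at h

lemma mem_unitsIn_of_eq_or {x y : K} (h : x = y ∨ x = -y) (hx : x ∈ unitsIn S) :
    y ∈ unitsIn S := by
  rcases h with rfl | rfl
  · exact hx
  · exact neg_neg y ▸ neg_mem_unitsIn hx

lemma antiMinor_full {R : Type*} [CommRing R] (m : Matrix (Fin n) (Fin n) R) :
    antiMinor m n = m.det := by
  rw [antiMinor, Nat.sub_self, blk_zero, List.append_nil, listDet_blk_full]

/-- The entries of a normal form are Laurent polynomials in its corner determinants. -/
lemma normalForm_mem {b₁ m b₃ : Matrix (Fin n) (Fin n) K} (h₁ : IsLower b₁) (hm : IsAnti m)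
    (h₃ : IsLower b₃) (hne : ∀ p, ∑ b, p b = n → cornerDet ![1, b₁, m, b₃] p ≠ 0)
    (h : ∀ p, ∑ b, p b = n → p 1 = 0 ∨ p 3 = 0 → cornerDet ![1, b₁, m, b₃] p ∈ unitsIn S) :
    ((∀ r c, b₁ r c ∈ S) ∧ (∀ r c, m r c ∈ S) ∧ ∀ r c, b₃ r c ∈ S) ∧
      b₁.det ∈ unitsIn S ∧ m.det ∈ unitsIn S ∧ b₁.det ≠ 0 ∧ m.det ≠ 0 := by
  have s1 : ∀ p i, p + i ≤ n → ∑ b, (![p, i, n - p - i, 0] : Fin 4 → ℕ) b = n := fun p i h => by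
    rw [Fin.sum_univ_four]; simp; omega
  have s3 : ∀ p i, p + i ≤ n → ∑ b, (![p, 0, n - p - i, i] : Fin 4 → ℕ) b = n := fun p i h => by
    rw [Fin.sum_univ_four]; simp; omega
  have e1 : ∀ p i, p + i ≤ n → antiMinor m (n - p - i) * flagMinor b₁ p i ∈ unitsIn S ∧
      antiMinor m (n - p - i) * flagMinor b₁ p i ≠ 0 := by
    intro p i hp
    have h1 := cornerDet_anti_fst (b₁ := b₁) (b₃ := b₃) hm (s1 p i hp) rfl
    refine ⟨mem_unitsIn_of_eq_or h1 (h _ (s1 p i hp) (Or.inr rfl)), fun h0 => ?_⟩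
    simp only [Matrix.cons_val] at h1
    rw [h0, neg_zero, or_self] at h1
    exact hne _ (s1 p i hp) h1
  have e3 : ∀ p i, p + i ≤ n → antiMinor m (n - p - i) * flagMinor b₃ p i ∈ unitsIn S ∧
      antiMinor m (n - p - i) * flagMinor b₃ p i ≠ 0 := by
    intro p i hp
    have h1 := cornerDet_anti_snd (b₁ := b₁) (b₃ := b₃) hm (s3 p i hp) rfl
    refine ⟨mem_unitsIn_of_eq_or h1 (h _ (s3 p i hp) (Or.inl rfl)), fun h0 => ?_⟩
    simp only [Matrix.cons_val] at h1
    rw [h0, neg_zero, or_self] at h1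
    exact hne _ (s3 p i hp) h1
  -- On the edge without columns of b₁ the flag minor is 1, which isolates the antidiagonal factor.
  -- Dividing by it yields the flag minors of b₁ and b₃.
  have a : ∀ j ≤ n, antiMinor m j ∈ unitsIn S ∧ antiMinor m j ≠ 0 := by
    intro j hj
    have h1 := e1 (n - j) 0 (by omega)
    rwa [flagMinor_zero _ (by omega), mul_one, show n - (n - j) - 0 = j by omega] at h1
  have f1 : ∀ p i, p + i ≤ n → flagMinor b₁ p i ∈ unitsIn S := fun p i hp =>
    mem_unitsIn_of_mul (a _ (by omega)).1 (a _ (by omega)).2 (e1 p i hp).1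
  have f3 : ∀ p i, p + i ≤ n → flagMinor b₃ p i ∈ unitsIn S := fun p i hp =>
    mem_unitsIn_of_mul (a _ (by omega)).1 (a _ (by omega)).2 (e3 p i hp).1
  have n1 : ∀ p i, p + i ≤ n → flagMinor b₁ p i ≠ 0 := fun p i hp =>
    right_ne_zero_of_mul (e1 p i hp).2
  refine ⟨⟨entry_mem_of_flagMinor h₁ n1 (fun p i hp => (f1 p i hp).1) fun p i hp => (f1 p i hp).2,
    fun r c => ?_, entry_mem_of_flagMinor h₃ (fun p i hp => right_ne_zero_of_mul (e3 p i hp).2)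
      (fun p i hp => (f3 p i hp).1) fun p i hp => (f3 p i hp).2⟩, ?_, ?_, ?_, ?_⟩
  · by_cases hrc : (r : ℕ) + c + 1 = n
    · have h1 := antiMinor_succ hm c.2
      have h2 : (⟨n - 1 - c, by omega⟩ : Fin n) = r := Fin.ext (by simp only; omega)
      rw [h2, mul_comm] at h1
      have h3 := mem_of_mul_eq h1.symm (a c (by omega)).1.2 (a c (by omega)).2
        (a (c + 1) (by omega)).1.1
      rcases neg_one_pow_eq_or K (n - 1 - c) with h4 | h4
      · rwa [h4, one_mul] at h3
      · rw [h4, neg_one_mul] at h3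
        exact neg_neg (m r c) ▸ S.neg_mem h3
    · rw [hm r c hrc]
      exact S.zero_mem
  · exact flagMinor_full b₁ ▸ f1 0 n (by omega)
  · exact antiMinor_full m ▸ (a n le_rfl).1
  · exact flagMinor_full b₁ ▸ n1 0 n (by omega)
  · exact antiMinor_full m ▸ (a n le_rfl).2

end NormalFormEntries

section Chart

variable {n : ℕ}

/-- The only point of the two faces without an index is α = 0, where all columns come from the
identity block and the minor is 1. -/
lemma cornerDet_prods_of_face {R : Type*} [CommRing R] {g : Fin 3 → Matrix (Fin n) (Fin n) R}
    {P : R → Prop} (h1 : P 1) (h : ∀ α : FaceIndex n, P (multiCorner g α.1)) {p : Fin 4 → ℕ}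
    (hp : ∑ b, p b = n) (hf : p 1 = 0 ∨ p 3 = 0) : P (cornerDet (prods g) p) := by
  have hp' := hp
  rw [Fin.sum_univ_four] at hp'
  by_cases h0 : p 0 = n
  · have e : cornerDet (prods g) p = 1 := by
      have q1 : p 1 = 0 := by omega
      have q2 : p 2 = 0 := by omega
      have q3 : p 3 = 0 := by omega
      simp only [cornerDet, flat, blocks, h0, q1, q2, q3, blk_zero, List.append_nil]
      rw [listDet_blk_full]
      exact Matrix.det_one
    rwa [e]
  · obtain ⟨α, a0, a1, a2⟩ : ∃ α : Fin 3 → ℤ, α 0 = p 1 ∧ α 1 = p 2 ∧ α 2 = p 3 :=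
      ⟨![p 1, p 2, p 3], rfl, rfl, rfl⟩
    rw [← multiCorner_of_mult g hp a0 a1 a2]
    refine h ⟨α, ⟨fun l => ?_, by omega⟩, by omega, ?_⟩
    · fin_cases l
      exacts [by simp [a0], by simp [a1], by simp [a2]]
    · rintro rfl
      simp only [Pi.zero_apply] at a0 a1 a2
      omega

lemma multiCorner_face_ne_zero (α : FaceIndex n) : multiCorner (genericGL n) α.1 ≠ 0 := by
  rw [multiCorner_eq _ α.2.1]
  exact cornerDet_genericGL_ne_zero (sum_mult α.2.1)

lemma genericGL_mem_iff {S : Subring (GLField n)} : (∀ l r c, genericGL n l r c ∈ S) ↔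
    ∀ s, algebraMap (MatPoly n) (GLField n) (MvPolynomial.X s) ∈ S :=
  ⟨fun h s => h s.1 s.2.1 s.2.2, fun h l r c => h (l, r, c)⟩

lemma det_prods_genericGL_ne_zero :
    (genericGL n 0 * genericGL n 1 * genericGL n 2).det ≠ 0 := by
  have hs : ∑ b, (![0, 0, 0, n] : Fin 4 → ℕ) b = n := by rw [Fin.sum_univ_four]; simp
  have := cornerDet_genericGL_ne_zero hs
  simpa [cornerDet, flat, blocks, prods, listDet_blk_full] using this

lemma det_genericGL_ne_zero (l : Fin 3) : (genericGL n l).det ≠ 0 := by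
  have := det_prods_genericGL_ne_zero (n := n)
  rw [Matrix.det_mul, Matrix.det_mul] at this
  fin_cases l
  · exact left_ne_zero_of_mul (left_ne_zero_of_mul this)
  · exact right_ne_zero_of_mul (left_ne_zero_of_mul this)
  · exact right_ne_zero_of_mul this

/-- Regular functions on `GL_n³` are quotients of polynomials by powers of the determinant. -/
lemma exists_mul_det_pow {f : GLField n} (hf : f ∈ coordinateRing (genericGL n)) :
    ∃ (N : ℕ) (P : MatPoly n),
      f * (genericGL n 0 * genericGL n 1 * genericGL n 2).det ^ N = algebraMap _ _ P := by
  let B := (algebraMap (MatPoly n) (GLField n)).range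
  have hB : ∀ l r c, genericGL n l r c ∈ B := fun l r c => ⟨_, rfl⟩
  set d := (genericGL n 0 * genericGL n 1 * genericGL n 2).det with hd
  have hdB : d ∈ B := det_mem (mul_entry_mem (mul_entry_mem (hB 0) (hB 1)) (hB 2))
  suffices ∃ N : ℕ, f * d ^ N ∈ B by
    obtain ⟨N, P, hP⟩ := this
    exact ⟨N, P, hP.symm⟩
  induction hf using Algebra.adjoin_induction with
  | mem x hx =>
    obtain ⟨l, r, c, rfl | rfl⟩ := hx
    · exact ⟨0, by rw [pow_zero, mul_one]; exact hB l r c⟩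
    -- An entry of the inverse becomes polynomial after multiplication by the determinant of its own
    -- matrix, which divides the determinant of the triple product.
    · refine ⟨1, ?_⟩
      have h1 : (genericGL n l)⁻¹ r c * (genericGL n l).det ∈ B := by
        have h3 : (genericGL n l).adjugate = (polyMat n l).adjugate.map (algebraMap _ _) :=
          ((algebraMap (MatPoly n) (GLField n)).map_adjugate (polyMat n l)).symm
        rw [Matrix.inv_def, Ring.inverse_eq_inv', Matrix.smul_apply, smul_eq_mul, mul_comm,
          mul_inv_cancel_left₀ (det_genericGL_ne_zero l), h3]
        exact ⟨_, rfl⟩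
      have h2 : ∀ l, (genericGL n l).det ∈ B := fun l => det_mem (hB l)
      have h3 : ∃ e ∈ B, d = (genericGL n l).det * e := by
        rw [hd, Matrix.det_mul, Matrix.det_mul]
        fin_cases l
        · exact ⟨_, B.mul_mem (h2 1) (h2 2), by simp only [Fin.zero_eta]; ring⟩
        · exact ⟨_, B.mul_mem (h2 0) (h2 2), by simp only [Fin.mk_one]; ring⟩
        · exact ⟨_, B.mul_mem (h2 0) (h2 1), by simp only [Fin.reduceFinMk]; ring⟩
      obtain ⟨e, he, hde⟩ := h3
      rw [pow_one, hde, ← mul_assoc]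
      exact B.mul_mem h1 he
  | algebraMap r =>
    refine ⟨0, MvPolynomial.C r, ?_⟩
    rw [pow_zero, mul_one, IsScalarTower.algebraMap_apply ℂ (MatPoly n)]
    rfl
  | add x y _ _ hx hy =>
    obtain ⟨N, hN⟩ := hx
    obtain ⟨N', hN'⟩ := hy
    refine ⟨N + N', ?_⟩
    have := B.add_mem (B.mul_mem hN (B.pow_mem hdB N')) (B.mul_mem hN' (B.pow_mem hdB N))
    rwa [show x * d ^ N * d ^ N' + y * d ^ N' * d ^ N = (x + y) * d ^ (N + N') by ring] at this
  | mul x y _ _ hx hy =>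
    obtain ⟨N, hN⟩ := hx
    obtain ⟨N', hN'⟩ := hy
    refine ⟨N + N', ?_⟩
    have := B.mul_mem hN hN'
    rwa [show x * d ^ N * (y * d ^ N') = x * y * d ^ (N + N') by ring] at this

/-- The normal form of the generic point. -/
lemma exists_normalForm_genericGL (n : ℕ) :
    ∃ (U : Fin 4 → Matrix (Fin n) (Fin n) (GLField n)) (b₁ m b₃ : Matrix (Fin n) (Fin n) (GLField n)),
      (∀ l, IsUnipUpper (U l)) ∧ IsLower b₁ ∧ IsAnti m ∧ IsLower b₃ ∧
      U 0 * genericGL n 0 * U 1 = b₁ ∧ U 0 * (genericGL n 0 * genericGL n 1) * U 2 = m ∧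
      U 0 * (genericGL n 0 * genericGL n 1 * genericGL n 2) * U 3 = b₃ ∧
      ∀ p, ∑ b, p b = n → cornerDet ![1, b₁, m, b₃] p = cornerDet (prods (genericGL n)) p := by
  obtain ⟨v, u₁, u₂, u₃, hv, h1, h2, h3, hl₁, hm, hl₃⟩ := exists_normalForm
    (H₁ := genericGL n 0) (H₂ := genericGL n 0 * genericGL n 1)
    (H₃ := genericGL n 0 * genericGL n 1 * genericGL n 2)
    fun p hp => cornerDet_genericGL_ne_zero hp
  refine ⟨![v, u₁, u₂, u₃], _, _, _, fun l => ?_, hl₁, hm, hl₃, rfl, rfl, rfl,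
    fun p hp => cornerDet_normalize hv h1 h2 h3 _ _ _ hp⟩
  fin_cases l
  exacts [hv, h1, h2, h3]

/-- Invariant functions are Laurent polynomials in the functions on two faces. -/
theorem invariantRing_le {S : Subalgebra ℂ (GLField n)}
    (h : ∀ α : FaceIndex n, multiCorner (genericGL n) α.1 ∈ unitsIn S.toSubring) :
    invariantRing n ≤ S := by
  intro f hf
  rw [mem_invariantRing_iff] at hf
  obtain ⟨hf, hinv⟩ := hf
  obtain ⟨N, P, hP⟩ := exists_mul_det_pow hf
  set d := (genericGL n 0 * genericGL n 1 * genericGL n 2).det with hd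
  have hs : ∑ b, (![0, 0, 0, n] : Fin 4 → ℕ) b = n := by rw [Fin.sum_univ_four]; simp
  have hdc : cornerDet (prods (genericGL n)) ![0, 0, 0, n] = d := by
    simp [cornerDet, flat, blocks, prods, listDet_blk_full, hd]
  have hface : ∀ p, ∑ b, p b = n → p 1 = 0 ∨ p 3 = 0 →
      cornerDet (prods (genericGL n)) p ∈ unitsIn S.toSubring := fun p hp hf =>
    cornerDet_prods_of_face (P := fun x => x ∈ unitsIn S.toSubring)
      (unitsIn S.toSubring).one_mem h hp hf
  -- The determinant of the triple product is itself an invariant corner determinant, so the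
  -- numerator inherits the invariance of f.
  have hPinv : ∀ u : Fin 4 → GL (Fin n) ℂ, (∀ l, IsUnipotentUpper (u l)) → substHom u P = P := by
    intro u hu
    apply IsFractionRing.injective (MatPoly n) (GLField n)
    rw [← act_algebraMap, ← hP, map_mul, map_pow, hinv u hu, ← hdc,
      (mem_invariantRing_iff.1 (cornerDet_genericGL_mem hs)).2 u hu]
  obtain ⟨U, b₁, m, b₃, hU, hb₁, hm, hb₃, e1, e2, e3, hc⟩ := exists_normalForm_genericGL n
  obtain ⟨⟨m1, m2, m3⟩, d1, d2, z1, z2⟩ := normalForm_mem (S := S.toSubring) hb₁ hm hb₃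
    (fun p hp => by rw [hc p hp]; exact cornerDet_genericGL_ne_zero hp)
    fun p hp hf => by rw [hc p hp]; exact hface p hp hf
  have hU' : ∀ l, IsUnit (U l).det := fun l => by rw [(hU l).det]; exact isUnit_one
  have z1' := isUnit_iff_ne_zero.2 z1
  have z2' := isUnit_iff_ne_zero.2 z2
  -- The numerator may be evaluated at the triple with partial products b₁, m, b₃. The unipotent
  -- matrices have entries in the function field, so invariance under complex matrices alone would
  -- not suffice.
  have key := evalAt_eq_of_invariant hPinv (U := ![U 0, (U 1)⁻¹, (U 2)⁻¹, (U 3)⁻¹])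
    (X := genericGL n) (X' := ![b₁, b₁⁻¹ * m, m⁻¹ * b₃]) (fun l => by
      fin_cases l
      exacts [hU 0, (hU 1).inv, (hU 2).inv, (hU 3).inv]) (fun l => by
      fin_cases l
      · change U 0 * genericGL n 0 = b₁ * (U 1)⁻¹
        rw [← e1, Matrix.mul_nonsing_inv_cancel_right _ _ (hU' 1)]
      · change (U 1)⁻¹ * genericGL n 1 = b₁⁻¹ * m * (U 2)⁻¹
        rw [← e2, Matrix.mul_assoc b₁⁻¹, Matrix.mul_nonsing_inv_cancel_right _ _ (hU' 2)]
        rw [← Matrix.nonsing_inv_mul_cancel_left b₁ ((U 1)⁻¹ * genericGL n 1) z1']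
        congr 1
        rw [← e1, ← Matrix.mul_assoc, Matrix.mul_nonsing_inv_cancel_right _ _ (hU' 1),
          Matrix.mul_assoc]
      · change (U 2)⁻¹ * genericGL n 2 = m⁻¹ * b₃ * (U 3)⁻¹
        rw [← e3, Matrix.mul_assoc m⁻¹, Matrix.mul_nonsing_inv_cancel_right _ _ (hU' 3)]
        rw [← Matrix.nonsing_inv_mul_cancel_left m ((U 2)⁻¹ * genericGL n 2) z2']
        congr 1
        rw [← e2, ← Matrix.mul_assoc, Matrix.mul_nonsing_inv_cancel_right _ _ (hU' 2),
          Matrix.mul_assoc])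
  have hPS : algebraMap (MatPoly n) (GLField n) P ∈ S := by
    rw [← evalAt_genericGL, ← key]
    refine evalAt_mem (fun l => ?_) P
    fin_cases l
    · exact m1
    · exact mul_entry_mem (S := S.toSubring) (inv_entry_mem m1 d1.2) m2
    · exact mul_entry_mem (S := S.toSubring) (inv_entry_mem m2 d2.2) m3
  have hdS : d ∈ unitsIn S.toSubring := hdc ▸ hface _ hs (Or.inl rfl)
  have hd0 : d ≠ 0 := det_prods_genericGL_ne_zero
  exact mem_of_mul_eq (S := S.toSubring) hP ((unitsIn S.toSubring).pow_mem hdS N).2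
    (pow_ne_zero N hd0) hPS

instance : Finite (FaceIndex n) :=
  Finite.of_injective (β := Fin 3 → Fin (n + 1))
    (fun α l => ⟨(α.1 l).toNat, by
      obtain ⟨h0, hs⟩ := α.2.1
      have a0 := h0 0
      have a1 := h0 1
      have a2 := h0 2
      fin_cases l <;> simp <;> omega⟩)
    (fun α β h => by
      refine Subtype.ext (funext fun l => ?_)
      have h1 := congrFun h l
      simp only [Fin.mk.injEq] at h1
      have h2 := α.2.1.1 l
      have h3 := β.2.1.1 l
      omega)

/-- The entries above the diagonal. -/
abbrev UpperIndex (n : ℕ) : Type := {x : Fin n × Fin n // x.1 < x.2}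

/-- The place of an index among the entries of three matrices. -/
def facePlace (n : ℕ) : FaceIndex n ⊕ (Fin 4 × UpperIndex n) → ℤ × ℤ × ℤ :=
  Sum.elim
    (fun α => if α.1 2 ≠ 0 then (0, n - α.1 2, α.1 1) else
      if α.1 0 ≠ 0 then (1, n - α.1 0, α.1 1) else (2, α.1 1 - 1, α.1 1 - 1))
    fun x => if x.1 = 3 then (2, x.2.1.2, x.2.1.1) else (x.1, x.2.1.1, x.2.1.2)

/-- The two faces off their common edge occupy the lower triangles, with diagonal, of the first two
matrices, and the common edge occupies the diagonal of the third. The four unipotent matrices take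
the three strict upper triangles and the strict lower triangle of the third matrix. -/
lemma facePlace_bounds (x : FaceIndex n ⊕ (Fin 4 × UpperIndex n)) :
    0 ≤ (facePlace n x).1 ∧ (facePlace n x).1 < 3 ∧ 0 ≤ (facePlace n x).2.1 ∧
      (facePlace n x).2.1 < n ∧ 0 ≤ (facePlace n x).2.2 ∧ (facePlace n x).2.2 < n := by
  rcases x with ⟨α, ⟨h0, hs⟩, hf, hα⟩ | ⟨l, ⟨r, c⟩, hrc⟩
  · have a0 := h0 0
    have a1 := h0 1
    have a2 := h0 2
    have hne : α 0 ≠ 0 ∨ α 1 ≠ 0 ∨ α 2 ≠ 0 := by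
      by_contra! h
      exact hα (funext fun l => by fin_cases l; exacts [h.1, h.2.1, h.2.2])
    simp only [facePlace, Sum.elim_inl]
    split_ifs <;> refine ⟨?_, ?_, ?_, ?_, ?_, ?_⟩ <;> simp only <;> omega
  · have h1 : (r : ℕ) < c := hrc
    simp only [facePlace, Sum.elim_inr]
    split_ifs with h
    · refine ⟨?_, ?_, ?_, ?_, ?_, ?_⟩ <;> simp only <;> omega
    · have h2 : (l : ℕ) ≠ 3 := fun h' => h (Fin.ext h')
      refine ⟨?_, ?_, ?_, ?_, ?_, ?_⟩ <;> simp only <;> omega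

lemma facePlace_injective : Function.Injective (facePlace n) := by
  have key : ∀ (α : FaceIndex n) (x : Fin 4 × UpperIndex n),
      facePlace n (Sum.inl α) ≠ facePlace n (Sum.inr x) := by
    rintro ⟨α, ⟨h0, hs⟩, hf, hα⟩ ⟨l, ⟨r, c⟩, hrc⟩ h
    have h1 : (r : ℕ) < c := hrc
    have a1 := h0 1
    have a0 := h0 0
    have a2 := h0 2
    have h4 : l ≠ 3 → (l : ℕ) ≠ 3 := fun h h' => h (Fin.ext h')
    simp only [facePlace, Sum.elim_inl, Sum.elim_inr] at h
    split_ifs at h <;> simp only [Prod.mk.injEq] at h <;> omega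
  rintro (α | x) (β | y) h
  · obtain ⟨α, ⟨h0, hs⟩, hf, hα⟩ := α
    obtain ⟨β, ⟨h0', hs'⟩, hf', hβ⟩ := β
    congr 2
    simp only [facePlace, Sum.elim_inl] at h
    have h3 : α 0 = β 0 ∧ α 1 = β 1 ∧ α 2 = β 2 := by
      split_ifs at h <;> simp only [Prod.mk.injEq] at h <;> omega
    ext l
    fin_cases l
    exacts [h3.1, h3.2.1, h3.2.2]
  · exact absurd h (key α y)
  · exact absurd h.symm (key β x)
  · obtain ⟨l, ⟨r, c⟩, hrc⟩ := x
    obtain ⟨l', ⟨r', c'⟩, hrc'⟩ := y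
    have h1 : (r : ℕ) < c := hrc
    have h1' : (r' : ℕ) < c' := hrc'
    have h3 : ∀ l : Fin 4, l = 3 → (l : ℕ) = 3 := fun l h => by rw [h]; rfl
    have h4 : ∀ l : Fin 4, l ≠ 3 → (l : ℕ) ≠ 3 := fun l h h' => h (Fin.ext h')
    have h5 : (l : ℕ) = l' ∧ (r : ℕ) = r' ∧ (c : ℕ) = c' := by
      have i3 := h3 l
      have i4 := h4 l
      have i3' := h3 l'
      have i4' := h4 l'
      simp only [facePlace, Sum.elim_inr] at h
      split_ifs at h <;> simp only [Prod.mk.injEq] at h <;> omega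
    obtain ⟨h5, h6, h7⟩ := h5
    obtain rfl := Fin.ext h5
    obtain rfl := Fin.ext h6
    obtain rfl := Fin.ext h7
    rfl

/-- The count behind it is (n² + 2n) + 4 · n(n-1)/2 = 3n²: face functions and the dimension of U⁴
add up to the dimension of GL_n³. -/
lemma card_faceIndex_le [Fintype (FaceIndex n)] :
    Fintype.card (FaceIndex n ⊕ (Fin 4 × UpperIndex n)) ≤
      Fintype.card (Fin 3 × Fin n × Fin n) := by
  have hb := facePlace_bounds (n := n)
  refine Fintype.card_le_of_injective (fun x => (⟨(facePlace n x).1.toNat, ?_⟩,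
    ⟨(facePlace n x).2.1.toNat, ?_⟩, ⟨(facePlace n x).2.2.toNat, ?_⟩)) fun x y h => ?_
  · have := hb x
    omega
  · have := hb x
    omega
  · have := hb x
    omega
  · have hx := hb x
    have hy := hb y
    simp only [Prod.mk.injEq, Fin.mk.injEq] at h
    apply facePlace_injective
    refine Prod.ext ?_ (Prod.ext ?_ ?_) <;> omega

/-- The face functions determine the normal form, and the entries of the four unipotent matrices
then recover the generic triple. So both together generate the function field, and by the count they
are independent. -/
lemma algebraicIndependent_multiCorner :
    AlgebraicIndependent ℂ fun α : FaceIndex n => multiCorner (genericGL n) α.1 := by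
  have := Fintype.ofFinite (FaceIndex n)
  obtain ⟨U, b₁, m, b₃, hU, hb₁, hm, hb₃, e1, e2, e3, hc⟩ := exists_normalForm_genericGL n
  let f : FaceIndex n ⊕ (Fin 4 × UpperIndex n) → GLField n :=
    Sum.elim (fun α => multiCorner (genericGL n) α.1) fun x => U x.1 x.2.1.1 x.2.1.2
  suffices AlgebraicIndependent ℂ f from this.comp Sum.inl Sum.inl_injective
  refine algebraicIndependent_of_generate card_faceIndex_le ?_
  set E := IntermediateField.adjoin ℂ (Set.range f)
  let S : Subring (GLField n) := E.toSubfield.toSubring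
  have hinv : ∀ {M : Matrix (Fin n) (Fin n) (GLField n)}, (∀ r c, M r c ∈ S) →
      ∀ r c, M⁻¹ r c ∈ S := fun h => inv_entry_mem h (E.inv_mem (det_mem (S := S) h))
  have hfE : ∀ x, f x ∈ E := fun x => IntermediateField.subset_adjoin _ _ ⟨x, rfl⟩
  have hface : ∀ p, ∑ b, p b = n → p 1 = 0 ∨ p 3 = 0 →
      cornerDet (prods (genericGL n)) p ∈ unitsIn S := fun p hp hf =>
    cornerDet_prods_of_face (P := fun x => x ∈ unitsIn S) (unitsIn S).one_mem
      (fun α => ⟨hfE (Sum.inl α), E.inv_mem (hfE (Sum.inl α))⟩) hp hf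
  obtain ⟨⟨m1, m2, m3⟩, -⟩ := normalForm_mem (S := S) hb₁ hm hb₃
    (fun p hp => by rw [hc p hp]; exact cornerDet_genericGL_ne_zero hp)
    fun p hp hf => by rw [hc p hp]; exact hface p hp hf
  have hUS : ∀ l r c, U l r c ∈ S := by
    intro l r c
    rcases lt_trichotomy r c with h | rfl | h
    · exact hfE (Sum.inr (l, ⟨(r, c), h⟩))
    · rw [(hU l).1]
      exact S.one_mem
    · rw [(hU l).2 r c h]
      exact S.zero_mem
  have hU' : ∀ l, IsUnit (U l).det := fun l => by rw [(hU l).det]; exact isUnit_one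
  have hH : ∀ {H M : Matrix (Fin n) (Fin n) (GLField n)} (l), U 0 * H * U l = M →
      (∀ r c, M r c ∈ S) → ∀ r c, H r c ∈ S := by
    rintro H _ l rfl hM
    have h1 := mul_entry_mem (mul_entry_mem (hinv (hUS 0)) hM) (hinv (hUS l))
    rwa [← Matrix.mul_assoc, ← Matrix.mul_assoc, Matrix.mul_nonsing_inv_cancel_right _ _ (hU' l),
      Matrix.nonsing_inv_mul _ (hU' 0), one_mul] at h1
  have g0 := hH 1 e1 m1
  have g01 := hH 2 e2 m2
  have g012 := hH 3 e3 m3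
  have hd : ∀ l, IsUnit (genericGL n l).det := fun l =>
    isUnit_iff_ne_zero.2 (det_genericGL_ne_zero l)
  have g1 := mul_entry_mem (hinv g0) g01
  rw [Matrix.nonsing_inv_mul_cancel_left _ _ (hd 0)] at g1
  have g2 := mul_entry_mem (hinv g01) g012
  rw [Matrix.nonsing_inv_mul_cancel_left _ _ (by rw [Matrix.det_mul]; exact (hd 0).mul (hd 1))] at g2
  refine genericGL_mem_iff (S := S).1 fun l => ?_
  fin_cases l
  exacts [g0, g1, g2]

/-- The face functions are regular themselves, so the chart is the locus where their product does
not vanish. -/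
theorem exists_faceChart (n : ℕ) : ∃ θ₀ : ToricChart (invariantRing n) (FaceIndex n),
    ∀ α : FaceIndex n, θ₀.IsCoordinate α (multiCorner (genericGL n) α.1) := by
  have := Fintype.ofFinite (FaceIndex n)
  set f := fun α : FaceIndex n => multiCorner (genericGL n) α.1 with hfdef
  have hf : ∀ α, f α ≠ 0 := multiCorner_face_ne_zero
  have hind : AlgebraicIndependent ℂ f := algebraicIndependent_multiCorner
  have hu : ∀ α, f α ∈ unitsIn (laurentEval f hf).range.toSubring := fun α =>
    ⟨mem_range_laurentEval hf α, inv_mem_range_laurentEval hf α⟩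
  have hA : ∀ α, f α ∈ invariantRing n := fun α => multiCorner_genericGL_mem α.1
  obtain ⟨θ, hθ⟩ := exists_toricChart hf hind (invariantRing_le hu) (F := ∏ α, f α)
    ((invariantRing n).prod_mem fun α _ => hA α) (Finset.prod_ne_zero_iff.2 fun α _ => hf α)
    ((unitsIn (laurentEval f hf).range.toSubring).prod_mem fun α _ => hu α).2 fun α =>
      ⟨(invariantRing n).mul_mem (hA α) ((invariantRing n).prod_mem fun α _ => hA α),
        inv_mul_prod_mem (S := (invariantRing n).toSubring) hA hf α⟩
  exact ⟨θ, fun α => isCoordinate_of_eval hf hind hθ α (hA α) (invariantRing n).one_mem one_ne_zero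
    (div_one _).symm⟩

/-- The positive structure on `GL_n³ // U⁴`. -/
theorem cornerDet_genericGL_mem_posSet {ι : Type} {θ : ToricChart (invariantRing n) ι}
    (h : ∀ α : FaceIndex n, θ.IsPositive (multiCorner (genericGL n) α.1)) (p : Fin 4 → ℕ)
    (hp : ∑ b, p b = n) : cornerDet (prods (genericGL n)) p ∈ posSet θ :=
  cornerDet_mem (isPositiveSet_posSet θ)
    (fun _ hp hf => cornerDet_prods_of_face (P := fun x => x ∈ posSet θ)
      ⟨one_ne_zero, θ.isPositive_one⟩ (fun α => ⟨multiCorner_face_ne_zero α, h α⟩) hp hf) p hp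

end Chart

end MultiHorn

end

/-! ### The main theorem -/

open MultiHorn in
theorem mainTheorem6 (n : ℕ) :
    -- the variety `GL_n³ // U⁴` with the potential `Φ₃`
    ((∀ α, multiCorner (genericGL n) α ∈ invariantRing n) ∧
      ∃ θ₀ : ToricChart (invariantRing n) (FaceIndex n),
        (∀ α : FaceIndex n, θ₀.IsCoordinate α (multiCorner (genericGL n) α.1)) ∧
        ∀ (ι : Type) [Finite ι] (θ : ToricChart (invariantRing n) ι), θ.PosEquiv θ₀ →
          θ.IsPositive (potential (genericGL n)) ∧
          (∀ α, θ.IsPositive (multiCorner (genericGL n) α)) ∧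
          ∀ ξ : ι → ℝ,
            OctahedronRecurrence (fun α => θ.trop (multiCorner (genericGL n) α) ξ) ∧
            (θ.trop (potential (genericGL n)) ξ ≤ 0 ↔
              RhombusInequalities n (fun α => θ.trop (multiCorner (genericGL n) α) ξ))) ∧
    -- the variety `B_-³` with the potential `Φ₃`
    (∃ θ₀ : ToricChart (coordinateRing (genericLower n)) (Fin 3 × GZIndex n),
        (∀ x, θ₀.IsCoordinate x (gzCoord (genericLower n x.1) x.2)) ∧
        ∀ (ι : Type) [Finite ι] (θ : ToricChart (coordinateRing (genericLower n)) ι),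
          θ.PosEquiv θ₀ →
          θ.IsPositive (potential (genericLower n)) ∧
          (∀ α, θ.IsPositive (multiCorner (genericLower n) α)) ∧
          ∀ ξ : ι → ℝ,
            θ.trop (potential (genericLower n)) ξ ≤ 0 →
              RhombusInequalities n (fun α => θ.trop (multiCorner (genericLower n) α) ξ)) := by
  refine ⟨⟨multiCorner_genericGL_mem, ?_⟩, ?_⟩
  · obtain ⟨θ₀, hθ₀⟩ := exists_faceChart n
    refine ⟨θ₀, hθ₀, fun ι _ θ hθ => ?_⟩
    -- Positivity in an equivalent chart requires only that the coordinates of the distinguished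
    -- chart are positive there; the octahedron relation supplies the other minors.
    have hM := cornerDet_genericGL_mem_posSet fun α => hθ.isPositive (hθ₀ α)
    exact ⟨isPositive_potential det_genericGL_ne_zero hM, isPositive_multiCorner hM,
      fun ξ => ⟨octahedronRecurrence_trop hM ξ,
        trop_potential_nonpos_iff det_genericGL_ne_zero hM ξ⟩⟩
  · obtain ⟨θ₀, hθ₀⟩ := exists_gzChart n
    refine ⟨θ₀, hθ₀, fun ι _ θ hθ => ?_⟩
    have hM := cornerDet_genericLower_mem fun x => hθ.isPositive (hθ₀ x)
    exact ⟨isPositive_potential det_genericLower_ne_zero hM, isPositive_multiCorner hM,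
      fun ξ => (trop_potential_nonpos_iff det_genericLower_ne_zero hM ξ).1⟩
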